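/- **Theorem (Clustering with more centers).** Notation: for a finite set $P\subseteq\mathbb{R}^d$ ($d\ge 1$) with weights $w:P\to\{1,2,\dots\}$ (unweighted means $w\equiv 1$) and a finite nonempty set $C\subseteq\mathbb{R}^d$, let $$\nu_C(P)=\sum_{p\in P}w(p)\,\mathbf{d}(p,C),\qquad \mu_C(P)=\sum_{p\in P}w(p)\,\mathbf{d}(p,C)^2,\qquad \mathbf{d}(p,C)=\min_{x\in C}\|p-x\|,$$ and let $\nu_{\mathrm{opt}}(P,k)$, $\mu_{\mathrm{opt}}(P,k)$ be the minima of $\nu_C(P)$, $\mu_C(P)$ over all $C\subseteq\mathbb{R}^d$ with $|C|=k$. Algorithms are programs of a randomized unit-cost real RAM: registers and memory cells hold real numbers, memory is addressed indirectly by arbitrary natural numbers (so that hashing takes constant time) and is initially $0$ outside the input, and the unit-time operations are integer constants, copying, $+,-,\times,/$, $\sqrt{\cdot}$, $\log$, the floor function, comparisons, and drawing a uniformly random integer from $\{0,\dots,N\}$ for a computed $N$. The input is $n$, $k$, and the coordinates (and weights) of the $n$ points of $P$. Fix $d\ge 1$ and $\varepsilon_0>0$ (the exponent in "with high probability"). The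 constants in $O(\cdot)$ below may depend only on $d$, $\varepsilon_0$ and, for running times in the unweighted case, on $a$. 1. *(Unweighted.)* There is an algorithm that, given any set $P$ of $n\ge 2$ points in $\mathbb{R}^d$ and any integer $k\ge 1$, computes with probability at least $1-n^{-\varepsilon_0}$ a nonempty set $X\subseteq\mathbb{R}^d$ of $O(k\log^3 n)$ centers such that simultaneously $$\mu_X(P)\le 32\,\mu_{\mathrm{opt}}(P,k)\quad\text{and}\quad \nu_X(P)\le 32\,\nu_{\mathrm{opt}}(P,k).$$ For every constant $a\ge 1$, the expected running time of this algorithm is $O(n)$ if $k\le a\,n^{1/4}$, and $O(n\log(k\log n))$ otherwise. 2. *(Weighted.)* There is an algorithm that, given any set $P$ of $n$ points in $\mathbb{R}^d$ with positive integer weights of total weight $W\ge 2$ and any integer $k\ge 1$, computes with probability at least $1-W^{-\varepsilon_0}$ a nonempty set $X\subseteq\mathbb{R}^d$ of $O(k\log^3 W)$ centers such that simultaneously $\mu_X(P)\le 32\,\mu_{\mathrm{opt}}(P,k)$ and $\nu_X(P)\le 32\,\nu_{\mathrm{opt}}(P,k)$. Its expected running time is $O(n\log^2 W)$. -/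

import Mathlib

open scoped ENNReal

noncomputable section

namespace KClustering

/-! ## Clustering prices -/

/-- The space `ℝᵈ` with its Euclidean distance. -/
abbrev Pt (d : ℕ) : Type := EuclideanSpace ℝ (Fin d)

/-- The price `ν_C(P)` of the `k`-median clustering provided by `C` for the points `p i` with
weights `w i`. For a nonempty finite `C`, `Metric.infDist x C` is the minimum distance from `x`
to a point of `C`. -/
def medianPrice {d n : ℕ} (p : Fin n → Pt d) (w : Fin n → ℕ) (C : Finset (Pt d)) : ℝ :=
  ∑ i, (w i : ℝ) * Metric.infDist (p i) (C : Set (Pt d))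

/-- The price `μ_C(P)` of the `k`-means clustering provided by `C`. -/
def meansPrice {d n : ℕ} (p : Fin n → Pt d) (w : Fin n → ℕ) (C : Finset (Pt d)) : ℝ :=
  ∑ i, (w i : ℝ) * Metric.infDist (p i) (C : Set (Pt d)) ^ 2

/-- `ν_opt(P, k)`: the optimal price of a `k`-median clustering, over all sets of `k` centers
in `ℝᵈ`. -/
def medianOpt {d n : ℕ} (p : Fin n → Pt d) (w : Fin n → ℕ) (k : ℕ) : ℝ :=
  ⨅ C : {C : Finset (Pt d) // C.card = k}, medianPrice p w C.1

/-- `μ_opt(P, k)`: the optimal price of a `k`-means clustering, over all sets of `k` centers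
in `ℝᵈ`. -/
def meansOpt {d n : ℕ} (p : Fin n → Pt d) (w : Fin n → ℕ) (k : ℕ) : ℝ :=
  ⨅ C : {C : Finset (Pt d) // C.card = k}, meansPrice p w C.1

/-! ## The randomized unit-cost real RAM -/

/-- The store of the machine: registers and memory cells, each holding a real number. -/
structure Store where
  reg : ℕ → ℝ
  mem : ℕ → ℝ

/-- Assignment to register `i`. -/
def Store.setReg (σ : Store) (i : ℕ) (x : ℝ) : Store :=
  { σ with reg := Function.update σ.reg i x }

/-- Assignment to memory cell `a`. -/
def Store.setMem (σ : Store) (a : ℕ) (x : ℝ) : Store :=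
  { σ with mem := Function.update σ.mem a x }

/-- Unary operations on real numbers. -/
inductive UnOp
  | copy | floor | log | sqrt

def UnOp.eval : UnOp → ℝ → ℝ
  | .copy, x => x
  | .floor, x => (⌊x⌋ : ℝ)
  | .log, x => Real.log x
  | .sqrt, x => Real.sqrt x

/-- Binary operations on real numbers. -/
inductive BinOp
  | add | sub | mul | div

def BinOp.eval : BinOp → ℝ → ℝ → ℝ
  | .add, x, y => x + y
  | .sub, x, y => x - y
  | .mul, x, y => x * y
  | .div, x, y => x / y

/-- The elementary instructions. The only constants a program may contain are integers. -/
inductive Instr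
  /-- `reg i := z` -/
  | const (i : ℕ) (z : ℤ)
  /-- `reg i := o (reg j)` -/
  | unop (o : UnOp) (i j : ℕ)
  /-- `reg i := o (reg j) (reg l)` -/
  | binop (o : BinOp) (i j l : ℕ)
  /-- `reg i := mem ⌊reg j⌋₊` (indirect addressing) -/
  | load (i j : ℕ)
  /-- `mem ⌊reg i⌋₊ := reg j` (indirect addressing) -/
  | store (i j : ℕ)
  /-- `reg i :=` a fresh uniformly random integer from `{0, …, ⌊reg j⌋₊}` -/
  | rand (i j : ℕ)

/-- The (random) effect of an elementary instruction. -/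
def Instr.run : Instr → Store → PMF Store
  | .const i z, σ => PMF.pure (σ.setReg i (z : ℝ))
  | .unop o i j, σ => PMF.pure (σ.setReg i (o.eval (σ.reg j)))
  | .binop o i j l, σ => PMF.pure (σ.setReg i (o.eval (σ.reg j) (σ.reg l)))
  | .load i j, σ => PMF.pure (σ.setReg i (σ.mem ⌊σ.reg j⌋₊))
  | .store i j, σ => PMF.pure (σ.setMem ⌊σ.reg i⌋₊ (σ.reg j))
  | .rand i j, σ =>
      (PMF.uniformOfFintype (Fin (⌊σ.reg j⌋₊ + 1))).map fun u => σ.setReg i ((u : ℕ) : ℝ)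

/-- Programs. The tests of conditionals and loops are comparisons `reg i < reg j`. -/
inductive Prog
  | exec (I : Instr)
  | seq (P Q : Prog)
  | cond (i j : ℕ) (P Q : Prog)
  | loop (i j : ℕ) (P : Prog)

/-- A configuration: the stack of programs that remain to be executed, and the store. The
machine has halted when the stack is empty. -/
abbrev Config : Type := List Prog × Store

/-- One step of the machine. A halted machine stays as it is. -/
def step : Config → PMF Config
  | ([], σ) => PMF.pure ([], σ)
  | (.exec I :: K, σ) => (I.run σ).map fun τ => (K, τ)
  | (.seq P Q :: K, σ) => PMF.pure (P :: Q :: K, σ)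
  | (.cond i j P Q :: K, σ) =>
      if σ.reg i < σ.reg j then PMF.pure (P :: K, σ) else PMF.pure (Q :: K, σ)
  | (.loop i j P :: K, σ) =>
      if σ.reg i < σ.reg j then PMF.pure (P :: .loop i j P :: K, σ) else PMF.pure (K, σ)

/-- The distribution of the configuration after `t` steps of `P` started on the store `σ`. -/
def runFor (P : Prog) (σ : Store) : ℕ → PMF Config
  | 0 => PMF.pure ([P], σ)
  | t + 1 => (runFor P σ t).bind step

/-- The expected running time `E[T] = ∑ₜ Pr[T > t]`, where `T` is the number of steps until the
machine halts; it is `∞` if the machine fails to halt with positive probability. -/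
def expectedTime (P : Prog) (σ : Store) : ℝ≥0∞ :=
  ∑' t : ℕ, (runFor P σ t).toOuterMeasure {c | c.1 ≠ []}

/-- The probability that `P`, started on `σ`, halts in a store that satisfies `Q`. (The
probabilities of having done so within `t` steps increase with `t`.) -/
def haltProb (P : Prog) (σ : Store) (Q : Store → Prop) : ℝ≥0∞ :=
  ⨆ t : ℕ, (runFor P σ t).toOuterMeasure {c | c.1 = [] ∧ Q c.2}

/-! ## Input and output conventions -/

/-- The memory holding the points `p 0, …, p (n - 1)`: coordinate `j` of `p i` is in cell
`i * d + j`, and cell `n * d + i` holds `v i`. All other cells hold `0`. -/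
def inputMem {d n : ℕ} (p : Fin n → Pt d) (v : Fin n → ℝ) (a : ℕ) : ℝ :=
  if h : a < n * d then
    p ⟨a / d, Nat.div_lt_of_lt_mul (by rwa [Nat.mul_comm] at h)⟩
      ⟨a % d, Nat.mod_lt _ (Nat.pos_of_ne_zero (by rintro rfl; simp at h))⟩
  else if h : a - n * d < n then v ⟨a - n * d, h⟩
  else 0

/-- The initial store: `n` in register `0`, `k` in register `1`, all other registers `0`, and
the points with their attached numbers `v` in memory. -/
def inputStore {d n : ℕ} (k : ℕ) (p : Fin n → Pt d) (v : Fin n → ℝ) : Store where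
  reg i := if i = 0 then (n : ℝ) else if i = 1 then (k : ℝ) else 0
  mem := inputMem p v

/-- The initial store of the unweighted problem. -/
def input {d n : ℕ} (k : ℕ) (p : Fin n → Pt d) : Store :=
  inputStore k p fun _ => 0

/-- The initial store of the weighted problem. -/
def weightedInput {d n : ℕ} (k : ℕ) (p : Fin n → Pt d) (w : Fin n → ℕ) : Store :=
  inputStore k p fun i => (w i : ℝ)

/-- The set of points a halted machine outputs: register `0` holds their number, register `1`
the address of an array with their coordinates. -/
def output (d : ℕ) (σ : Store) : Finset (Pt d) :=
  open Classical in
  (Finset.range ⌊σ.reg 0⌋₊).image fun i =>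
    WithLp.toLp 2 fun j : Fin d => σ.mem (⌊σ.reg 1⌋₊ + (i * d + (j : ℕ)))

/-- `X` is a nonempty set of at most `s` centers whose `k`-means price and whose `k`-median
price are both within a factor `32` of the optimal prices for `k` centers. -/
def IsGoodCenters {d n : ℕ} (p : Fin n → Pt d) (w : Fin n → ℕ) (k : ℕ) (s : ℝ)
    (X : Finset (Pt d)) : Prop :=
  X.Nonempty ∧ (X.card : ℝ) ≤ s ∧
    meansPrice p w X ≤ 32 * meansOpt p w k ∧ medianPrice p w X ≤ 32 * medianOpt p w k

end KClustering

end

/-! The centers are sampled in rounds. Let `P` be the points still alive, of weight `W`, and let `L`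
be an integer slightly above the logarithm of the initial weight. A round draws a sample `X` of
order `k * L` and then a fresh test sample of order `L`, both in proportion to the weights, and
takes for `r` a median distance from the test points to `X`. A grid of side `r` yields a set of
points to discard: it contains every alive point within `r` of `X`, and each of its points is within
`2 * d * r` of `X`. The points of `X` become centers, and the next round continues with the rest.
With high probability at least an eighth of the weight lies at distance at most `r` and at least an
eighth at distance at least `r`. So the weight falls by the factor `7 / 8`, and there are `O(L)`
rounds.

Price. For `e = 1, 2` fix an assignment of the points to at most `k` input points that costs at most
`2 ^ e` times any choice of `k` centers (`exists_assignment`), and let `δ` be the distances in it.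
If `X` hits the innermost part of each cluster of substantial weight, then all alive points except a
weight of `W / (512 * d ^ 2)` have a sample point within `2 * δ` (`bad_weight_le`). A discarded
point of the good kind pays at most `2 * δ`. A discarded point of the bad kind pays at most `2 * d *
r`, which is charged to good points at distance at least `r` from `X`: these have `δ ≥ r / 2`, and
their weight is at least `W / 16`. Since the alive weight shrinks geometrically, the charges of all
rounds fit on top of each other with no point charged beyond its own weight; this is the invariant
`Charged`, carried backwards through a round by `Charged.step`. In the end the centers cost at most
`2 ^ e + 4` times the assignment, hence at most `(2 ^ e + 4) * 2 ^ e` times the optimum, which is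
`12` for the median and `32` for the means. The same sample serves both exponents.

Probability. Stratified samples obey the exponential bounds of independent ones (`tape_locate_le`).
This bounds the chance of missing an innermost part (`tape_misses_le`) and that of an
unrepresentative median (`tape_skewed_le`). A union bound over the clusters, both exponents and all
rounds gives `failure_le`.

Time. Stratified positions are increasing, so sampling is a merge of two lists. Grid cells are
addressed directly by an injective integer code, and stamping the marks with the round makes erasing
them unnecessary. A round thus takes time linear in the number of alive points, plus order `k * L ^
2` for the distances between the two samples. If a round removes too little weight, all points are
dropped at once, so the time bound holds surely and not only in expectation. If `k * L ^ 3` is at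
least `n`, all points are returned as centers. Altogether the time is `O(n)` for unit weights,
whatever `k` is, and `O(n * log W)` for general weights.

Programs. `wp` is the expectation of a function of the final store, and `⊤` as soon as halting in
time is not certain. A finite bound therefore proves termination, safety and a failure probability
together; `roundLoop_bound` is the induction over the rounds in these terms. -/

noncomputable section

namespace KClustering

/-! ## Weakest pre-expectations -/

/-- The expectation of `f` under `μ`. -/
def expec {α : Type*} (μ : PMF α) (f : α → ℝ≥0∞) : ℝ≥0∞ := ∑' a, μ a * f a

theorem expec_pure {α : Type*} (a : α) (f : α → ℝ≥0∞) : expec (PMF.pure a) f = f a := by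
  classical
  unfold expec
  rw [tsum_eq_single a]
  · simp [PMF.pure_apply]
  · intro b hb
    simp [PMF.pure_apply, hb]

theorem expec_bind {α β : Type*} (μ : PMF α) (κ : α → PMF β) (f : β → ℝ≥0∞) :
    expec (μ.bind κ) f = expec μ fun a => expec (κ a) f := by
  simp only [expec, PMF.bind_apply, ← ENNReal.tsum_mul_right, ← ENNReal.tsum_mul_left]
  rw [ENNReal.tsum_comm]
  simp only [mul_assoc]

theorem expec_map {α β : Type*} (μ : PMF α) (g : α → β) (f : β → ℝ≥0∞) :
    expec (μ.map g) f = expec μ fun a => f (g a) := by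
  rw [PMF.map, expec_bind]
  simp [expec_pure]

theorem expec_mono {α : Type*} (μ : PMF α) {f g : α → ℝ≥0∞} (h : ∀ a, f a ≤ g a) :
    expec μ f ≤ expec μ g :=
  ENNReal.tsum_le_tsum fun a => mul_le_mul_right (h a) _

theorem expec_const {α : Type*} (μ : PMF α) (v : ℝ≥0∞) : expec μ (fun _ => v) = v := by
  simp [expec, ENNReal.tsum_mul_right, μ.tsum_coe]

theorem expec_uniform_fin (N : ℕ) (f : ℕ → ℝ≥0∞) :
    expec (PMF.uniformOfFintype (Fin (N + 1))) (fun u => f u) =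
      (∑ u ∈ Finset.range (N + 1), f u) / ((N + 1 : ℕ) : ℝ≥0∞) := by
  simp only [expec, PMF.uniformOfFintype_apply, Fintype.card_fin, tsum_fintype]
  rw [← Finset.mul_sum, Finset.sum_range, ENNReal.div_eq_inv_mul]

/-- `wp T c f` is the expectation of `f` at the store in which the machine started on `c` halts,
and `∞` if it fails to halt within `T` steps with positive probability. -/
def wp : ℕ → Config → (Store → ℝ≥0∞) → ℝ≥0∞
  | 0, c, f => match c.1 with
    | [] => f c.2
    | _ :: _ => ⊤
  | T + 1, c, f => expec (step c) fun c' => wp T c' f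

theorem wp_nil (T : ℕ) (σ : Store) (f : Store → ℝ≥0∞) : wp T ([], σ) f = f σ := by
  induction T with
  | zero => rfl
  | succ T ih => simp [wp, step, expec_pure, ih]

theorem wp_succ_le (T : ℕ) (c : Config) (f : Store → ℝ≥0∞) : wp (T + 1) c f ≤ wp T c f := by
  induction T generalizing c with
  | zero =>
    obtain ⟨L, σ⟩ := c
    cases L with
    | nil => rw [wp_nil, wp_nil]
    | cons P L => simp [wp]
  | succ T ih => exact expec_mono _ fun c' => ih c'

theorem wp_antitone {T T' : ℕ} (h : T ≤ T') (c : Config) (f : Store → ℝ≥0∞) :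
    wp T' c f ≤ wp T c f := by
  induction h with
  | refl => exact le_rfl
  | step _ ih => exact (wp_succ_le _ _ _).trans ih

theorem wp_mono (T : ℕ) (c : Config) {f g : Store → ℝ≥0∞} (h : ∀ σ, f σ ≤ g σ) :
    wp T c f ≤ wp T c g := by
  induction T generalizing c with
  | zero =>
    obtain ⟨L, σ⟩ := c
    cases L with
    | nil => simpa [wp] using h σ
    | cons P L => simp [wp]
  | succ T ih => exact expec_mono _ fun c' => ih c'

/-- A finite value for `g` certifies that the machine halts in time and only in stores where `g` is
finite; the rest is that probabilities add up to one. This provides the trivial bound after a round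
that failed. -/
theorem wp_le_one {T : ℕ} {c : Config} {f g : Store → ℝ≥0∞} (hg : wp T c g ≠ ⊤)
    (hf : ∀ σ, g σ ≠ ⊤ → f σ ≤ 1) : wp T c f ≤ 1 := by
  induction T generalizing c with
  | zero =>
    obtain ⟨L, σ⟩ := c
    cases L with
    | nil => simpa [wp] using hf σ (by simpa [wp] using hg)
    | cons P L => simp [wp] at hg
  | succ T ih =>
    have key : ∀ c', step c c' * wp T c' f ≤ step c c' := by
      intro c'
      by_cases h0 : step c c' = 0
      · simp [h0]
      · have : wp T c' g ≠ ⊤ := by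
          intro htop
          apply hg
          have : step c c' * wp T c' g ≤ expec (step c) fun c' => wp T c' g :=
            ENNReal.le_tsum c'
          rw [htop, ENNReal.mul_top h0, top_le_iff] at this
          exact this
        simpa using mul_le_mul_right (ih this) (step c c')
    calc wp (T + 1) c f ≤ ∑' c', step c c' := ENNReal.tsum_le_tsum key
      _ = 1 := (step c).tsum_coe

theorem step_append (P : Prog) (L K : List Prog) (σ : Store) :
    step (P :: (L ++ K), σ) = (step (P :: L, σ)).map fun c => (c.1 ++ K, c.2) := by
  cases P with
  | exec I => simp [step, PMF.map_comp, Function.comp_def]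
  | seq P Q => simp [step, PMF.pure_map]
  | cond i j P Q => by_cases h : σ.reg i < σ.reg j <;> simp [step, PMF.pure_map, h]
  | loop i j P => by_cases h : σ.reg i < σ.reg j <;> simp [step, PMF.pure_map, h]

/-- Only an inequality, because the first part may finish before its budget is spent; the steps left
over do no harm, as `wp` decreases in the budget. -/
theorem wp_append (T T' : ℕ) (L K : List Prog) (σ : Store) (f : Store → ℝ≥0∞) :
    wp (T + T') (L ++ K, σ) f ≤ wp T (L, σ) fun τ => wp T' (K, τ) f := by
  induction T generalizing L σ with
  | zero =>
    cases L with
    | nil => simp [wp]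
    | cons P L => simp [wp]
  | succ T ih =>
    cases L with
    | nil =>
      rw [wp_nil]
      exact wp_antitone (by omega) _ _
    | cons P L =>
      rw [show T + 1 + T' = (T + T') + 1 by omega]
      simp only [wp, List.cons_append]
      rw [step_append, expec_map]
      exact expec_mono _ fun c' => ih _ _

/-- One program on an otherwise empty stack. -/
def pwp (P : Prog) (σ : Store) (T : ℕ) (f : Store → ℝ≥0∞) : ℝ≥0∞ := wp T ([P], σ) f

theorem pwp_seq (P Q : Prog) (σ : Store) (T T' : ℕ) (f : Store → ℝ≥0∞) :
    pwp (.seq P Q) σ (1 + T + T') f ≤ pwp P σ T fun τ => pwp Q τ T' f := by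
  rw [show 1 + T + T' = (T + T') + 1 by omega]
  simp only [pwp, wp, step, expec_pure]
  exact wp_append T T' [P] [Q] σ f

theorem pwp_cond (i j : ℕ) (P Q : Prog) (σ : Store) (T : ℕ) (f : Store → ℝ≥0∞) :
    pwp (.cond i j P Q) σ (1 + T) f =
      if σ.reg i < σ.reg j then pwp P σ T f else pwp Q σ T f := by
  rw [add_comm]
  by_cases h : σ.reg i < σ.reg j <;> simp [pwp, wp, step, h, expec_pure]

theorem pwp_loop_stop {i j : ℕ} (P : Prog) {σ : Store} (h : ¬ σ.reg i < σ.reg j) (T : ℕ)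
    (f : Store → ℝ≥0∞) : pwp (.loop i j P) σ (1 + T) f = f σ := by
  rw [add_comm]
  simp [pwp, wp, step, h, expec_pure, wp_nil]

theorem pwp_loop_step {i j : ℕ} (P : Prog) {σ : Store} (h : σ.reg i < σ.reg j) (T T' : ℕ)
    (f : Store → ℝ≥0∞) :
    pwp (.loop i j P) σ (1 + T + T') f ≤ pwp P σ T fun τ => pwp (.loop i j P) τ T' f := by
  rw [show 1 + T + T' = (T + T') + 1 by omega]
  simp only [pwp, wp, step, h, if_true, expec_pure]
  exact wp_append T T' [P] [.loop i j P] σ f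

theorem pwp_exec (I : Instr) (σ : Store) (T : ℕ) (f : Store → ℝ≥0∞) :
    pwp (.exec I) σ (1 + T) f = expec (I.run σ) f := by
  rw [add_comm]
  simp [pwp, wp, step, expec_map, wp_nil]

/-! ## Expected times and success probabilities from pre-expectations -/

/-- The bridge between the two views of a computation: `runFor` appends steps at the end, `wp`
unfolds them at the beginning, and the split of the total time between them is immaterial. -/
theorem expec_runFor (P : Prog) (σ : Store) (f : Store → ℝ≥0∞) (t T : ℕ) :
    expec (runFor P σ t) (fun c => wp T c f) = pwp P σ (t + T) f := by
  induction t generalizing T with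
  | zero => simp [runFor, expec_pure, pwp]
  | succ t ih =>
    rw [runFor, expec_bind, show t + 1 + T = t + (T + 1) by omega, ← ih]
    rfl

theorem toOuterMeasure_eq_expec {α : Type*} (μ : PMF α) (s : Set α) :
    μ.toOuterMeasure s = expec μ (s.indicator 1) := by
  rw [PMF.toOuterMeasure_apply, expec]
  congr 1
  ext a
  by_cases h : a ∈ s <;> simp [h]

/-- With no steps left, `wp` is `⊤` on every running configuration, so a finite expectation leaves
these no probability. -/
theorem not_halted_eq_zero {P : Prog} {σ : Store} {T t : ℕ} {f : Store → ℝ≥0∞}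
    (h : pwp P σ T f ≠ ⊤) (ht : T ≤ t) :
    (runFor P σ t).toOuterMeasure {c | c.1 ≠ []} = 0 := by
  have h1 : expec (runFor P σ t) (fun c => wp 0 c f) ≠ ⊤ := by
    rw [expec_runFor]
    exact ne_top_of_le_ne_top h (wp_antitone (by omega) _ _)
  rw [PMF.toOuterMeasure_apply_eq_zero_iff, Set.disjoint_left]
  rintro ⟨L, τ⟩ hc hL
  apply h1
  have h2 : runFor P σ t (L, τ) * wp 0 (L, τ) f ≤ _ :=
    ENNReal.le_tsum (f := fun c => runFor P σ t c * wp 0 c f) (L, τ)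
  cases L with
  | nil => simp at hL
  | cons Q L =>
    simp only [wp] at h2
    rw [ENNReal.mul_top ((PMF.mem_support_iff _ _).1 hc), top_le_iff] at h2
    exact h2

theorem toOuterMeasure_le_one {α : Type*} (μ : PMF α) (s : Set α) : μ.toOuterMeasure s ≤ 1 := by
  rw [toOuterMeasure_eq_expec, ← expec_const μ 1]
  exact expec_mono _ fun a => Set.indicator_le_self' (by simp) a

theorem expectedTime_le {P : Prog} {σ : Store} {T : ℕ} {f : Store → ℝ≥0∞}
    (h : pwp P σ T f ≠ ⊤) : expectedTime P σ ≤ T := by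
  unfold expectedTime
  rw [tsum_eq_sum (s := Finset.range T)]
  · calc _ ≤ ∑ t ∈ Finset.range T, (1 : ℝ≥0∞) :=
        Finset.sum_le_sum fun t _ => toOuterMeasure_le_one _ _
      _ = T := by simp
  · intro t ht
    exact not_halted_eq_zero h (by simpa using ht)

/-- Pointwise, the indicator of success plus `wp 0` of the failure indicator is at least one: on
halted configurations one of the two is one, and on running ones the second is `⊤`. -/
theorem le_haltProb {P : Prog} {σ : Store} {T : ℕ} {Q : Store → Prop} {δ : ℝ≥0∞}
    [DecidablePred Q] (h : pwp P σ T (fun τ => if Q τ then 0 else 1) ≤ δ) :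
    1 - δ ≤ haltProb P σ Q := by
  refine le_trans ?_ (le_iSup _ T)
  rw [tsub_le_iff_right, toOuterMeasure_eq_expec]
  have h1 := expec_runFor P σ (fun τ => if Q τ then 0 else 1) T 0
  rw [add_zero] at h1
  refine le_trans ?_ (add_le_add_right (h1.trans_le h) _)
  rw [← expec_const (runFor P σ T) 1]
  simp only [expec]
  rw [← ENNReal.tsum_add]
  refine ENNReal.tsum_le_tsum ?_
  rintro ⟨L, τ⟩
  rw [← mul_add]
  refine mul_le_mul_right ?_ _
  cases L with
  | nil => by_cases hQ : Q τ <;> simp [wp, hQ]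
  | cons Q L => simp [wp]

/-! ## A small imperative language over named variables -/

/-- The variables of the programs. -/
inductive Var
  | nn | kk | zero | tot | na | cnt | ss | mm | rho | lg | base | xs | len | val | ii | jj | tt | cum
  | pid | xx | yy | ll | best | rad | flag | new | newtot
  deriving DecidableEq

/-- The register that holds a variable. -/
def Var.idx (x : Var) : ℕ := x.ctorIdx

/-- The registers from this one on hold intermediate results. -/
def tmp : ℕ := 27

theorem Var.idx_lt (x : Var) : x.idx < tmp := by
  cases x <;> decide

theorem Var.idx_injective : Function.Injective Var.idx := by
  intro x y h
  have := congrArg Var.ofNat h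
  simpa only [Var.idx, Var.ofNat_ctorIdx] using this

/-- The values of the variables and the memory. -/
structure State where
  reg : Var → ℝ
  mem : ℕ → ℝ

/-- The part of a store that programs refer to. -/
def Store.view (σ : Store) : State := ⟨fun x => σ.reg x.idx, σ.mem⟩

def State.set (σ : State) (x : Var) (v : ℝ) : State :=
  ⟨fun y => if y = x then v else σ.reg y, σ.mem⟩

def State.put (σ : State) (a : ℕ) (v : ℝ) : State :=
  ⟨σ.reg, fun b => if b = a then v else σ.mem b⟩

@[simp] theorem State.set_reg (σ : State) (x y : Var) (v : ℝ) :
    (σ.set x v).reg y = if y = x then v else σ.reg y := rfl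
@[simp] theorem State.set_mem (σ : State) (x : Var) (v : ℝ) : (σ.set x v).mem = σ.mem := rfl
@[simp] theorem State.put_reg (σ : State) (a : ℕ) (v : ℝ) : (σ.put a v).reg = σ.reg := rfl
@[simp] theorem State.put_mem (σ : State) (a b : ℕ) (v : ℝ) :
    (σ.put a v).mem b = if b = a then v else σ.mem b := rfl

/-- Expressions. -/
inductive Expr
  | var (x : Var)
  | nat (z : ℕ)
  | int (z : ℤ)
  | un (o : UnOp) (e : Expr)
  | bin (o : BinOp) (e e' : Expr)
  | ld (e : Expr)

namespace Expr

instance : Coe Var Expr := ⟨.var⟩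
instance : Add Expr := ⟨.bin .add⟩
instance : Sub Expr := ⟨.bin .sub⟩
instance : Mul Expr := ⟨.bin .mul⟩
instance : Div Expr := ⟨.bin .div⟩

def eval (σ : State) : Expr → ℝ
  | var x => σ.reg x
  | nat z => z
  | int z => z
  | un o e => o.eval (e.eval σ)
  | bin o e e' => o.eval (e.eval σ) (e'.eval σ)
  | ld e => σ.mem ⌊e.eval σ⌋₊

@[simp] theorem eval_var (σ : State) (x : Var) : (var x).eval σ = σ.reg x := rfl
@[simp] theorem eval_nat (σ : State) (z : ℕ) : (nat z).eval σ = z := rfl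
@[simp] theorem eval_int (σ : State) (z : ℤ) : (int z).eval σ = z := rfl
@[simp] theorem eval_ld (σ : State) (e : Expr) : (ld e).eval σ = σ.mem ⌊e.eval σ⌋₊ := rfl
@[simp] theorem eval_add (σ : State) (e e' : Expr) : (e + e').eval σ = e.eval σ + e'.eval σ := rfl
@[simp] theorem eval_sub (σ : State) (e e' : Expr) : (e - e').eval σ = e.eval σ - e'.eval σ := rfl
@[simp] theorem eval_mul (σ : State) (e e' : Expr) : (e * e').eval σ = e.eval σ * e'.eval σ := rfl
@[simp] theorem eval_div (σ : State) (e e' : Expr) : (e / e').eval σ = e.eval σ / e'.eval σ := rfl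
@[simp] theorem eval_floor (σ : State) (e : Expr) :
    (un .floor e).eval σ = (⌊e.eval σ⌋ : ℝ) := rfl
@[simp] theorem eval_log (σ : State) (e : Expr) : (un .log e).eval σ = Real.log (e.eval σ) := rfl
@[simp] theorem eval_sqrt (σ : State) (e : Expr) : (un .sqrt e).eval σ = Real.sqrt (e.eval σ) := rfl

/-- The code that computes an expression into register `t`. -/
def code : Expr → ℕ → Prog
  | var x, t => .exec (.unop .copy t x.idx)
  | nat z, t => .exec (.const t z)
  | int z, t => .exec (.const t z)
  | un o e, t => .seq (e.code t) (.exec (.unop o t t))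
  | bin o e e', t => .seq (e.code t) (.seq (e'.code (t + 1)) (.exec (.binop o t t (t + 1))))
  | ld e, t => .seq (e.code t) (.exec (.load t t))

def time : Expr → ℕ
  | var _ => 1
  | nat _ => 1
  | int _ => 1
  | un _ e => 1 + e.time + 1
  | bin _ e e' => 1 + e.time + (1 + e'.time + 1)
  | ld e => 1 + e.time + 1

theorem time_sub (e e' : Expr) : (e - e').time = 1 + e.time + (1 + e'.time + 1) := rfl

end Expr

theorem pwp_exec_det {I : Instr} {σ τ : Store} (h : I.run σ = PMF.pure τ) (f : Store → ℝ≥0∞) :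
    pwp (.exec I) σ 1 f = f τ := by
  have := pwp_exec I σ 0 f
  rwa [h, expec_pure] at this

theorem Store.view_setReg_of_le {t : ℕ} (ht : tmp ≤ t) (σ : Store) (x : ℝ) :
    (σ.setReg t x).view = σ.view := by
  simp only [Store.view, Store.setReg, State.mk.injEq, and_true]
  ext y
  exact Function.update_of_ne (by have := y.idx_lt; omega) _ _

theorem Store.view_setReg_idx (σ : Store) (x : Var) (v : ℝ) :
    (σ.setReg x.idx v).view = σ.view.set x v := by
  simp only [Store.view, Store.setReg, State.set, State.mk.injEq, and_true]
  ext y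
  simp [Function.update_apply, Var.idx_injective.eq_iff]

theorem Store.view_setMem (σ : Store) (a : ℕ) (v : ℝ) :
    (σ.setMem a v).view = σ.view.put a v := by
  simp only [Store.view, Store.setMem, State.put, State.mk.injEq, true_and]
  ext y
  simp [Function.update_apply]

/-- The hypothesis on `f` records that the registers below `t` are untouched, so that the left
operand of a binary operation, kept in `t`, survives the evaluation of the right one in `t + 1`. -/
theorem Expr.pwp_code (e : Expr) {t : ℕ} (ht : tmp ≤ t) (σ : Store) (f : Store → ℝ≥0∞)
    (v : ℝ≥0∞)
    (h : ∀ τ : Store, τ.view = σ.view → (∀ i < t, τ.reg i = σ.reg i) →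
      τ.reg t = e.eval σ.view → f τ ≤ v) :
    pwp (e.code t) σ e.time f ≤ v := by
  have aux : ∀ x : ℝ, x = e.eval σ.view → f (σ.setReg t x) ≤ v := by
    intro x hx
    refine h _ (Store.view_setReg_of_le ht _ _) (fun i hi => ?_) ?_
    · exact Function.update_of_ne (by omega) _ _
    · simpa [Store.setReg] using hx
  induction e generalizing t σ f v with
  | var x =>
    rw [code, time, pwp_exec_det (by rfl)]
    exact aux _ rfl
  | nat z =>
    rw [code, time, pwp_exec_det (by rfl)]
    exact aux _ (by simp)
  | int z =>
    rw [code, time, pwp_exec_det (by rfl)]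
    exact aux _ (by simp)
  | un o e ih =>
    rw [code, time]
    refine (pwp_seq _ _ _ _ _ _).trans ?_
    have step : ∀ τ : Store, τ.view = σ.view → (∀ i < t, τ.reg i = σ.reg i) →
        τ.reg t = e.eval σ.view →
        pwp (.exec (.unop o t t)) τ 1 f ≤ v := by
      intro τ h1 h2 h3
      rw [pwp_exec_det (by rfl)]
      refine h _ ((Store.view_setReg_of_le ht _ _).trans h1) (fun i hi => ?_) ?_
      · exact (Function.update_of_ne (by omega) _ _).trans (h2 i hi)
      · simp [Store.setReg, h3, eval]
    exact ih ht σ _ v step (fun x hx => step _ (Store.view_setReg_of_le ht _ _)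
      (fun i hi => Function.update_of_ne (by omega) _ _) (by simpa [Store.setReg] using hx))
  | ld e ih =>
    rw [code, time]
    refine (pwp_seq _ _ _ _ _ _).trans ?_
    have step : ∀ τ : Store, τ.view = σ.view → (∀ i < t, τ.reg i = σ.reg i) →
        τ.reg t = e.eval σ.view →
        pwp (.exec (.load t t)) τ 1 f ≤ v := by
      intro τ h1 h2 h3
      rw [pwp_exec_det (by rfl)]
      refine h _ ((Store.view_setReg_of_le ht _ _).trans h1) (fun i hi => ?_) ?_
      · exact (Function.update_of_ne (by omega) _ _).trans (h2 i hi)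
      · have : τ.mem = σ.mem := congrArg State.mem h1
        simp [Store.setReg, h3, eval, this, Store.view]
    exact ih ht σ _ v step (fun x hx => step _ (Store.view_setReg_of_le ht _ _)
      (fun i hi => Function.update_of_ne (by omega) _ _) (by simpa [Store.setReg] using hx))
  | bin o e e' ih ih' =>
    rw [code, time]
    refine (pwp_seq _ _ _ _ _ _).trans ?_
    have step' : ∀ τ : Store, τ.view = σ.view → (∀ i < t, τ.reg i = σ.reg i) →
        τ.reg t = e.eval σ.view → τ.reg (t + 1) = e'.eval σ.view →
        pwp (.exec (.binop o t t (t + 1))) τ 1 f ≤ v := by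
      intro τ h1 h2 h3 h4
      rw [pwp_exec_det (by rfl)]
      refine h _ ((Store.view_setReg_of_le ht _ _).trans h1) (fun i hi => ?_) ?_
      · exact (Function.update_of_ne (by omega) _ _).trans (h2 i hi)
      · simp [Store.setReg, h3, h4, eval]
    have step : ∀ τ : Store, τ.view = σ.view → (∀ i < t, τ.reg i = σ.reg i) →
        τ.reg t = e.eval σ.view →
        pwp (.seq (e'.code (t + 1)) (.exec (.binop o t t (t + 1)))) τ (1 + e'.time + 1) f ≤ v := by
      intro τ h1 h2 h3
      refine (pwp_seq _ _ _ _ _ _).trans ?_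
      have fin : ∀ ρ : Store, ρ.view = τ.view → (∀ i < t + 1, ρ.reg i = τ.reg i) →
          ρ.reg (t + 1) = e'.eval τ.view → pwp (.exec (.binop o t t (t + 1))) ρ 1 f ≤ v := by
        intro ρ h4 h5 h6
        refine step' ρ (h4.trans h1) (fun i hi => (h5 i (by omega)).trans (h2 i hi))
          ((h5 t (by omega)).trans h3) (by rw [h6, h1])
      exact ih' (by omega) τ _ v fin (fun x hx => fin _ (Store.view_setReg_of_le (by omega) _ _)
        (fun i hi => Function.update_of_ne (by omega) _ _) (by simpa [Store.setReg] using hx))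
    exact ih ht σ _ v step (fun x hx => step _ (Store.view_setReg_of_le ht _ _)
      (fun i hi => Function.update_of_ne (by omega) _ _) (by simpa [Store.setReg] using hx))

/-- `Bound P σ T g v`: started on a store with view `σ`, the program `P` halts within `T` steps,
and the expectation of `g` at the final view is at most `v`. -/
def Bound (P : Prog) (σ : State) (T : ℕ) (g : State → ℝ≥0∞) (v : ℝ≥0∞) : Prop :=
  ∀ σ₀ : Store, σ₀.view = σ → pwp P σ₀ T (fun τ => g τ.view) ≤ v

/-- `Runs P σ T Q`: started on a store with view `σ`, the program `P` halts within `T` steps with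
probability one in a single view, which satisfies `Q`. -/
def Runs (P : Prog) (σ : State) (T : ℕ) (Q : State → Prop) : Prop :=
  ∃ τ, Q τ ∧ ∀ g, Bound P σ T g (g τ)

theorem Bound.mono {P : Prog} {σ : State} {T T' : ℕ} {g g' : State → ℝ≥0∞} {v v' : ℝ≥0∞}
    (h : Bound P σ T g v) (hT : T ≤ T') (hg : ∀ τ, g' τ ≤ g τ) (hv : v ≤ v') :
    Bound P σ T' g' v' := fun σ₀ hσ =>
  ((wp_antitone hT _ _).trans (wp_mono _ _ fun _ => hg _)).trans ((h σ₀ hσ).trans hv)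

theorem Bound.le_one {P : Prog} {σ : State} {T : ℕ} {g g' : State → ℝ≥0∞} {v : ℝ≥0∞}
    (h : Bound P σ T g v) (hv : v ≠ ⊤) (hg : ∀ τ, g τ ≠ ⊤ → g' τ ≤ 1) :
    Bound P σ T g' 1 := fun σ₀ hσ =>
  wp_le_one (ne_top_of_le_ne_top hv (h σ₀ hσ)) fun _ => hg _

theorem Bound.seq {P P' : Prog} {σ : State} {T T' : ℕ} {g h : State → ℝ≥0∞} {v : ℝ≥0∞}
    (h1 : Bound P σ T h v) (h2 : ∀ τ, Bound P' τ T' g (h τ)) :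
    Bound (.seq P P') σ (1 + T + T') g v := fun σ₀ hσ =>
  (pwp_seq _ _ _ _ _ _).trans ((wp_mono _ _ fun τ => h2 τ.view τ rfl).trans (h1 σ₀ hσ))

theorem Runs.mono {P : Prog} {σ : State} {T T' : ℕ} {Q Q' : State → Prop} (h : Runs P σ T Q)
    (hT : T ≤ T') (hQ : ∀ τ, Q τ → Q' τ) : Runs P σ T' Q' := by
  obtain ⟨τ, h1, h2⟩ := h
  exact ⟨τ, hQ τ h1, fun g => (h2 g).mono hT (fun _ => le_rfl) le_rfl⟩

theorem Runs.bound {P : Prog} {σ : State} {T : ℕ} {Q : State → Prop} (h : Runs P σ T Q)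
    {g : State → ℝ≥0∞} {v : ℝ≥0∞} (hQ : ∀ τ, Q τ → g τ ≤ v) : Bound P σ T g v := by
  obtain ⟨τ, h1, h2⟩ := h
  exact (h2 g).mono le_rfl (fun _ => le_rfl) (hQ τ h1)

theorem Runs.seq_bound {P P' : Prog} {σ : State} {T T' : ℕ} {Q : State → Prop}
    {g : State → ℝ≥0∞} {v : ℝ≥0∞} (h1 : Runs P σ T Q) (h2 : ∀ τ, Q τ → Bound P' τ T' g v) :
    Bound (.seq P P') σ (1 + T + T') g v := by
  intro σ₀ hσ
  obtain ⟨τ, h3, h4⟩ := h1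
  classical
  refine (pwp_seq _ _ _ _ _ _).trans ?_
  -- The test function that is `v` at `τ` and `⊤` elsewhere turns the bounds for all functions into
  -- the certainty that the first program ends in `τ`.
  refine le_trans (wp_mono _ _ fun ρ => ?_)
    ((h4 (fun ρ => if ρ = τ then v else ⊤) σ₀ hσ).trans (by simp))
  by_cases hρ : ρ.view = τ
  · simpa [hρ] using h2 τ h3 ρ hρ
  · simp [hρ]

theorem Runs.seq {P P' : Prog} {σ : State} {T T' : ℕ} {Q Q' : State → Prop}
    (h1 : Runs P σ T Q) (h2 : ∀ τ, Q τ → Runs P' τ T' Q') :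
    Runs (.seq P P') σ (1 + T + T') Q' := by
  obtain ⟨τ, h3, h4⟩ := h1
  obtain ⟨ρ, h5, h6⟩ := h2 τ h3
  exact ⟨ρ, h5, fun g => Runs.seq_bound ⟨τ, rfl, h4⟩ fun τ' h => h ▸ h6 g⟩

/-- The ghost value `a` describes the progress of the loop and `μ a` bounds the iterations left. It
is not required to count them, which suits loops such as `merge` that advance one of two indices. -/
theorem Runs.while {x y : Var} {P : Prog} {c : ℕ} {G : Type*} (I : G → State → Prop) (μ : G → ℕ)
    (h : ∀ a σ, I a σ → σ.reg x < σ.reg y → Runs P σ c fun τ => ∃ a', I a' τ ∧ μ a' < μ a)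
    {a : G} {σ : State} (h0 : I a σ) :
    Runs (.loop x.idx y.idx P) σ ((c + 1) * μ a + 1)
      fun τ => ∃ a', I a' τ ∧ ¬ τ.reg x < τ.reg y := by
  induction hN : μ a using Nat.strong_induction_on generalizing a σ with
  | _ N ih =>
    by_cases hlt : σ.reg x < σ.reg y
    · obtain ⟨τ, ⟨a', h1, h2⟩, h3⟩ := h a σ h0 hlt
      obtain ⟨ρ, h4, h5⟩ := ih (μ a') (hN ▸ h2) h1 rfl
      refine ⟨ρ, h4, fun g σ₀ hσ => ?_⟩
      have hT : 1 + c + ((c + 1) * μ a' + 1) ≤ (c + 1) * N + 1 := by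
        have : (c + 1) * (μ a' + 1) ≤ (c + 1) * N := Nat.mul_le_mul_left _ (by omega)
        linarith
      refine (wp_antitone hT _ _).trans ?_
      refine (pwp_loop_step P (by subst hσ; exact hlt) c ((c + 1) * μ a' + 1) _).trans ?_
      classical
      refine le_trans (wp_mono _ _ fun ν => ?_)
        ((h3 (fun ν => if ν = τ then g ρ else ⊤) σ₀ hσ).trans (by simp))
      by_cases hν : ν.view = τ
      · simpa [hν] using h5 g ν hν
      · simp [hν]
    · refine ⟨σ, ⟨a, h0, hlt⟩, fun g σ₀ hσ => ?_⟩
      rw [add_comm]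
      rw [pwp_loop_stop P (by subst hσ; exact hlt), hσ]

theorem Runs.for {x y : Var} {P : Prog} {c N : ℕ} (I : ℕ → State → Prop)
    (hx : ∀ j σ, I j σ → σ.reg x = j ∧ σ.reg y = N)
    (h : ∀ j σ, j < N → I j σ → Runs P σ c (I (j + 1))) {σ : State} (h0 : I 0 σ) :
    Runs (.loop x.idx y.idx P) σ ((c + 1) * N + 1) (I N) := by
  refine (Runs.while (c := c) (fun j σ => I j σ ∧ j ≤ N) (fun j => N - j) ?_ (a := 0)
    ⟨h0, Nat.zero_le _⟩).mono le_rfl ?_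
  · rintro j σ ⟨h1, h2⟩ hlt
    rw [(hx j σ h1).1, (hx j σ h1).2, Nat.cast_lt] at hlt
    exact (h j σ hlt h1).mono le_rfl fun τ hτ => ⟨j + 1, ⟨hτ, hlt⟩, by omega⟩
  · rintro τ ⟨j, ⟨h1, h2⟩, h3⟩
    rw [(hx j τ h1).1, (hx j τ h1).2, Nat.cast_lt] at h3
    rwa [show N = j by omega]

/-! ### Loop-free statements -/

/-- Loop-free statements. -/
inductive Stmt
  | skip
  | assign (x : Var) (e : Expr)
  | put (a e : Expr)
  | seq (S S' : Stmt)
  | ite (e e' : Expr) (S S' : Stmt)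

namespace Stmt

def den : Stmt → State → State
  | skip, σ => σ
  | assign x e, σ => σ.set x (e.eval σ)
  | put a e, σ => σ.put ⌊a.eval σ⌋₊ (e.eval σ)
  | seq S S', σ => S'.den (S.den σ)
  | ite e e' S S', σ => if e.eval σ < e'.eval σ then S.den σ else S'.den σ

def code : Stmt → Prog
  | skip => .exec (.const tmp 0)
  | assign x e => .seq (e.code tmp) (.exec (.unop .copy x.idx tmp))
  | put a e => .seq (a.code tmp) (.seq (e.code (tmp + 1)) (.exec (.store tmp (tmp + 1))))
  | seq S S' => .seq S.code S'.code
  | ite e e' S S' =>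
    .seq (e.code tmp) (.seq (e'.code (tmp + 1)) (.cond tmp (tmp + 1) S.code S'.code))

def time : Stmt → ℕ
  | skip => 1
  | assign _ e => 1 + e.time + 1
  | put a e => 1 + a.time + (1 + e.time + 1)
  | seq S S' => 1 + S.time + S'.time
  | ite e e' S S' => 1 + e.time + (1 + e'.time + (1 + (S.time + S'.time)))

theorem bound (S : Stmt) (σ : State) : ∀ g : State → ℝ≥0∞,
    Bound S.code σ S.time g (g (S.den σ)) := by
  have two : ∀ (e e' : Expr) (P : Prog) (T : ℕ) (σ : State) (f : Store → ℝ≥0∞) (v : ℝ≥0∞),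
      (∀ τ : Store, τ.view = σ → τ.reg tmp = e.eval σ → τ.reg (tmp + 1) = e'.eval σ →
        pwp P τ T f ≤ v) → ∀ σ₀ : Store, σ₀.view = σ →
      pwp (.seq (e.code tmp) (.seq (e'.code (tmp + 1)) P)) σ₀
        (1 + e.time + (1 + e'.time + T)) f ≤ v := by
    intro e e' P T σ f v h σ₀ hσ
    refine (pwp_seq _ _ _ _ _ _).trans ?_
    refine e.pwp_code le_rfl σ₀ _ v fun τ h1 h2 h3 => ?_
    refine (pwp_seq _ _ _ _ _ _).trans ?_
    refine e'.pwp_code (by omega) τ _ v fun ρ h4 h5 h6 => ?_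
    exact h ρ (h4.trans (h1.trans hσ)) (by rw [h5 _ (by omega), h3, hσ]) (by rw [h6, h1, hσ])
  induction S generalizing σ with
  | skip =>
    intro g σ₀ hσ
    rw [code, time, pwp_exec_det (by rfl), Store.view_setReg_of_le le_rfl, hσ, den]
  | assign x e =>
    intro g σ₀ hσ
    rw [code, time]
    refine (pwp_seq _ _ _ _ _ _).trans ?_
    refine e.pwp_code le_rfl σ₀ _ _ fun τ h1 h2 h3 => ?_
    rw [pwp_exec_det (by rfl)]
    rw [Store.view_setReg_idx, h1, h3, hσ]
    exact le_rfl
  | put a e =>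
    intro g
    refine two a e _ 1 σ _ _ fun τ h1 h2 h3 => ?_
    rw [pwp_exec_det (by rfl)]
    rw [Store.view_setMem, h1, h2, h3]
    exact le_rfl
  | seq S S' ih ih' => exact fun g => Runs.seq_bound ⟨S.den σ, rfl, ih σ⟩ fun τ h => h ▸ ih' _ g
  | ite e e' S S' ih ih' =>
    intro g
    refine two e e' _ (1 + (S.time + S'.time)) σ _ _ fun τ h1 h2 h3 => ?_
    rw [pwp_cond, h2, h3, den]
    split_ifs
    · exact (ih σ g).mono (by omega) (fun _ => le_rfl) le_rfl τ h1
    · exact (ih' σ g).mono (by omega) (fun _ => le_rfl) le_rfl τ h1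

theorem runs (S : Stmt) {σ : State} {Q : State → Prop} (h : Q (S.den σ)) :
    Runs S.code σ S.time Q := ⟨_, h, S.bound σ⟩

end Stmt

/-! ### Branching and drawing -/

/-- Branching between programs. -/
def branch (e e' : Expr) (P P' : Prog) : Prog :=
  .seq (e.code tmp) (.seq (e'.code (tmp + 1)) (.cond tmp (tmp + 1) P P'))

theorem branch_bound {e e' : Expr} {P P' : Prog} {σ : State} {T : ℕ} {g : State → ℝ≥0∞}
    {v : ℝ≥0∞} (h : e.eval σ < e'.eval σ → Bound P σ T g v)
    (h' : ¬ e.eval σ < e'.eval σ → Bound P' σ T g v) :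
    Bound (branch e e' P P') σ (e.time + e'.time + 3 + T) g v := by
  intro σ₀ hσ
  rw [branch, show e.time + e'.time + 3 + T = 1 + e.time + (1 + e'.time + (1 + T)) by omega]
  refine (pwp_seq _ _ _ _ _ _).trans ?_
  refine e.pwp_code le_rfl σ₀ _ v fun τ h1 h2 h3 => ?_
  refine (pwp_seq _ _ _ _ _ _).trans ?_
  refine e'.pwp_code (by omega) τ _ v fun ρ h4 h5 h6 => ?_
  rw [pwp_cond, h5 _ (by omega), h3, h6, h1, hσ]
  have hρ : ρ.view = σ := h4.trans (h1.trans hσ)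
  split_ifs with hlt
  · exact h hlt ρ hρ
  · exact h' hlt ρ hρ

/-- `x :=` a uniformly random integer from `{0, …, ⌊e⌋₊}`. -/
def draw (x : Var) (e : Expr) : Prog := .seq (e.code tmp) (.exec (.rand x.idx tmp))

theorem draw_bound {x : Var} {e : Expr} {σ : State} {N : ℕ} (hN : e.eval σ = N)
    (g : State → ℝ≥0∞) :
    Bound (draw x e) σ (1 + e.time + 1) g
      ((∑ u ∈ Finset.range (N + 1), g (σ.set x u)) / ((N + 1 : ℕ) : ℝ≥0∞)) := by
  intro σ₀ hσ
  refine (pwp_seq _ _ _ _ _ _).trans ?_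
  refine e.pwp_code le_rfl σ₀ _ _ fun τ h1 h2 h3 => ?_
  refine (wp_antitone (T := 1 + 0) le_rfl _ _).trans ?_
  refine (pwp_exec _ _ 0 _).trans_le ?_
  have hr : ⌊τ.reg tmp⌋₊ = N := by rw [h3, hσ, hN, Nat.floor_natCast]
  rw [Instr.run, expec_map]
  refine (expec_bind _ _ _).trans_le ?_
  refine le_of_eq_of_le ?_
    (expec_uniform_fin ⌊τ.reg tmp⌋₊ fun u => g (τ.setReg x.idx (u : ℝ)).view).le |>.trans ?_
  · congr 1
    ext u
    exact expec_pure _ _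
  · rw [hr]
    simp only [Store.view_setReg_idx, h1, hσ]
    exact le_rfl

/-! ### Frames -/

/-- `τ` differs from `σ` at most in the variables `R` and the memory cells `M`. -/
structure Fr (R : List Var) (M : Set ℕ) (σ τ : State) : Prop where
  reg : ∀ x, x ∉ R → τ.reg x = σ.reg x
  mem : ∀ a, a ∉ M → τ.mem a = σ.mem a

theorem Fr.refl (R : List Var) (M : Set ℕ) (σ : State) : Fr R M σ σ :=
  ⟨fun _ _ => rfl, fun _ _ => rfl⟩

theorem Fr.trans {R R' R'' : List Var} {M M' M'' : Set ℕ} {σ τ ρ : State} (h : Fr R M σ τ)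
    (h' : Fr R' M' τ ρ) (hR : R ⊆ R'') (hR' : R' ⊆ R'') (hM : M ⊆ M'') (hM' : M' ⊆ M'') :
    Fr R'' M'' σ ρ :=
  ⟨fun x hx => (h'.reg x fun hc => hx (hR' hc)).trans (h.reg x fun hc => hx (hR hc)),
    fun a ha => (h'.mem a fun hc => ha (hM' hc)).trans (h.mem a fun hc => ha (hM hc))⟩

/-! ## Cost analysis -/

/-- One assignment has to serve all `C`, so it is a cheapest one among those with at most `k`
values. For a given `C` the competitor sends each cluster to its member nearest to the center of the
cluster; by the triangle inequality this at most doubles each distance. -/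
theorem exists_assignment {d n k : ℕ} (p : Fin n → Pt d) (w : Fin n → ℕ) (hk : 1 ≤ k) (e : ℕ) :
    ∃ φ : Fin n → Fin n, (Finset.univ.image φ).card ≤ k ∧
      ∀ C : Finset (Pt d), C.card = k →
        ∑ i, (w i : ℝ) * dist (p i) (p (φ i)) ^ e ≤
          2 ^ e * ∑ i, (w i : ℝ) * Metric.infDist (p i) (C : Set (Pt d)) ^ e := by
  classical
  rcases Nat.eq_zero_or_pos n with rfl | hn
  · exact ⟨id, by simp, by simp⟩
  have : Nonempty (Fin n) := ⟨⟨0, hn⟩⟩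
  obtain ⟨φ, hφ, hmin⟩ := Finset.exists_min_image
    (Finset.univ.filter fun φ : Fin n → Fin n => (Finset.univ.image φ).card ≤ k)
    (fun φ => ∑ i, (w i : ℝ) * dist (p i) (p (φ i)) ^ e)
    ⟨fun _ => ⟨0, hn⟩, by
      simp only [Finset.mem_filter, Finset.mem_univ, true_and]
      rw [Finset.image_const Finset.univ_nonempty]
      simpa using hk⟩
  simp only [Finset.mem_filter, Finset.mem_univ, true_and] at hφ hmin
  refine ⟨φ, hφ, fun C hC => ?_⟩
  have hCne : (C : Set (Pt d)).Nonempty := by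
    rw [Finset.coe_nonempty, ← Finset.card_pos]
    omega
  have h1 : ∀ i, ∃ c ∈ C, Metric.infDist (p i) (C : Set (Pt d)) = dist (p i) c := fun i =>
    C.finite_toSet.isCompact.exists_infDist_eq_dist hCne (p i)
  choose cc hcc hdist using h1
  have h2 : ∀ c ∈ Finset.univ.image cc, ∃ j, cc j = c ∧ ∀ i, cc i = c →
      dist (p j) c ≤ dist (p i) c := by
    intro c hc
    obtain ⟨i, -, hi⟩ := Finset.mem_image.1 hc
    obtain ⟨j, hj, hj'⟩ := Finset.exists_min_image (Finset.univ.filter fun i => cc i = c)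
      (fun i => dist (p i) c) ⟨i, by simpa using hi⟩
    exact ⟨j, by simpa using hj, fun i hi => hj' i (by simpa using hi)⟩
  choose! rep hrep hrep' using h2
  have hmem : ∀ i, cc i ∈ Finset.univ.image cc := fun i => Finset.mem_image_of_mem _ (by simp)
  refine (hmin (fun i => rep (cc i)) ?_).trans ?_
  · calc (Finset.univ.image fun i => rep (cc i)).card
        = ((Finset.univ.image cc).image rep).card := by rw [Finset.image_image]; rfl
      _ ≤ (Finset.univ.image cc).card := Finset.card_image_le
      _ ≤ C.card := Finset.card_le_card (Finset.image_subset_iff.2 fun i _ => hcc i)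
      _ = k := hC
  · rw [Finset.mul_sum]
    refine Finset.sum_le_sum fun i _ => ?_
    have h3 : dist (p i) (p (rep (cc i))) ≤ 2 * Metric.infDist (p i) (C : Set (Pt d)) := by
      have h4 := dist_triangle_right (p i) (p (rep (cc i))) (cc i)
      have h5 := hrep' (cc i) (hmem i) i rfl
      rw [hdist]
      linarith
    calc (w i : ℝ) * dist (p i) (p (rep (cc i))) ^ e
        ≤ w i * (2 * Metric.infDist (p i) (C : Set (Pt d))) ^ e := by gcongr
      _ = _ := by rw [mul_pow]; ring

/-- The invariant of the cost analysis: for the assignment distances `δ`, the points of `P` with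
costs `c` pay at most `2 ^ e` times the assignment costs and `4` times the assignment costs of a
fractional part of `P` with a sixteenth of its weight. -/
def Charged {n : ℕ} (w : Fin n → ℕ) (δ : Fin n → ℝ) (e : ℕ) (P : Finset (Fin n))
    (c : Fin n → ℝ) : Prop :=
  ∃ u : Fin n → ℝ, (∀ i ∈ P, 0 ≤ u i ∧ u i ≤ w i) ∧ ∑ i ∈ P, u i ≤ (∑ i ∈ P, (w i : ℝ)) / 16 ∧
    ∑ i ∈ P, w i * c i ^ e ≤ 2 ^ e * ∑ i ∈ P, w i * δ i ^ e + 4 * ∑ i ∈ P, u i * δ i ^ e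

theorem Charged.empty {n : ℕ} (w : Fin n → ℕ) (δ : Fin n → ℝ) (e : ℕ) (c : Fin n → ℝ) :
    Charged w δ e ∅ c := ⟨0, by simp⟩

/-- A fractional part `u` of a subset can be enlarged on `G` by any amount up to the weight of `G`
that is not used. -/
theorem exists_enlarge {α : Type*} {P P' G : Finset α} {w u : α → ℝ} (hP : P' ⊆ P)
    (hG : G ⊆ P) (hw : ∀ i ∈ P, 0 ≤ w i) (hu : ∀ i ∈ P', 0 ≤ u i ∧ u i ≤ w i) {a : ℝ}
    (ha : 0 ≤ a) (hroom : a + ∑ i ∈ P', u i ≤ ∑ i ∈ G, w i) :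
    ∃ u' : α → ℝ, (∀ i ∈ P, 0 ≤ u' i ∧ u' i ≤ w i) ∧ ∑ i ∈ P, u' i = ∑ i ∈ P', u i + a ∧
      ∀ (g : α → ℝ) (t : ℝ), (∀ i ∈ P, 0 ≤ g i) → (∀ i ∈ G, t ≤ g i) →
        ∑ i ∈ P', u i * g i + a * t ≤ ∑ i ∈ P, u' i * g i := by
  classical
  set u₀ : α → ℝ := fun i => if i ∈ P' then u i else 0 with hu₀
  have hu₀w : ∀ i ∈ P, 0 ≤ u₀ i ∧ u₀ i ≤ w i := by
    intro i hi
    by_cases h : i ∈ P'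
    · simpa [hu₀, h] using hu i h
    · simpa [hu₀, h] using hw i hi
  have hsum : ∀ g : α → ℝ, ∑ i ∈ P, u₀ i * g i = ∑ i ∈ P', u i * g i := by
    intro g
    rw [← Finset.sum_subset hP (f := fun i => u₀ i * g i)]
    · exact Finset.sum_congr rfl fun i hi => by simp [hu₀, hi]
    · intro i _ hi
      simp [hu₀, hi]
  have hsum1 : ∑ i ∈ P, u₀ i = ∑ i ∈ P', u i := by simpa using hsum fun _ => 1
  set R := ∑ i ∈ G, (w i - u₀ i) with hR
  have hRa : a ≤ R := by
    have h1 : ∑ i ∈ G, u₀ i ≤ ∑ i ∈ P, u₀ i :=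
      Finset.sum_le_sum_of_subset_of_nonneg hG fun i hi _ => (hu₀w i hi).1
    rw [hR, Finset.sum_sub_distrib]
    linarith
  -- `θ` is the share of the unused weight of `G` that is taken. The case `a = 0` is separate
  -- because `R` may vanish then.
  obtain ⟨θ, hθ0, hθ1, hθ⟩ : ∃ θ : ℝ, 0 ≤ θ ∧ θ ≤ 1 ∧ θ * R = a := by
    rcases ha.eq_or_lt with rfl | ha'
    · exact ⟨0, le_rfl, zero_le_one, zero_mul _⟩
    · have hR0 : 0 < R := ha'.trans_le hRa
      exact ⟨a / R, by positivity, (div_le_one hR0).2 hRa, div_mul_cancel₀ _ hR0.ne'⟩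
  have hind : ∀ g : α → ℝ, ∑ i ∈ P, (if i ∈ G then θ * (w i - u₀ i) else 0) * g i =
      θ * ∑ i ∈ G, (w i - u₀ i) * g i := by
    intro g
    rw [Finset.mul_sum, ← Finset.sum_subset hG
      (f := fun i => (if i ∈ G then θ * (w i - u₀ i) else 0) * g i)]
    · exact Finset.sum_congr rfl fun i hi => by simp [hi]; ring
    · intro i _ hi
      simp [hi]
  refine ⟨fun i => u₀ i + if i ∈ G then θ * (w i - u₀ i) else 0, fun i hi => ?_, ?_, ?_⟩
  · obtain ⟨h1, h2⟩ := hu₀w i hi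
    by_cases h : i ∈ G
    · simp only [h, if_true]
      constructor
      · have := mul_nonneg hθ0 (sub_nonneg.2 h2)
        linarith
      · have := mul_le_of_le_one_left (sub_nonneg.2 h2) hθ1
        linarith
    · simpa [h] using ⟨h1, h2⟩
  · have := hind fun _ => 1
    simp only [mul_one] at this
    rw [Finset.sum_add_distrib, hsum1, this, hθ]
  · intro g t hg ht
    simp only [add_mul, Finset.sum_add_distrib]
    rw [hsum, hind]
    refine add_le_add le_rfl ?_
    rw [← hθ, mul_assoc, hR, Finset.sum_mul]
    refine mul_le_mul_of_nonneg_left (Finset.sum_le_sum fun i hi => ?_) hθ0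
    exact mul_le_mul_of_nonneg_left (ht i hi) (sub_nonneg.2 (hu₀w i (hG hi)).2)

open Classical in
-- A discarded point outside `B` has a sample point within `2 * δ` and pays for itself. Points of
-- `B` may pay `2 * d * r`, but they are so light that the distant points outside `B`, which all
-- have `δ ≥ r / 2`, can absorb this with a weight of `W / 128`.
theorem Charged.step {d n : ℕ} (hd : 1 ≤ d) {p : Fin n → Pt d} {w : Fin n → ℕ}
    {δ : Fin n → ℝ} {e : ℕ} (he : e ≤ 2) {P P' : Finset (Fin n)}
    {S : Set (Fin n)} {c : Fin n → ℝ} {r : ℝ} (hδ : ∀ i, 0 ≤ δ i) (hr : 0 ≤ r) (hP : P' ⊆ P)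
    (hW : 8 * ∑ i ∈ P', (w i : ℝ) ≤ 7 * ∑ i ∈ P, (w i : ℝ))
    (hc0 : ∀ i, 0 ≤ c i) (hc : ∀ i, ∀ x ∈ S, c i ≤ dist (p i) (p x))
    (hdisc : ∀ i ∈ P, i ∉ P' → ∃ x ∈ S, dist (p i) (p x) ≤ 2 * d * r)
    (hB : ∑ i ∈ P with ∀ x ∈ S, 2 * δ i < dist (p i) (p x), (w i : ℝ) ≤
      (∑ i ∈ P, (w i : ℝ)) / (512 * d ^ 2))
    (hH : (∑ i ∈ P, (w i : ℝ)) / 8 ≤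
      ∑ i ∈ P with ∀ x ∈ S, r ≤ dist (p i) (p x), (w i : ℝ))
    (h : Charged w δ e P' c) : Charged w δ e P c := by
  obtain ⟨u, hu, husum, hcost⟩ := h
  set W := ∑ i ∈ P, (w i : ℝ) with hWdef
  set W' := ∑ i ∈ P', (w i : ℝ) with hWdef'
  have hW0 : 0 ≤ W := Finset.sum_nonneg fun i _ => by positivity
  have hd1 : (1 : ℝ) ≤ d := by exact_mod_cast hd
  have hd2 : (1 : ℝ) ≤ (d : ℝ) ^ 2 := one_le_pow₀ hd1
  set B := P.filter fun i => ∀ x ∈ S, 2 * δ i < dist (p i) (p x) with hBdef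
  set H := P.filter fun i => ∀ x ∈ S, r ≤ dist (p i) (p x) with hHdef
  set G := H \ B with hGdef
  have hGP : G ⊆ P := Finset.sdiff_subset.trans (Finset.filter_subset _ _)
  have hGw : W / 16 ≤ ∑ i ∈ G, (w i : ℝ) := by
    have h1 : ∑ i ∈ H, (w i : ℝ) ≤ ∑ i ∈ G, (w i : ℝ) + ∑ i ∈ B, (w i : ℝ) := by
      rw [← Finset.sum_sdiff (Finset.inter_subset_left : H ∩ B ⊆ H), Finset.sdiff_inter_self_left]
      exact add_le_add le_rfl (Finset.sum_le_sum_of_subset_of_nonneg Finset.inter_subset_right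
        fun i _ _ => by positivity)
    have h2 : W / (512 * d ^ 2) ≤ W / 16 := div_le_div_of_nonneg_left hW0 (by norm_num) (by linarith)
    linarith
  have hGδ : ∀ i ∈ G, (r / 2) ^ e ≤ δ i ^ e := by
    intro i hi
    obtain ⟨hiH, hiB⟩ := Finset.mem_sdiff.1 hi
    obtain ⟨hiP, hiH⟩ := Finset.mem_filter.1 hiH
    have : ¬ ∀ x ∈ S, 2 * δ i < dist (p i) (p x) := fun hc =>
      hiB (Finset.mem_filter.2 ⟨hiP, hc⟩)
    push Not at this
    obtain ⟨x, hx, hx'⟩ := this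
    have := hiH x hx
    exact pow_le_pow_left₀ (by linarith) (by linarith) _
  -- The later rounds use at most `W' / 16`, and `W' ≤ 7 * W / 8`, so they use at most `7 * W /
  -- 128`. Another `W / 128` exhausts the allowance `W / 16`, which `G` is heavy enough to provide.
  obtain ⟨u', hu', husum', hgain⟩ := exists_enlarge (w := fun i => (w i : ℝ)) (u := u)
    (a := W / 128) hP hGP (fun i _ => by positivity) hu (by positivity) (by linarith)
  refine ⟨u', hu', by rw [husum']; linarith, ?_⟩
  have hgain' := hgain (fun i => δ i ^ e) ((r / 2) ^ e) (fun i _ => pow_nonneg (hδ i) _) hGδ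
  have hD : ∑ i ∈ P \ P', (w i : ℝ) * c i ^ e ≤
      2 ^ e * ∑ i ∈ P \ P', (w i : ℝ) * δ i ^ e + ∑ i ∈ B, (w i : ℝ) * (2 * d * r) ^ e := by
    have h1 : ∀ i ∈ P \ P', (w i : ℝ) * c i ^ e ≤ 2 ^ e * (w i * δ i ^ e) +
        if i ∈ B then (w i : ℝ) * (2 * d * r) ^ e else 0 := by
      intro i hi
      obtain ⟨hiP, hiP'⟩ := Finset.mem_sdiff.1 hi
      by_cases hiB : i ∈ B
      · obtain ⟨x, hx, hx'⟩ := hdisc i hiP hiP'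
        have h2 : (w i : ℝ) * c i ^ e ≤ w i * (2 * d * r) ^ e :=
          mul_le_mul_of_nonneg_left (pow_le_pow_left₀ (hc0 i) ((hc i x hx).trans hx') _)
            (by positivity)
        have h3 : 0 ≤ 2 ^ e * (w i * δ i ^ e) := by have := hδ i; positivity
        simp only [hiB, if_true]
        linarith
      · have : ¬ ∀ x ∈ S, 2 * δ i < dist (p i) (p x) := fun hc =>
          hiB (Finset.mem_filter.2 ⟨hiP, hc⟩)
        push Not at this
        obtain ⟨x, hx, hx'⟩ := this
        simp only [hiB, if_false, add_zero]
        calc (w i : ℝ) * c i ^ e ≤ w i * (2 * δ i) ^ e :=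
              mul_le_mul_of_nonneg_left (pow_le_pow_left₀ (hc0 i) ((hc i x hx).trans hx') _)
                (by positivity)
          _ = 2 ^ e * (w i * δ i ^ e) := by rw [mul_pow]; ring
    refine (Finset.sum_le_sum h1).trans ?_
    rw [Finset.sum_add_distrib, Finset.mul_sum, ← Finset.sum_filter]
    refine add_le_add le_rfl (Finset.sum_le_sum_of_subset_of_nonneg ?_ fun i _ _ => by positivity)
    intro i hi
    exact (Finset.mem_filter.1 hi).2
  -- As `2 * d * r` is `4 * d` times `r / 2` and `e ≤ 2`, the powers differ by a factor of at most
  -- `16 * d ^ 2`; the share `1 / (512 * d ^ 2)` of the bad points then leaves `1 / 32 = 4 / 128`.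
  have hbad : ∑ i ∈ B, (w i : ℝ) * (2 * d * r) ^ e ≤ 4 * (W / 128 * (r / 2) ^ e) := by
    rw [← Finset.sum_mul]
    have h1 : (2 * d * r) ^ e ≤ 16 * d ^ 2 * (r / 2) ^ e := by
      rw [show 2 * d * r = 4 * d * (r / 2) by ring, mul_pow]
      refine mul_le_mul_of_nonneg_right ?_ (by positivity)
      calc (4 * (d : ℝ)) ^ e ≤ (4 * d) ^ 2 := pow_le_pow_right₀ (by linarith) he
        _ = 16 * d ^ 2 := by ring
    calc (∑ i ∈ B, (w i : ℝ)) * (2 * d * r) ^ e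
        ≤ W / (512 * d ^ 2) * (16 * d ^ 2 * (r / 2) ^ e) :=
          mul_le_mul hB h1 (by positivity) (by positivity)
      _ = 4 * (W / 128 * (r / 2) ^ e) := by field_simp; ring
  have e1 := Finset.sum_sdiff hP (f := fun i => (w i : ℝ) * c i ^ e)
  have e2 := Finset.sum_sdiff hP (f := fun i => (w i : ℝ) * δ i ^ e)
  rw [← e1, ← e2, mul_add]
  linarith

theorem Charged.cost_le {n : ℕ} {w : Fin n → ℕ} {δ : Fin n → ℝ} {e : ℕ} {c : Fin n → ℝ}
    (hδ : ∀ i, 0 ≤ δ i) (h : Charged w δ e Finset.univ c) :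
    ∑ i, (w i : ℝ) * c i ^ e ≤ (2 ^ e + 4) * ∑ i, (w i : ℝ) * δ i ^ e := by
  obtain ⟨u, hu, -, h⟩ := h
  have : ∑ i, u i * δ i ^ e ≤ ∑ i, (w i : ℝ) * δ i ^ e := Finset.sum_le_sum fun i hi =>
    mul_le_mul_of_nonneg_right (hu i hi).2 (pow_nonneg (hδ i) _)
  linarith

/-! ### Initial segments by weight -/

open Classical in
/-- The points of `Q` that are preceded by weight at most `θ`. -/
theorem near_weight {α : Type*} (Q : Finset α) (w : α → ℕ) (κ : α → ℝ) {θ : ℝ}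
    (hθ : θ ≤ ∑ i ∈ Q, (w i : ℝ)) :
    θ ≤ ∑ x ∈ Q with ∑ q ∈ Q with κ q < κ x, (w q : ℝ) ≤ θ, (w x : ℝ) := by
  set F := Q.filter fun x => ¬ ∑ q ∈ Q with κ q < κ x, (w q : ℝ) ≤ θ with hF
  rcases F.eq_empty_or_nonempty with hE | hne
  · rw [Finset.filter_true_of_mem]
    · exact hθ
    · intro x hx
      by_contra hc
      exact (Finset.eq_empty_iff_forall_notMem.1 hE x) (Finset.mem_filter.2 ⟨hx, hc⟩)
  -- All predecessors of the first excluded point are included, and it is excluded because they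
  -- weigh more than `θ`.
  · obtain ⟨x, hx, hmin⟩ := Finset.exists_min_image F κ hne
    obtain ⟨hxQ, hx⟩ := Finset.mem_filter.1 hx
    refine (not_le.1 hx).le.trans (Finset.sum_le_sum_of_subset_of_nonneg ?_ fun i _ _ => by
      positivity)
    intro q hq
    obtain ⟨hqQ, hqx⟩ := Finset.mem_filter.1 hq
    refine Finset.mem_filter.2 ⟨hqQ, ?_⟩
    by_contra hc
    exact absurd (hmin q (Finset.mem_filter.2 ⟨hqQ, hc⟩)) (not_le.2 hqx)

open Classical in
-- The set consists of points up to its own last element in the order of `κ`, and that element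
-- belongs to it only if all those points together weigh less than `θ`.
theorem low_weight {α : Type*} (Q : Finset α) (w : α → ℕ) (κ : α → ℝ) {θ : ℝ} (hθ : 0 ≤ θ) :
    ∑ x ∈ Q with ∑ q ∈ Q with κ q ≤ κ x, (w q : ℝ) < θ, (w x : ℝ) ≤ θ := by
  set F := Q.filter fun x => ∑ q ∈ Q with κ q ≤ κ x, (w q : ℝ) < θ with hF
  rcases F.eq_empty_or_nonempty with hE | hne
  · simpa [hE] using hθ
  · obtain ⟨x, hx, hmax⟩ := Finset.exists_max_image F κ hne
    obtain ⟨hxQ, hx⟩ := Finset.mem_filter.1 hx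
    refine le_trans (Finset.sum_le_sum_of_subset_of_nonneg ?_ fun i _ _ => by positivity) hx.le
    intro q hq
    exact Finset.mem_filter.2 ⟨(Finset.mem_filter.1 hq).1, hmax q hq⟩

/-! ### Indicators as bounds for probabilities. -/

/-- The indicator of a proposition. -/
def ind (q : Prop) : ℝ≥0∞ := open Classical in if q then 1 else 0

theorem ind_pos {q : Prop} (h : q) : ind q = 1 := if_pos h

theorem ind_neg {q : Prop} (h : ¬ q) : ind q = 0 := if_neg h

theorem ind_le_one (q : Prop) : ind q ≤ 1 := by
  by_cases h : q
  · rw [ind_pos h]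
  · rw [ind_neg h]
    exact zero_le

theorem ind_le {q : Prop} {v : ℝ≥0∞} (h : q → 1 ≤ v) : ind q ≤ v := by
  by_cases hq : q
  · rw [ind_pos hq]
    exact h hq
  · rw [ind_neg hq]
    exact zero_le

/-! ## Stratified sampling -/

/-- The expectation of `v` at `u`, when the entries `j, …, j + c - 1` of `u` are replaced by
independent uniform elements of `{0, …, W - 1}`. -/
def tape (W : ℕ) : ℕ → ℕ → (ℕ → ℕ) → ((ℕ → ℕ) → ℝ≥0∞) → ℝ≥0∞
  | 0, _, u, v => v u
  | c + 1, j, u, v => (∑ x ∈ Finset.range W, tape W c (j + 1) (Function.update u j x) v) / W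

theorem tape_mono (W c j : ℕ) (u : ℕ → ℕ) {v v' : (ℕ → ℕ) → ℝ≥0∞}
    (h : ∀ u', (∀ i, j ≤ i → i < j + c → u' i < W) → v u' ≤ v' u') :
    tape W c j u v ≤ tape W c j u v' := by
  suffices H : ∀ c j u, (∀ u', (∀ i < j, u' i = u i) → (∀ i, j ≤ i → i < j + c → u' i < W) →
      v u' ≤ v' u') → tape W c j u v ≤ tape W c j u v' from H c j u fun u' _ => h u'
  clear h c j u
  intro c
  induction c with
  | zero => exact fun j u h => h u (fun _ _ => rfl) fun i h1 h2 => by omega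
  | succ c ih =>
    intro j u h
    simp only [tape]
    refine ENNReal.div_le_div_right (Finset.sum_le_sum fun x hx => ih _ _ fun u' h1 h2 => ?_) _
    refine h u' (fun i hi => ?_) fun i h3 h4 => ?_
    · rw [h1 i (by omega), Function.update_of_ne (by omega)]
    · rcases h3.eq_or_lt with rfl | h3
      · rw [h1 j (by omega), Function.update_self]
        simpa using hx
      · exact h2 i h3 (by omega)

theorem tape_add (W c j : ℕ) (u : ℕ → ℕ) (v v' : (ℕ → ℕ) → ℝ≥0∞) :
    tape W c j u (fun u => v u + v' u) = tape W c j u v + tape W c j u v' := by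
  induction c generalizing j u with
  | zero => rfl
  | succ c ih => simp only [tape, ih, Finset.sum_add_distrib, ENNReal.add_div]

theorem tape_const_le (W c j : ℕ) (u : ℕ → ℕ) (a : ℝ≥0∞) : tape W c j u (fun _ => a) ≤ a := by
  induction c generalizing j u with
  | zero => exact le_rfl
  | succ c ih =>
    simp only [tape]
    calc _ ≤ (∑ x ∈ Finset.range W, a) / W :=
          ENNReal.div_le_div_right (Finset.sum_le_sum fun x _ => ih _ _) _
      _ ≤ a := by
        rw [Finset.sum_const, Finset.card_range, nsmul_eq_mul, mul_comm]
        exact ENNReal.div_le_of_le_mul le_rfl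

theorem tape_sum {ι : Type*} (s : Finset ι) (W c j : ℕ) (u : ℕ → ℕ)
    (v : ι → (ℕ → ℕ) → ℝ≥0∞) :
    tape W c j u (fun u => ∑ i ∈ s, v i u) = ∑ i ∈ s, tape W c j u (v i) := by
  induction c generalizing j u with
  | zero => rfl
  | succ c ih =>
    simp only [tape, ih]
    rw [Finset.sum_comm]
    simp only [div_eq_mul_inv, Finset.sum_mul]

/-- Independence of the entries: the expected product is the product of the means, where the entries
before `j` are already drawn and act as constants. -/
theorem tape_prod (W : ℕ) (q : ℕ → ℕ → ℝ≥0∞) (c j : ℕ) (u : ℕ → ℕ) :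
    tape W c j u (fun u => ∏ i ∈ Finset.range (j + c), q i (u i)) =
      (∏ i ∈ Finset.range j, q i (u i)) *
        ∏ i ∈ Finset.range c, ((∑ x ∈ Finset.range W, q (j + i) x) / W) := by
  induction c generalizing j u with
  | zero => simp [tape]
  | succ c ih =>
    simp only [tape]
    rw [Finset.prod_range_succ' _ c]
    simp only [show j + (c + 1) = j + 1 + c by omega]
    simp only [ih, Finset.prod_range_succ _ j, Function.update_self, add_zero]
    have h1 : ∀ x, ∏ i ∈ Finset.range j, q i (Function.update u j x i) =
        ∏ i ∈ Finset.range j, q i (u i) := fun x => Finset.prod_congr rfl fun i hi => by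
      rw [Function.update_of_ne (by simp at hi; omega)]
    simp only [h1, show ∀ i, j + 1 + i = j + (i + 1) by intro i; omega]
    rw [← Finset.sum_mul, ← Finset.mul_sum]
    simp only [div_eq_mul_inv]
    ring

/-! ### Elements as blocks of positions, and exponential bounds. -/

/-- The element of the list at position `x`, when each element `a` takes `c * w a` positions. -/
def locate {α : Type*} (w : α → ℕ) (c : ℕ) : List α → ℕ → Option α
  | [], _ => none
  | a :: l, x => if x < c * w a then some a else locate w c l (x - c * w a)

theorem sum_locate {α : Type*} (w : α → ℕ) (c : ℕ) (H : Option α → ℝ) (l : List α) :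
    ∑ x ∈ Finset.range (c * (l.map w).sum), H (locate w c l x) =
      c * (l.map fun a => w a * H (some a)).sum := by
  induction l with
  | nil => simp
  | cons a l ih =>
    rw [List.map_cons, List.sum_cons, mul_add, Finset.sum_range_add, List.map_cons, List.sum_cons,
      mul_add, ← ih]
    congr 1
    · rw [Finset.sum_congr rfl (g := fun _ => H (some a))]
      · simp [mul_assoc]
      · intro x hx
        simp only [locate, if_pos (Finset.mem_range.1 hx)]
    · refine Finset.sum_congr rfl fun x _ => ?_
      simp [locate]

theorem locate_mem {α : Type*} {w : α → ℕ} {c : ℕ} {l : List α} {x : ℕ} {a : α}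
    (h : locate w c l x = some a) : a ∈ l := by
  induction l generalizing x with
  | nil => simp [locate] at h
  | cons b l ih =>
    simp only [locate] at h
    split_ifs at h with hx
    · simp_all
    · exact List.mem_cons_of_mem _ (ih h)

theorem locate_eq_some {α : Type*} (w : α → ℕ) (c : ℕ) (l : List α) (t x : ℕ) (ht : t < l.length)
    (h1 : c * ((l.take t).map w).sum ≤ x) (h2 : x < c * ((l.take t).map w).sum + c * w l[t]) :
    locate w c l x = some l[t] := by
  induction l generalizing t x with
  | nil => simp at ht
  | cons b l ih =>
    cases t with
    | zero => simpa [locate] using fun h => absurd h2 (by simpa using h)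
    | succ t =>
      simp only [List.take_succ_cons, List.map_cons, List.sum_cons, mul_add] at h1 h2
      simp only [List.getElem_cons_succ] at h2 ⊢
      rw [locate, if_neg (by omega)]
      exact ih t _ _ (by omega) (by omega)

theorem sum_range_blocks (f : ℕ → ℝ) (c W : ℕ) :
    ∑ j ∈ Finset.range c, ∑ x ∈ Finset.range W, f (j * W + x) =
      ∑ y ∈ Finset.range (c * W), f y := by
  induction c with
  | zero => simp
  | succ c ih => rw [Finset.sum_range_succ, ih, Nat.succ_mul, Finset.sum_range_add]

/-- The draws are independent but not identically distributed, since each stratum meets only some of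
the elements. Bounding each mean `x` by `exp (x - 1)` turns the product of means into the
exponential of a sum, and summed over all strata each element `a` occupies exactly `c * w a`
positions. Only this sum matters, so the result is the one for independent draws by weight. -/
theorem tape_locate_le {α : Type*} (w : α → ℕ) (l : List α) {W : ℕ} (hW : (l.map w).sum = W)
    (hW0 : 0 < W) (c : ℕ) (H : Option α → ℝ) (hH : ∀ a, 0 ≤ H a) (u : ℕ → ℕ) :
    tape W c 0 u (fun u => ∏ j ∈ Finset.range c,
        ENNReal.ofReal (H (locate w c l (j * W + u j)))) ≤
      ENNReal.ofReal (Real.exp (c * ((l.map fun a => w a * H (some a)).sum / W - 1))) := by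
  have h := tape_prod W (fun j x => ENNReal.ofReal (H (locate w c l (j * W + x)))) c 0 u
  simp only [zero_add, Finset.range_zero, Finset.prod_empty, one_mul] at h
  rw [h]
  have hWr : (0 : ℝ) < W := by exact_mod_cast hW0
  have h1 : ∀ j, (∑ x ∈ Finset.range W, ENNReal.ofReal (H (locate w c l (j * W + x)))) / W ≤
      ENNReal.ofReal (Real.exp ((∑ x ∈ Finset.range W, H (locate w c l (j * W + x))) / W - 1)) := by
    intro j
    rw [← ENNReal.ofReal_sum_of_nonneg fun _ _ => hH _, ← ENNReal.ofReal_natCast W,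
      ← ENNReal.ofReal_div_of_pos hWr]
    refine ENNReal.ofReal_le_ofReal ?_
    have := Real.add_one_le_exp ((∑ x ∈ Finset.range W, H (locate w c l (j * W + x))) / W - 1)
    linarith
  refine (Finset.prod_le_prod' fun j _ => h1 j).trans_eq ?_
  rw [← ENNReal.ofReal_prod_of_nonneg fun _ _ => (Real.exp_pos _).le, ← Real.exp_sum,
    Finset.sum_sub_distrib, ← Finset.sum_div, sum_range_blocks (fun y => H (locate w c l y)),
    ← hW, sum_locate]
  congr 2
  simp only [Finset.sum_const, Finset.card_range, nsmul_eq_mul]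
  ring

theorem list_sum_eq {α : Type*} [DecidableEq α] {l : List α} (hl : l.Nodup) (f : α → ℝ) :
    (l.map f).sum = ∑ a ∈ l.toFinset, f a := (List.sum_toFinset f hl).symm

theorem list_sum_cast_eq {α : Type*} [DecidableEq α] {l : List α} (hl : l.Nodup) (w : α → ℕ) :
    (((l.map w).sum : ℕ) : ℝ) = ∑ a ∈ l.toFinset, (w a : ℝ) := by
  rw [← List.sum_toFinset w hl]
  push_cast
  rfl

open Classical in
/-- A sample misses a set `A` with probability at most `exp (- c * w(A) / W)`. -/
theorem tape_miss_le {α : Type*} [DecidableEq α] (w : α → ℕ) {l : List α} (hl : l.Nodup) {W : ℕ}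
    (hW : (l.map w).sum = W) (hW0 : 0 < W) (c : ℕ) {A : Finset α} (hA : A ⊆ l.toFinset)
    (u : ℕ → ℕ) {δ : ℝ} (hδ : δ ≤ c * (∑ a ∈ A, (w a : ℝ)) / W) :
    tape W c 0 u (fun u => ind (∀ j < c, ∀ a ∈ A, locate w c l (j * W + u j) ≠ some a))
      ≤ ENNReal.ofReal (Real.exp (-δ)) := by
  have hWr : (0 : ℝ) < W := by exact_mod_cast hW0
  set H : Option α → ℝ := fun o => if ∃ a ∈ A, o = some a then 0 else 1 with hHdef
  have hH : ∀ a, 0 ≤ H a := by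
    intro a
    simp only [hHdef]
    split_ifs <;> norm_num
  refine le_trans ?_ ((tape_locate_le w l hW hW0 c H hH u).trans ?_)
  · refine tape_mono _ _ _ _ fun u' _ => ?_
    refine ind_le fun h => ?_
    · rw [Finset.prod_eq_one]
      intro j hj
      have : H (locate w c l (j * W + u' j)) = 1 := by
        simp only [hHdef]
        rw [if_neg]
        rintro ⟨a, ha, hja⟩
        exact h j (Finset.mem_range.1 hj) a ha hja
      rw [this, ENNReal.ofReal_one]
  · refine ENNReal.ofReal_le_ofReal (Real.exp_le_exp.2 ?_)
    have h1 : (l.map fun a => w a * H (some a)).sum = W - ∑ a ∈ A, (w a : ℝ) := by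
      rw [list_sum_eq hl, ← hW, list_sum_cast_eq hl,
        ← Finset.sum_sdiff hA (f := fun a => (w a : ℝ)), add_sub_cancel_right,
        ← Finset.sum_sdiff hA]
      rw [Finset.sum_congr rfl (g := fun a => (w a : ℝ)), Finset.sum_eq_zero (s := A), add_zero]
      · intro a ha
        simp [hHdef, ha]
      · intro a ha
        simp [hHdef, (Finset.mem_sdiff.1 ha).2]
    rw [h1, sub_div, div_self hWr.ne']
    have : (c : ℝ) * (1 - (∑ a ∈ A, (w a : ℝ)) / W - 1) = - (c * (∑ a ∈ A, (w a : ℝ)) / W) := by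
      ring
    linarith

open Classical in
/-- The number of samples that fall into `A`. -/
def hits {α : Type*} (w : α → ℕ) (c : ℕ) (l : List α) (W : ℕ) (u : ℕ → ℕ) (A : Finset α) : ℕ :=
  ((Finset.range c).filter fun j => ∃ a ∈ A, locate w c l (j * W + u j) = some a).card

theorem card_le_hits {α : Type*} {w : α → ℕ} {c : ℕ} {l : List α} {W : ℕ} {u : ℕ → ℕ}
    {A : Finset α} {J : Finset ℕ}
    (h : ∀ j ∈ J, j < c ∧ ∃ a ∈ A, locate w c l (j * W + u j) = some a) :
    J.card ≤ hits w c l W u A :=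
  Finset.card_le_card fun j hj => by simpa using h j hj

open Classical in
/-- Half of a sample falls into a set of an eighth of the weight with probability at most
`exp (- c / 4)`. -/
theorem tape_tail_le {α : Type*} (w : α → ℕ) {l : List α} (hl : l.Nodup) {W : ℕ}
    (hW : (l.map w).sum = W) (hW0 : 0 < W) (c : ℕ) {A : Finset α} (hA : ∀ a ∈ A, a ∈ l)
    (hAw : ∑ a ∈ A, (w a : ℝ) ≤ W / 8) (u : ℕ → ℕ) :
    tape W c 0 u (fun u => ind (c ≤ 2 * hits w c l W u A))
      ≤ ENNReal.ofReal (Real.exp (-(c / 4))) := by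
  replace hA : A ⊆ l.toFinset := fun a ha => List.mem_toFinset.2 (hA a ha)
  have hWr : (0 : ℝ) < W := by exact_mod_cast hW0
  -- With factor `2` for a hit and `1 / 2` for a miss, the product is at least one once half of the
  -- draws are hits, while the weighted mean is at most `1 / 2 + 3 / 2 * (1 / 8) = 11 / 16`, below
  -- `3 / 4`.
  set H : Option α → ℝ := fun o => if ∃ a ∈ A, o = some a then 2 else 1 / 2 with hHdef
  have hH : ∀ a, 0 ≤ H a := by
    intro a
    simp only [hHdef]
    split_ifs <;> norm_num
  refine le_trans ?_ ((tape_locate_le w l hW hW0 c H hH u).trans ?_)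
  · refine tape_mono _ _ _ _ fun u' _ => ?_
    refine ind_le fun h => ?_
    · rw [← ENNReal.ofReal_prod_of_nonneg fun _ _ => hH _, ← ENNReal.ofReal_one]
      refine ENNReal.ofReal_le_ofReal ?_
      simp only [hHdef]
      rw [Finset.prod_ite, Finset.prod_const, Finset.prod_const]
      have h2 := Finset.card_filter_add_card_filter_not (s := Finset.range c)
        (fun j => ∃ a ∈ A, locate w c l (j * W + u' j) = some a)
      rw [Finset.card_range] at h2
      rw [hits] at h
      rw [one_div, inv_pow, ← div_eq_mul_inv, one_le_div (by positivity)]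
      exact pow_le_pow_right₀ (by norm_num) (by omega)
  · refine ENNReal.ofReal_le_ofReal (Real.exp_le_exp.2 ?_)
    have h1 : (l.map fun a => w a * H (some a)).sum = W / 2 + 3 / 2 * ∑ a ∈ A, (w a : ℝ) := by
      rw [list_sum_eq hl, ← hW, list_sum_cast_eq hl, ← Finset.sum_sdiff hA,
        ← Finset.sum_sdiff hA]
      rw [Finset.sum_congr rfl (s₁ := l.toFinset \ A) (g := fun a => (w a : ℝ) * (1 / 2)),
        Finset.sum_congr rfl (s₁ := A) (g := fun a => (w a : ℝ) * 2), ← Finset.sum_mul,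
        ← Finset.sum_mul]
      · ring
      · intro a ha
        simp [hHdef, ha]
      · intro a ha
        simp [hHdef, (Finset.mem_sdiff.1 ha).2]
    have h2 : (W / 2 + 3 / 2 * ∑ a ∈ A, (w a : ℝ)) / W - 1 ≤ -(1 / 4) := by
      rw [sub_le_iff_le_add, div_le_iff₀ hWr]
      linarith
    rw [h1]
    calc _ ≤ (c : ℝ) * -(1 / 4) := mul_le_mul_of_nonneg_left h2 (Nat.cast_nonneg c)
      _ = _ := by ring

/-! ## Bad events -/

open Classical in
/-- The part of the cluster of `i` in `P` that is preceded by at most a fraction `ε` of its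
weight. -/
def nearPart {n : ℕ} (w : Fin n → ℕ) (φ : Fin n → Fin n) (δ : Fin n → ℝ) (ε : ℝ)
    (P : Finset (Fin n)) (i : Fin n) : Finset (Fin n) :=
  {x ∈ P | φ x = i ∧
    ∑ q ∈ P with φ q = i ∧ δ q < δ x, (w q : ℝ) ≤ ε * ∑ q ∈ P with φ q = i, (w q : ℝ)}

theorem nearPart_subset {n : ℕ} (w : Fin n → ℕ) (φ : Fin n → Fin n) (δ : Fin n → ℝ) (ε : ℝ)
    (P : Finset (Fin n)) (i : Fin n) : nearPart w φ δ ε P i ⊆ P := Finset.filter_subset _ _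

open Classical in
theorem le_nearPart_weight {n : ℕ} (w : Fin n → ℕ) (φ : Fin n → Fin n) (δ : Fin n → ℝ) {ε : ℝ}
    (hε : ε ≤ 1) (P : Finset (Fin n)) (i : Fin n) :
    ε * ∑ q ∈ P with φ q = i, (w q : ℝ) ≤ ∑ x ∈ nearPart w φ δ ε P i, (w x : ℝ) := by
  have h0 : 0 ≤ ∑ q ∈ P with φ q = i, (w q : ℝ) := Finset.sum_nonneg fun _ _ => by positivity
  have := near_weight (P.filter fun q => φ q = i) w δ
    (θ := ε * ∑ q ∈ P with φ q = i, (w q : ℝ)) (mul_le_of_le_one_left h0 hε)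
  refine this.trans_eq (Finset.sum_congr ?_ fun _ _ => rfl)
  ext x
  simp [nearPart, Finset.filter_filter]

open Classical in
/-- The sample misses the near part of a large cluster. -/
def Misses {n : ℕ} (w : Fin n → ℕ) (φ : Fin n → Fin n) (δ : Fin n → ℝ) (ε : ℝ) (k : ℕ)
    (l : List (Fin n)) (W s : ℕ) (u : ℕ → ℕ) : Prop :=
  ∃ i ∈ Finset.univ.image φ, ε * W / k ≤ ∑ q ∈ l.toFinset with φ q = i, (w q : ℝ) ∧
    ∀ j < s, ∀ a ∈ nearPart w φ δ ε l.toFinset i, locate w s l (j * W + u j) ≠ some a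

open Classical in
-- A union bound over at most `k` clusters: a cluster of weight `ε * W / k` has a near part of
-- weight at least `ε ^ 2 * W / k`, so that `s` draws miss it with probability at most `exp (- s * ε
-- ^ 2 / k)`.
theorem tape_misses_le {n : ℕ} (w : Fin n → ℕ) (φ : Fin n → Fin n) (δ : Fin n → ℝ) {ε : ℝ}
    (hε0 : 0 ≤ ε) (hε : ε ≤ 1) {k : ℕ} (hφ : (Finset.univ.image φ).card ≤ k)
    {l : List (Fin n)} (hl : l.Nodup) {W : ℕ} (hW : (l.map w).sum = W) (hW0 : 0 < W) (s : ℕ)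
    (u : ℕ → ℕ) :
    tape W s 0 u (fun u => ind (Misses w φ δ ε k l W s u)) ≤
      k * ENNReal.ofReal (Real.exp (-(s * ε ^ 2 / k))) := by
  have hWr : (0 : ℝ) < W := by exact_mod_cast hW0
  calc _ ≤ tape W s 0 u (fun u => ∑ i ∈ Finset.univ.image φ,
        if ε * W / k ≤ ∑ q ∈ l.toFinset with φ q = i, (w q : ℝ) then
          ind (∀ j < s, ∀ a ∈ nearPart w φ δ ε l.toFinset i, locate w s l (j * W + u j) ≠ some a)
          else 0) := by
        refine tape_mono _ _ _ _ fun u' _ => ?_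
        refine ind_le fun ⟨i, hi, h1, h2⟩ => ?_
        refine le_trans ?_ (Finset.single_le_sum (fun _ _ => zero_le) hi)
        rw [if_pos h1, ind_pos h2]
    _ ≤ ∑ i ∈ Finset.univ.image φ, ENNReal.ofReal (Real.exp (-(s * ε ^ 2 / k))) := by
        rw [tape_sum]
        refine Finset.sum_le_sum fun i _ => ?_
        by_cases hlarge : ε * W / k ≤ ∑ q ∈ l.toFinset with φ q = i, (w q : ℝ)
        · simp only [hlarge, if_true]
          refine tape_miss_le w hl hW hW0 s (nearPart_subset _ _ _ _ _ _) u ?_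
          have h1 := le_nearPart_weight w φ δ hε l.toFinset i
          have h2 : ε * (ε * W / k) ≤ ∑ x ∈ nearPart w φ δ ε l.toFinset i, (w x : ℝ) :=
            (mul_le_mul_of_nonneg_left hlarge hε0).trans h1
          rw [le_div_iff₀ hWr]
          calc (s : ℝ) * ε ^ 2 / k * W = s * (ε * (ε * W / k)) := by ring
            _ ≤ _ := mul_le_mul_of_nonneg_left h2 (Nat.cast_nonneg s)
        · simp only [hlarge, if_false]
          exact (tape_const_le _ _ _ _ _).trans zero_le
    _ ≤ _ := by
        rw [Finset.sum_const, nsmul_eq_mul]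
        gcongr

open Classical in
-- If the sample contains a point `a` of the near part of a cluster, each `q` of the cluster with `δ
-- q ≥ δ a` is within `δ q + δ a ≤ 2 * δ q` of `a`. Hence the bad points of that cluster precede `a`
-- and make up at most a fraction `ε` of it. Clusters lighter than `ε * W / k` contribute at most `ε
-- * W` altogether, even if they are bad throughout.
theorem bad_weight_le {d n : ℕ} {p : Fin n → Pt d} {w : Fin n → ℕ} {φ : Fin n → Fin n} {ε : ℝ}
    (hε0 : 0 ≤ ε) {k : ℕ} (hk : 1 ≤ k) (hφ : (Finset.univ.image φ).card ≤ k)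
    {l : List (Fin n)} {W s : ℕ} (hW : (W : ℝ) = ∑ i ∈ l.toFinset, (w i : ℝ)) {u : ℕ → ℕ}
    (hmiss : ¬ Misses w φ (fun i => dist (p i) (p (φ i))) ε k l W s u) {S : Set (Fin n)}
    (hS : ∀ j < s, ∀ a, locate w s l (j * W + u j) = some a → a ∈ S) :
    ∑ i ∈ l.toFinset with ∀ x ∈ S, 2 * dist (p i) (p (φ i)) < dist (p i) (p x), (w i : ℝ) ≤
      2 * ε * W := by
  set P := l.toFinset with hP
  set δ : Fin n → ℝ := fun i => dist (p i) (p (φ i)) with hδ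
  set B := P.filter fun i => ∀ x ∈ S, 2 * δ i < dist (p i) (p x) with hB
  have hk' : (0 : ℝ) < k := by exact_mod_cast hk
  have key : ∀ i ∈ Finset.univ.image φ, ∑ q ∈ B with φ q = i, (w q : ℝ) ≤
      ε * W / k + ε * ∑ q ∈ P with φ q = i, (w q : ℝ) := by
    intro i hi
    have h0 : 0 ≤ ∑ q ∈ P with φ q = i, (w q : ℝ) := Finset.sum_nonneg fun _ _ => by positivity
    by_cases hlarge : ε * W / k ≤ ∑ q ∈ P with φ q = i, (w q : ℝ)
    · have : ∃ j < s, ∃ a ∈ nearPart w φ δ ε P i, locate w s l (j * W + u j) = some a := by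
        by_contra hc
        push Not at hc
        exact hmiss ⟨i, hi, hlarge, hc⟩
      obtain ⟨j, hj, a, ha, hja⟩ := this
      obtain ⟨-, hai, haw⟩ := Finset.mem_filter.1 ha
      refine le_trans ?_ (haw.trans (le_add_of_nonneg_left (by positivity)))
      refine Finset.sum_le_sum_of_subset_of_nonneg ?_ fun _ _ _ => by positivity
      intro q hq
      obtain ⟨hqB, hqi⟩ := Finset.mem_filter.1 hq
      obtain ⟨hqP, hqB⟩ := Finset.mem_filter.1 hqB
      refine Finset.mem_filter.2 ⟨hqP, hqi, ?_⟩
      have h1 := hqB a (hS j hj a hja)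
      have h2 := dist_triangle_right (p q) (p a) (p i)
      simp only [hδ, hqi, hai] at h1 ⊢
      linarith
    · have h1 : ∑ q ∈ B with φ q = i, (w q : ℝ) ≤ ∑ q ∈ P with φ q = i, (w q : ℝ) :=
        Finset.sum_le_sum_of_subset_of_nonneg
          (Finset.filter_subset_filter _ (Finset.filter_subset _ _)) fun _ _ _ => by positivity
      have h2 : 0 ≤ ε * ∑ q ∈ P with φ q = i, (w q : ℝ) := mul_nonneg hε0 h0
      linarith
  have hfib : ∀ Q : Finset (Fin n), ∑ i ∈ Finset.univ.image φ, ∑ q ∈ Q with φ q = i, (w q : ℝ) =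
      ∑ q ∈ Q, (w q : ℝ) := fun Q =>
    Finset.sum_fiberwise_of_maps_to (fun q _ => Finset.mem_image_of_mem _ (Finset.mem_univ q)) _
  rw [← hfib B]
  refine (Finset.sum_le_sum key).trans ?_
  rw [Finset.sum_add_distrib, ← Finset.mul_sum, hfib P, ← hW, Finset.sum_const, nsmul_eq_mul]
  have h1 : ((Finset.univ.image φ).card : ℝ) * (ε * W / k) ≤ k * (ε * W / k) :=
    mul_le_mul_of_nonneg_right (by exact_mod_cast hφ) (by positivity)
  rw [mul_div_cancel₀ _ hk'.ne'] at h1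
  linarith

open Classical in
/-- The points up to which `κ` has less than an eighth of the weight. -/
def lowPart {n : ℕ} (w : Fin n → ℕ) (κ : Fin n → ℝ) (P : Finset (Fin n)) : Finset (Fin n) :=
  {x ∈ P | ∑ q ∈ P with κ q ≤ κ x, (w q : ℝ) < (∑ q ∈ P, (w q : ℝ)) / 8}

open Classical in
/-- At least half of the sample falls into the low part. -/
def Skewed {n : ℕ} (w : Fin n → ℕ) (κ : Fin n → ℝ) (l : List (Fin n)) (W m : ℕ)
    (u : ℕ → ℕ) : Prop :=
  m ≤ 2 * hits w m l W u (lowPart w κ l.toFinset)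

open Classical in
theorem tape_skewed_le {n : ℕ} (w : Fin n → ℕ) (κ : Fin n → ℝ)
    {l : List (Fin n)} (hl : l.Nodup) {W : ℕ} (hW : (l.map w).sum = W) (hW0 : 0 < W) (m : ℕ)
    (u : ℕ → ℕ) :
    tape W m 0 u (fun u => ind (Skewed w κ l W m u)) ≤
      ENNReal.ofReal (Real.exp (-(m / 4))) := by
  refine tape_tail_le w hl hW hW0 m
    (fun a ha => List.mem_toFinset.1 (Finset.filter_subset _ _ ha)) ?_ u
  have hWr : (W : ℝ) = ∑ q ∈ l.toFinset, (w q : ℝ) := by rw [← hW, list_sum_cast_eq hl]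
  rw [hWr]
  exact low_weight l.toFinset w κ (by positivity)

open Classical in
-- If the points with `κ ≤ r` weighed less than an eighth, they would all belong to the low part,
-- and half of the sample with them. Used for the squared distance and for its negative, this
-- controls both sides of the median.
theorem low_weight_ge {n : ℕ} {w : Fin n → ℕ} {κ : Fin n → ℝ}
    {l : List (Fin n)} {W m : ℕ} {u : ℕ → ℕ} (hu : ¬ Skewed w κ l W m u) {q : ℕ → Fin n}
    (hq : ∀ j < m, locate w m l (j * W + u j) = some (q j)) {r : ℝ}
    (hr : m ≤ 2 * ((Finset.range m).filter fun j => κ (q j) ≤ r).card) :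
    (∑ i ∈ l.toFinset, (w i : ℝ)) / 8 ≤ ∑ i ∈ l.toFinset with κ i ≤ r, (w i : ℝ) := by
  by_contra hc
  apply hu
  refine hr.trans (Nat.mul_le_mul_left 2 (card_le_hits fun j hj => ?_))
  obtain ⟨hj, hjr⟩ := Finset.mem_filter.1 hj
  have hlj := hq j (Finset.mem_range.1 hj)
  refine ⟨Finset.mem_range.1 hj, q j, Finset.mem_filter.2 ⟨?_, ?_⟩, hlj⟩
  · exact List.mem_toFinset.2 (locate_mem hlj)
  · refine lt_of_le_of_lt (Finset.sum_le_sum_of_subset_of_nonneg ?_ fun _ _ _ => by positivity)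
      (not_le.1 hc)
    intro i hi
    obtain ⟨h1, h2⟩ := Finset.mem_filter.1 hi
    exact Finset.mem_filter.2 ⟨h1, h2.trans hjr⟩

/-! ## More rules -/

/-- The least bound. -/
def best (P : Prog) (T : ℕ) (g : State → ℝ≥0∞) (σ : State) : ℝ≥0∞ :=
  ⨆ (σ₀ : Store) (_ : σ₀.view = σ), pwp P σ₀ T fun τ => g τ.view

theorem bound_best (P : Prog) (T : ℕ) (g : State → ℝ≥0∞) (σ : State) :
    Bound P σ T g (best P T g σ) := fun σ₀ hσ =>
  le_iSup₂ (f := fun (σ₀ : Store) (_ : σ₀.view = σ) => pwp P σ₀ T fun τ => g τ.view) σ₀ hσ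

theorem Bound.best_le {P : Prog} {T : ℕ} {g : State → ℝ≥0∞} {σ : State} {v : ℝ≥0∞}
    (h : Bound P σ T g v) : best P T g σ ≤ v := iSup₂_le h

/-- Takes the exact behaviour of the second program as the function to be bounded after the first,
so that no intermediate function has to be named. -/
theorem Bound.seq_best {P P' : Prog} {σ : State} {T T' : ℕ} {g : State → ℝ≥0∞} {v : ℝ≥0∞}
    (h : Bound P σ T (best P' T' g) v) : Bound (.seq P P') σ (1 + T + T') g v :=
  h.seq fun τ => bound_best P' T' g τ

theorem Bound.loop_stop {x y : Var} {P : Prog} {σ : State} (h : ¬ σ.reg x < σ.reg y)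
    (g : State → ℝ≥0∞) : Bound (.loop x.idx y.idx P) σ 1 g (g σ) := fun σ₀ hσ =>
  (pwp_loop_stop P (by subst hσ; exact h) 0 _).trans_le (by rw [hσ])

theorem Bound.loop_step {x y : Var} {P : Prog} {σ : State} {T T' : ℕ} {g : State → ℝ≥0∞}
    {v : ℝ≥0∞} (hlt : σ.reg x < σ.reg y)
    (h : Bound P σ T (best (.loop x.idx y.idx P) T' g) v) :
    Bound (.loop x.idx y.idx P) σ (1 + T + T') g v := fun σ₀ hσ =>
  (pwp_loop_step P (by subst hσ; exact hlt) T T' _).trans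
    ((wp_mono _ _ fun τ => bound_best _ _ _ _ τ rfl).trans (h σ₀ hσ))

theorem floor_of_eq {x : ℝ} {a : ℕ} (h : x = a) : ⌊x⌋₊ = a := by rw [h, Nat.floor_natCast]

infixr:60 " ;; " => Stmt.seq

open KClustering.Expr KClustering.Var KClustering.Stmt

/-! ## Data in memory -/

/-- The points, their weights, and the constants are in place. -/
structure Data {d n : ℕ} (p : Fin n → Pt d) (w : Fin n → ℕ) (σ : State) : Prop where
  nn : σ.reg nn = n
  zero : σ.reg zero = 0
  pt : ∀ (i : Fin n) (j : Fin d), σ.mem (i * d + j) = p i j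
  wt : ∀ i : Fin n, σ.mem (n * d + i) = w i

theorem Data.of_fr {d n : ℕ} {p : Fin n → Pt d} {w : Fin n → ℕ} {σ τ : State} {R : List Var}
    {M : Set ℕ} (h : Data p w σ) (hf : Fr R M σ τ) (hn : Var.nn ∉ R) (hz : Var.zero ∉ R)
    (hM : ∀ a ∈ M, n * (d + 1) ≤ a) : Data p w τ := by
  refine ⟨(hf.reg _ hn).trans h.nn, (hf.reg _ hz).trans h.zero, fun i j => ?_, fun i => ?_⟩
  · rw [hf.mem, h.pt]
    intro hc
    have h1 := hM _ hc
    have h2 : ((i : ℕ) + 1) * d ≤ n * d := Nat.mul_le_mul_right _ i.2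
    have h3 := j.2
    rw [mul_add] at h1
    rw [add_mul] at h2
    omega
  · rw [hf.mem, h.wt]
    intro hc
    have h1 := hM _ hc
    have := i.2
    rw [mul_add] at h1
    omega

/-- The numbers of the points in `l` are in memory from cell `a` on. -/
def Holds {n : ℕ} (a : ℕ) (l : List (Fin n)) (σ : State) : Prop :=
  ∀ (t : ℕ) (ht : t < l.length), σ.mem (a + t) = ((l[t] : ℕ) : ℝ)

theorem Holds.of_fr {n a : ℕ} {l : List (Fin n)} {σ τ : State} {R : List Var} {M : Set ℕ}
    (h : Holds a l σ) (hf : Fr R M σ τ) (hM : ∀ b ∈ M, a ≤ b → a + l.length ≤ b) :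
    Holds a l τ := fun t ht => by
  rw [hf.mem, h t ht]
  intro hc
  have := hM _ hc (by omega)
  omega

/-! ## Sampling -/

/-- Random positions, one in each stratum, and a sentinel. -/
def fillBody : Stmt := put (base + jj) (jj * tot + val) ;; assign jj (jj + nat 1)

def fillLoop : Prog :=
  .loop jj.idx len.idx (.seq (draw val (tot - nat 1)) fillBody.code)

/-- The position `len * tot` lies beyond all elements; placed after the last stratum, it keeps the
merge from accepting more than `len` positions. -/
def fillInit : Stmt := put (base + len) (len * tot) ;; assign jj (nat 0)

def fill : Prog := .seq fillInit.code fillLoop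

theorem fillLoop_bound {σ : State} {β c W : ℕ} (hW : 0 < W)
    {g : State → ℝ≥0∞} {v : (ℕ → ℕ) → ℝ≥0∞}
    (hg : ∀ u τ, (∀ j < c, u j < W) → Fr [val, jj] (Set.Ico β (β + c)) σ τ →
      (∀ j < c, τ.mem (β + j) = ((j * W + u j : ℕ) : ℝ)) → g τ ≤ v u)
    (hb : σ.reg base = β) (hc : σ.reg len = c) (htot : σ.reg tot = W)
    (rem j : ℕ) (hj : j + rem = c) (u : ℕ → ℕ) (τ : State) (hτ : τ.reg jj = j)
    (hf : Fr [val, jj] (Set.Ico β (β + c)) σ τ) (hu : ∀ i < j, u i < W)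
    (hm : ∀ i < j, τ.mem (β + i) = ((i * W + u i : ℕ) : ℝ)) :
    Bound fillLoop τ ((9 + fillBody.time) * rem + 1) g (tape W rem j u v) := by
  induction rem generalizing j u τ with
  | zero =>
    obtain rfl : j = c := by omega
    refine (Bound.loop_stop ?_ g).mono (by omega) (fun _ => le_rfl) (hg u τ hu hf hm)
    rw [hτ, hf.reg _ (by decide), hc]
    exact lt_irrefl _
  | succ rem ih =>
    have hlt : τ.reg jj < τ.reg len := by
      rw [hτ, hf.reg _ (by decide), hc, Nat.cast_lt]
      omega
    obtain ⟨N, rfl⟩ : ∃ N, W = N + 1 := ⟨W - 1, by omega⟩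
    have hN : (Expr.eval τ (tot - nat 1)) = N := by
      simp only [eval_sub, eval_var, eval_nat, hf.reg tot (by decide), htot]
      push_cast
      ring
    refine Bound.mono (T := 1 + (1 + (1 + (Expr.time (tot - nat 1)) + 1) + fillBody.time) +
        ((9 + fillBody.time) * rem + 1)) ?_ ?_ (fun _ => le_rfl) le_rfl
    · refine Bound.loop_step hlt (Bound.seq_best ((draw_bound hN _).mono le_rfl (fun _ => le_rfl) ?_))
      rw [tape]
      refine ENNReal.div_le_div_right (Finset.sum_le_sum fun x hx => ?_) _
      refine Bound.best_le (Runs.bound (Stmt.runs _ rfl) ?_)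
      rintro _ rfl
      refine Bound.best_le ?_
      have haddr : ⌊((β : ℝ) + (j : ℝ))⌋₊ = β + j := floor_of_eq (by push_cast; ring)
      have hb' := (hf.reg base (by decide)).trans hb
      have ht' := (hf.reg tot (by decide)).trans htot
      refine ih (j + 1) (by omega) (Function.update u j x) _ ?_ ?_ ?_ ?_
      · simp [fillBody, den, hτ]
      · refine hf.trans (R' := [val, jj]) (M' := {β + j}) ⟨fun y hy => ?_, fun a ha => ?_⟩
          (List.Subset.refl _) (List.Subset.refl _) subset_rfl ?_
        · simp only [List.mem_cons, List.not_mem_nil, or_false, not_or] at hy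
          simp [fillBody, den, hy.1, hy.2]
        · simp only [Set.mem_singleton_iff] at ha
          simp [fillBody, den, hτ, hb', haddr, ha]
        · simp
          omega
      · intro i hi
        by_cases h : i = j
        · subst h
          simpa using hx
        · rw [Function.update_of_ne h]
          exact hu i (by omega)
      · intro i hi
        by_cases h : i = j
        · subst h
          simp [fillBody, den, hτ, hb', ht', haddr]
        · rw [Function.update_of_ne h, ← hm i (by omega)]
          simp [fillBody, den, hτ, hb', haddr, h]
    · simp only [Expr.time_sub, Expr.time]
      have : (9 + fillBody.time) * (rem + 1) = (9 + fillBody.time) * rem + (9 + fillBody.time) :=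
        by ring
      omega

theorem fill_bound {σ : State} {β c W : ℕ} (hW : 0 < W)
    {g : State → ℝ≥0∞} {v : (ℕ → ℕ) → ℝ≥0∞}
    (hb : σ.reg base = β) (hc : σ.reg len = c) (htot : σ.reg tot = W)
    (hg : ∀ u τ, (∀ j < c, u j < W) → Fr [val, jj] (Set.Icc β (β + c)) σ τ →
      (∀ j < c, τ.mem (β + j) = ((j * W + u j : ℕ) : ℝ)) →
      τ.mem (β + c) = ((c * W : ℕ) : ℝ) → g τ ≤ v u) (u : ℕ → ℕ) :
    Bound fill σ ((10 + fillBody.time + fillInit.time) * (c + 1)) g (tape W c 0 u v) := by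
  have haddr : ⌊((β : ℝ) + (c : ℝ))⌋₊ = β + c := floor_of_eq (by push_cast; ring)
  have hden : fillInit.den σ = (σ.put (β + c) (c * W)).set jj 0 := by
    simp [fillInit, den, hb, hc, haddr, htot]
  refine Bound.mono (T := 1 + fillInit.time + ((9 + fillBody.time) * c + 1)) ?_ ?_
    (fun _ => le_rfl) le_rfl
  · refine Runs.seq_bound (Stmt.runs _ rfl) ?_
    rintro _ rfl
    rw [hden]
    refine fillLoop_bound hW ?_ (by simpa using hb) (by simpa using hc) (by simpa using htot)
      c 0 (by omega) u _ (by simp) (Fr.refl _ _ _) (by simp) (by simp)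
    intro u' τ h1 h2 h3
    refine hg u' τ h1 ⟨fun y hy => ?_, fun a ha => ?_⟩ h3 ?_
    · rw [h2.reg y hy]
      simp only [List.mem_cons, List.not_mem_nil, or_false, not_or] at hy
      simp [hy.2]
    · simp only [Set.mem_Icc, not_and, not_le] at ha
      rw [h2.mem a (by simp; omega)]
      simp
      omega
    · rw [h2.mem _ (by simp)]
      simp
  · have : (10 + fillBody.time + fillInit.time) * (c + 1) = (9 + fillBody.time) * c +
      (1 + fillInit.time) * c + (10 + fillBody.time + fillInit.time) := by ring
    omega

/-- Moves through the strata and the points simultaneously, and replaces the positions by the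
points at these positions. -/
def mergeBody (d : ℕ) : Stmt :=
  assign pid (ld (nn * nat (d + 1) + tt)) ;; assign xx (cum + len * ld (nn * nat d + pid)) ;;
  Stmt.ite (ld (base + jj)) xx (put (base + jj) pid ;; assign jj (jj + nat 1))
    (assign cum xx ;; assign tt (tt + nat 1))

def mergeInit : Stmt := assign tt (nat 0) ;; assign jj (nat 0) ;; assign cum (nat 0)

def merge (d : ℕ) : Prog :=
  .seq mergeInit.code (.loop tt.idx na.idx (mergeBody d).code)

/-- Positions in successive strata are monotone, so one simultaneous pass suffices: each iteration
either serves a stratum or moves on to the next element, and the measure is the sum of what remains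
of both lists. Results replace positions in place, which is safe because positions before `jj` are
never read again. -/
theorem merge_runs {d n : ℕ} {p : Fin n → Pt d} {w : Fin n → ℕ} {σ : State} {l : List (Fin n)}
    {β c W : ℕ} (hD : Data p w σ) (hl : Holds (n * (d + 1)) l σ) (hln : l.length ≤ n)
    (hna : σ.reg na = l.length)
    (hW : (l.map w).sum = W) (hb : σ.reg base = β) (hc : σ.reg len = c) (hβ : n * (d + 2) ≤ β)
    {pos : ℕ → ℕ} (hmono : ∀ j < c, pos j ≤ pos (j + 1)) (hpc : pos c = c * W)
    (hlt : ∀ j < c, pos j < c * W) (hpos : ∀ j ≤ c, σ.mem (β + j) = pos j) :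
    Runs (merge d) σ ((3 + mergeInit.time + (mergeBody d).time) * (l.length + c + 1)) fun τ =>
      Fr [tt, jj, cum, pid, xx] (Set.Ico β (β + c)) σ τ ∧
      ∃ q : List (Fin n), q.length = c ∧ Holds β q τ ∧
        ∀ (j : ℕ) (hj : j < q.length), locate w c l (pos j) = some q[j] := by
  set I : ℕ × ℕ → State → Prop := fun a τ =>
    a.1 ≤ l.length ∧ a.2 ≤ c ∧ Fr [tt, jj, cum, pid, xx] (Set.Ico β (β + c)) σ τ ∧
    τ.reg tt = a.1 ∧ τ.reg jj = a.2 ∧ τ.reg cum = (c * ((l.take a.1).map w).sum : ℕ) ∧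
    c * ((l.take a.1).map w).sum ≤ pos a.2 ∧ (∀ i, a.2 ≤ i → i ≤ c → τ.mem (β + i) = pos i) ∧
    ∃ q : List (Fin n), q.length = a.2 ∧ Holds β q τ ∧
        ∀ (j : ℕ) (hj : j < q.length), locate w c l (pos j) = some q[j] with hI
  have key := Runs.while (x := tt) (y := na) (P := (mergeBody d).code) (c := (mergeBody d).time)
    I (fun a => (l.length - a.1) + (c - a.2)) ?_ (a := (0, 0)) (σ := mergeInit.den σ) ?_
  · refine (Runs.seq (Stmt.runs mergeInit rfl) (T' := ((mergeBody d).time + 1) * (l.length + c) + 1)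
      (fun τ hτ => ?_)).mono ?_ (fun _ h => h)
    · rw [← hτ]
      refine key.mono (by simp) ?_
      rintro ρ ⟨⟨t, j⟩, ⟨h1, h2, h3, h4, h5, h6, h7, h8, h9⟩, h10⟩
      refine ⟨h3, ?_⟩
      rw [h4, h3.reg na (by decide), hna, Nat.cast_lt] at h10
      have ht : t = l.length := by simp only at h1 h10; omega
      simp only [ht, List.take_length, hW] at h7
      obtain rfl : j = c := by
        by_contra hne
        have := hlt j (by simp only at h2; omega)
        omega
      exact h9
    · have : (3 + mergeInit.time + (mergeBody d).time) * (l.length + c + 1) =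
          ((mergeBody d).time + 1) * (l.length + c) + (2 + mergeInit.time) * (l.length + c) +
          (3 + mergeInit.time + (mergeBody d).time) := by ring
      omega
  · rintro ⟨t, j⟩ τ ⟨h1, h2, h3, h4, h5, h6, h7, h8, q, h9, h10, h11⟩ hlt'
    simp only at h1 h2 h4 h5 h6 h7 h8 h9
    rw [h4, h3.reg na (by decide), hna, Nat.cast_lt] at hlt'
    refine Stmt.runs _ ?_
    have hDτ : Data p w τ := hD.of_fr h3 (by decide) (by decide) fun a ha => by
      have := ha.1
      rw [mul_add] at hβ ⊢
      omega
    have hlτ : Holds (n * (d + 1)) l τ := hl.of_fr h3 fun a ha _ => by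
      have := ha.1
      rw [mul_add] at hβ ⊢
      omega
    have a1 : ⌊(n : ℝ) * ((d + 1 : ℕ) : ℝ) + t⌋₊ = n * (d + 1) + t := floor_of_eq (by push_cast; ring)
    have a2 : ⌊(n : ℝ) * (d : ℝ) + ((l[t] : ℕ) : ℝ)⌋₊ = n * d + l[t] :=
      floor_of_eq (by push_cast; ring)
    have a3 : ⌊(β : ℝ) + (j : ℝ)⌋₊ = β + j := floor_of_eq (by push_cast; ring)
    have hb' := (h3.reg base (by decide)).trans hb
    have hc' := (h3.reg len (by decide)).trans hc
    have htake : ((l.take (t + 1)).map w).sum = ((l.take t).map w).sum + w l[t] := by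
      rw [List.take_add_one, List.getElem?_eq_getElem hlt', List.map_append, List.sum_append]
      rfl
    have e1 : τ.mem (n * (d + 1) + t) = ((l[t] : ℕ) : ℝ) := hlτ t hlt'
    have e2 := hDτ.wt l[t]
    have e3 : τ.mem (β + j) = pos j := h8 j le_rfl h2
    set τ₁ : State := (τ.set pid ((l[t] : ℕ) : ℝ)).set xx
      ((c * ((l.take (t + 1)).map w).sum : ℕ) : ℝ) with hτ₁
    have hden : (mergeBody d).den τ = if pos j < c * ((l.take (t + 1)).map w).sum then
        (τ₁.put (β + j) ((l[t] : ℕ) : ℝ)).set jj ((j + 1 : ℕ) : ℝ) else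
        (τ₁.set cum ((c * ((l.take (t + 1)).map w).sum : ℕ) : ℝ)).set tt ((t + 1 : ℕ) : ℝ) := by
      have s1 : (assign pid (ld (nn * nat (d + 1) + tt)) ;;
          assign xx (cum + len * ld (nn * nat d + pid))).den τ = τ₁ := by
        simp only [den, eval_ld, eval_add, eval_mul, eval_var, eval_nat, hDτ.nn, h4, a1, e1,
          State.set_reg, State.set_mem, if_true, reduceCtorEq, if_false, a2, e2, h6, hc', hτ₁, htake]
        push_cast
        rw [mul_add]
      have s2 : (mergeBody d).den τ = Stmt.den (Stmt.ite (ld (base + jj)) xx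
          (put (base + jj) pid ;; assign jj (jj + nat 1))
          (assign cum xx ;; assign tt (tt + nat 1)))
          ((assign pid (ld (nn * nat (d + 1) + tt)) ;;
          assign xx (cum + len * ld (nn * nat d + pid))).den τ) := rfl
      rw [s2, s1]
      have r1 : τ₁.reg base = β := by simpa [hτ₁] using hb'
      have r2 : τ₁.reg jj = j := by simpa [hτ₁] using h5
      have r3 : τ₁.reg tt = t := by simpa [hτ₁] using h4
      have r4 : τ₁.reg pid = (l[t] : ℕ) := by simp [hτ₁]
      have r5 : τ₁.reg xx = ((c * ((l.take (t + 1)).map w).sum : ℕ) : ℝ) := by simp [hτ₁]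
      have r6 : τ₁.mem (β + j) = pos j := by simpa [hτ₁] using e3
      simp only [den, eval_ld, eval_add, eval_var, r1, r2, r5, a3, r6, Nat.cast_lt, eval_nat,
        State.set_reg, State.put_reg, r4, r3, if_false, reduceCtorEq]
      push_cast
      rfl
    have hfr : Fr [tt, jj, cum, pid, xx] ∅ τ τ₁ := by
      refine ⟨fun y hy => ?_, fun a _ => rfl⟩
      simp only [List.mem_cons, List.not_mem_nil, or_false, not_or] at hy
      simp [hτ₁, hy]
    rw [hden]
    split_ifs with hcase
    -- The sentinel is `c * W`, which no partial sum exceeds, so the comparison cannot succeed at `j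
    -- = c`.
    · have hjc : j < c := by
        by_contra hne
        obtain rfl : j = c := by omega
        have h12 : ((l.take (t + 1)).map w).sum ≤ W := by
          rw [← hW]
          exact List.Sublist.sum_le_sum ((List.take_sublist _ _).map _) (by simp)
        have := Nat.mul_le_mul_left j h12
        omega
      refine ⟨(t, j + 1), ⟨h1, hjc, ?_, ?_, ?_, ?_, ?_, ?_, q ++ [l[t]], ?_, ?_, ?_⟩, ?_⟩
      · refine (h3.trans hfr (List.Subset.refl _) (List.Subset.refl _) subset_rfl
          (Set.empty_subset _)).trans (R' := [jj]) (M' := {β + j})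
          ⟨fun y hy => ?_, fun a ha => ?_⟩ (List.Subset.refl _) (by simp) subset_rfl
          (by simp; omega)
        · simp only [List.mem_singleton] at hy
          simp [hy]
        · simp only [Set.mem_singleton_iff] at ha
          simp [ha]
      · simpa [hτ₁] using h4
      · simp
      · simpa [hτ₁] using h6
      · exact h7.trans (hmono j hjc)
      · intro i hi1 hi2
        simp only [State.set_mem, State.put_mem]
        rw [if_neg (by omega)]
        exact h8 i (by omega) hi2
      · simp [h9]
      · intro i hi
        simp only [State.set_mem, State.put_mem]
        by_cases hij : i = j
        · subst hij
          rw [if_pos rfl, List.getElem_append_right (by omega)]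
          simp
        · have hi' : i < q.length := by simp at hi; omega
          rw [if_neg (by omega), List.getElem_append_left hi']
          exact h10 i hi'
      · intro i hi
        by_cases hij : i = j
        · subst hij
          rw [List.getElem_append_right (by omega)]
          simp only [List.getElem_singleton]
          refine locate_eq_some w c l t _ hlt' h7 ?_
          rw [htake, mul_add] at hcase
          exact hcase
        · have hi' : i < q.length := by simp at hi; omega
          rw [List.getElem_append_left hi']
          exact h11 i hi'
      · simp only
        omega
    · refine ⟨(t + 1, j), ⟨hlt', h2, ?_, ?_, ?_, ?_, ?_, ?_, q, h9, ?_, h11⟩, ?_⟩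
      · refine (h3.trans hfr (List.Subset.refl _) (List.Subset.refl _) subset_rfl
          (Set.empty_subset _)).trans (R' := [cum, tt]) (M' := ∅)
          ⟨fun y hy => ?_, fun a ha => rfl⟩ (List.Subset.refl _) (by simp) subset_rfl
          (by simp)
        simp only [List.mem_cons, List.not_mem_nil, or_false, not_or] at hy
        simp [hy]
      · simp
      · simpa [hτ₁] using h5
      · simp
      · exact not_lt.1 hcase
      · exact h8
      · exact h10
      · simp only
        omega
  · refine ⟨by simp, by simp, ⟨fun y hy => ?_, fun a _ => by simp [mergeInit, den]⟩, ?_, ?_, ?_, ?_,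
      ?_, [], rfl, fun t ht => by simp at ht, fun t ht => by simp at ht⟩
    · simp only [List.mem_cons, List.not_mem_nil, or_false, not_or] at hy
      simp [mergeInit, den, hy]
    · simp [mergeInit, den]
    · simp [mergeInit, den]
    · simp [mergeInit, den]
    · simp
    · intro i _ hi
      simpa [mergeInit, den] using hpos i hi

theorem Runs.for_init {x y : Var} {P : Prog} {S : Stmt} {c N : ℕ} (I : ℕ → State → Prop)
    (hx : ∀ j σ, I j σ → σ.reg x = j ∧ σ.reg y = N)
    (h : ∀ j σ, j < N → I j σ → Runs P σ c (I (j + 1))) {σ : State} (h0 : I 0 (S.den σ)) :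
    Runs (.seq S.code (.loop x.idx y.idx P)) σ ((c + S.time + 2) * (N + 1)) (I N) := by
  refine (Runs.seq (Stmt.runs S rfl) (T' := (c + 1) * N + 1) (Q' := I N)
    (by rintro _ rfl; exact Runs.for I hx h h0)).mono ?_ fun _ h => h
  have : (c + S.time + 2) * (N + 1) = (c + 1) * N + (S.time + 1) * N + (c + S.time + 2) := by ring
  omega

/-! ## Distances to the sample -/

/-- The squared distance of the points `pid` and `yy`, restricted to the first coordinates. -/
def sqDistE (d : ℕ) : ℕ → Expr
  | 0 => nat 0
  | j + 1 => sqDistE d j + (ld (pid * nat d + nat j) - ld (yy * nat d + nat j)) *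
      (ld (pid * nat d + nat j) - ld (yy * nat d + nat j))

theorem eval_sqDistE {d n : ℕ} {p : Fin n → Pt d} {w : Fin n → ℕ} {σ : State} (hD : Data p w σ)
    {a b : Fin n} (ha : σ.reg pid = (a : ℕ)) (hb : σ.reg yy = (b : ℕ)) :
    (sqDistE d d).eval σ = dist (p a) (p b) ^ 2 := by
  have key : ∀ (j : ℕ) (hj : j ≤ d), (sqDistE d j).eval σ =
      ∑ i : Fin j, (p a (Fin.castLE hj i) - p b (Fin.castLE hj i)) ^ 2 := by
    intro j
    induction j with
    | zero => simp [sqDistE]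
    | succ j ih =>
      intro hj
      have h1 : ∀ c : Fin n, ⌊((c : ℕ) : ℝ) * (d : ℝ) + (j : ℝ)⌋₊ = c * d + j := fun c =>
        floor_of_eq (by push_cast; ring)
      have h2 : ∀ c : Fin n, σ.mem (c * d + j) = p c ⟨j, hj⟩ := fun c => hD.pt c ⟨j, hj⟩
      rw [Fin.sum_univ_castSucc, sqDistE, eval_add, ih (by omega)]
      congr 1
      simp only [eval_mul, eval_sub, eval_ld, eval_add, eval_var, ha, hb, eval_nat, h1, h2]
      rw [← sq]
      rfl
  rw [key d le_rfl, EuclideanSpace.dist_eq, Real.sq_sqrt (Finset.sum_nonneg fun _ _ => sq_nonneg _)]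
  exact Finset.sum_congr rfl fun i _ => by rw [Real.dist_eq, sq_abs]; rfl

/-- `D` is the squared distance to the points of `X`. -/
def IsSqDist {d n : ℕ} (p : Fin n → Pt d) (X : List (Fin n)) (D : Fin n → ℝ) : Prop :=
  ∀ i, (∀ x ∈ X, D i ≤ dist (p i) (p x) ^ 2) ∧ ∃ x ∈ X, D i = dist (p i) (p x) ^ 2

theorem exists_isSqDist {d n : ℕ} (p : Fin n → Pt d) {X : List (Fin n)} (hX : X ≠ []) :
    ∃ D, IsSqDist p X D := by
  have : ∀ i, ∃ v : ℝ, (∀ x ∈ X, v ≤ dist (p i) (p x) ^ 2) ∧ ∃ x ∈ X, v = dist (p i) (p x) ^ 2 := by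
    intro i
    obtain ⟨x, hx, hmin⟩ := X.toFinset.exists_min_image (fun x => dist (p i) (p x) ^ 2)
      (by simpa using hX)
    exact ⟨_, fun y hy => hmin y (by simpa using hy), x, by simpa using hx, rfl⟩
  choose D hD using this
  exact ⟨D, hD⟩

def nearestBody (d : ℕ) : Stmt :=
  assign yy (ld (xs + ll)) ;; assign xx (sqDistE d d) ;;
  Stmt.ite xx Var.best (assign Var.best xx) skip ;; assign ll (ll + nat 1)

def nearestInit (d q : ℕ) : Stmt :=
  assign pid (ld (nn * nat q + jj)) ;; assign yy (ld xs) ;;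
  assign Var.best (sqDistE d d) ;; assign ll (nat 0)

/-- Computes the squared distance of the `jj`-th query point to the sample. -/
def nearest (d q : ℕ) : Prog :=
  .seq (nearestInit d q).code (.loop ll.idx ss.idx (nearestBody d).code)

theorem nearest_runs {d n : ℕ} {p : Fin n → Pt d} {w : Fin n → ℕ} {σ : State} {X : List (Fin n)}
    {α j q : ℕ} {a : Fin n} (hD : Data p w σ) (hxs : σ.reg xs = α) (hX : Holds α X σ)
    (hs : σ.reg ss = X.length) (hX0 : X ≠ []) (hj : σ.reg jj = j)
    (ha : σ.mem (n * q + j) = (a : ℕ)) {D : Fin n → ℝ} (hDist : IsSqDist p X D) :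
    Runs (nearest d q) σ (((nearestBody d).time + (nearestInit d q).time + 2) * (X.length + 1))
      fun τ => Fr [pid, yy, Var.best, ll, xx] ∅ σ τ ∧ τ.reg Var.best = D a := by
  have hX1 : 0 < X.length := List.length_pos_iff.2 hX0
  set I : ℕ → State → Prop := fun i τ => Fr [pid, yy, Var.best, ll, xx] ∅ σ τ ∧
    τ.reg pid = (a : ℕ) ∧ τ.reg ll = i ∧
    (∀ (l : ℕ) (hl : l < X.length), l < i → τ.reg Var.best ≤ dist (p a) (p X[l]) ^ 2) ∧
    ∃ x ∈ X, τ.reg Var.best = dist (p a) (p x) ^ 2 with hI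
  refine (Runs.for_init (N := X.length) I ?_ ?_ ?_).mono le_rfl ?_
  · rintro i τ ⟨h1, h2, h3, h4⟩
    exact ⟨h3, (h1.reg _ (by decide)).trans hs⟩
  · rintro i τ hi ⟨h1, h2, h3, h4, h5⟩
    refine Stmt.runs _ ?_
    have a1 : ⌊(α : ℝ) + (i : ℝ)⌋₊ = α + i := floor_of_eq (by push_cast; ring)
    have hDτ : Data p w τ := hD.of_fr h1 (by decide) (by decide) (by simp)
    have hxτ := (h1.reg xs (by decide)).trans hxs
    have e1 : τ.mem (α + i) = (X[i] : ℕ) := by rw [h1.mem _ (by simp)]; exact hX i hi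
    have e2 : (sqDistE d d).eval (τ.set yy ((X[i] : ℕ) : ℝ)) = dist (p a) (p X[i]) ^ 2 := by
      refine eval_sqDistE (w := w) (σ := τ.set yy ((X[i] : ℕ) : ℝ)) (hDτ.of_fr (R := [yy]) (M := ∅) ⟨fun y hy => ?_, fun _ _ => rfl⟩
        (by decide) (by decide) (by simp)) (by simpa using h2) (by simp)
      simp only [List.mem_singleton] at hy
      simp [hy]
    have hden : (nearestBody d).den τ = (if dist (p a) (p X[i]) ^ 2 < τ.reg Var.best then
        ((τ.set yy ((X[i] : ℕ) : ℝ)).set xx (dist (p a) (p X[i]) ^ 2)).set Var.best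
          (dist (p a) (p X[i]) ^ 2) else
        (τ.set yy ((X[i] : ℕ) : ℝ)).set xx (dist (p a) (p X[i]) ^ 2)).set ll ((i + 1 : ℕ) : ℝ) := by
      simp only [nearestBody, den, eval_ld, eval_add, eval_var, hxτ, h3, a1, e1, e2]
      simp only [State.set_reg, if_true, reduceCtorEq, if_false, eval_nat]
      split_ifs <;> simp [h3]
    rw [hden]
    split_ifs with hc
    · refine ⟨h1.trans (R' := [pid, yy, Var.best, ll, xx]) (M' := ∅) ⟨fun y hy => ?_, fun _ _ => rfl⟩
        (List.Subset.refl _) (List.Subset.refl _) subset_rfl subset_rfl, ?_, ?_, ?_, ?_⟩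
      · simp only [List.mem_cons, List.not_mem_nil, or_false, not_or] at hy
        simp [hy]
      · simpa using h2
      · simp
      · intro l hl hl'
        simp only [State.set_reg, reduceCtorEq, if_false, if_true]
        by_cases hli : l = i
        · subst hli
          exact le_rfl
        · exact hc.le.trans (h4 l hl (by omega))
      · exact ⟨X[i], List.getElem_mem _, by simp⟩
    · refine ⟨h1.trans (R' := [pid, yy, Var.best, ll, xx]) (M' := ∅) ⟨fun y hy => ?_, fun _ _ => rfl⟩
        (List.Subset.refl _) (List.Subset.refl _) subset_rfl subset_rfl, ?_, ?_, ?_, ?_⟩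
      · simp only [List.mem_cons, List.not_mem_nil, or_false, not_or] at hy
        simp [hy]
      · simpa using h2
      · simp
      · intro l hl hl'
        simp only [State.set_reg, reduceCtorEq, if_false]
        by_cases hli : l = i
        · subst hli
          exact not_lt.1 hc
        · exact h4 l hl (by omega)
      · simpa using h5
  · have a1 : ⌊(n : ℝ) * (q : ℝ) + (j : ℝ)⌋₊ = n * q + j := floor_of_eq (by push_cast; ring)
    have e1 : σ.mem α = (X[0] : ℕ) := by simpa using hX 0 hX1
    have e2 : (sqDistE d d).eval ((σ.set pid ((a : ℕ) : ℝ)).set yy ((X[0] : ℕ) : ℝ)) =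
        dist (p a) (p X[0]) ^ 2 := by
      refine eval_sqDistE (w := w)
        (σ := (σ.set pid ((a : ℕ) : ℝ)).set yy ((X[0] : ℕ) : ℝ)) (hD.of_fr (R := [pid, yy]) (M := ∅)
        ⟨fun y hy => ?_, fun _ _ => rfl⟩
        (by decide) (by decide) (by simp)) (by simp) (by simp)
      simp only [List.mem_cons, List.not_mem_nil, or_false, not_or] at hy
      simp [hy]
    have hden : (nearestInit d q).den σ = (((σ.set pid ((a : ℕ) : ℝ)).set yy
        ((X[0] : ℕ) : ℝ)).set Var.best (dist (p a) (p X[0]) ^ 2)).set ll 0 := by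
      simp only [nearestInit, den, eval_ld, eval_add, eval_mul, eval_nat, eval_var, hD.nn, hj, a1,
        ha, State.set_reg, reduceCtorEq, if_false, hxs, Nat.floor_natCast, State.set_mem, e1, e2,
        Nat.cast_zero]
    rw [hden]
    refine ⟨⟨fun y hy => ?_, fun _ _ => rfl⟩, by simp, by simp, by simp, X[0],
      List.getElem_mem _, by simp⟩
    simp only [List.mem_cons, List.not_mem_nil, or_false, not_or] at hy
    simp [hy]
  · rintro τ ⟨h1, h2, h3, h4, x, hx, h5⟩
    refine ⟨h1, le_antisymm ?_ ?_⟩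
    · obtain ⟨y, hy, hDy⟩ := (hDist a).2
      obtain ⟨l, hl, rfl⟩ := List.getElem_of_mem hy
      rw [hDy]
      exact h4 l hl hl
    · rw [h5]
      exact (hDist a).1 x hx

def distInit (d : ℕ) : Stmt := assign xs (nn * nat (d + 2) + cnt) ;; assign jj (nat 0)

def distNext (q : ℕ) : Stmt := put (nn * nat q + jj) Var.best ;; assign jj (jj + nat 1)

/-- Replaces each query point by its squared distance to the sample. -/
def distances (d q : ℕ) : Prog :=
  .seq (distInit d).code (.loop jj.idx mm.idx (.seq (nearest d q) (distNext q).code))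

theorem distances_runs {d n : ℕ} {p : Fin n → Pt d} {w : Fin n → ℕ} {σ : State}
    {X Q : List (Fin n)} {c q : ℕ} (hD : Data p w σ) (hcnt : σ.reg cnt = c)
    (hX : Holds (n * (d + 2) + c) X σ) (hs : σ.reg ss = X.length) (hX0 : X ≠ [])
    (hQ : Holds (n * q) Q σ) (hm : σ.reg mm = Q.length) (hq : n * (d + 2) + c + X.length ≤ n * q)
    {D : Fin n → ℝ} (hDist : IsSqDist p X D) :
    Runs (distances d q) σ
      (((1 + (((nearestBody d).time + (nearestInit d q).time + 2) * (X.length + 1)) +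
        (distNext q).time) + (distInit d).time + 2) * (Q.length + 1))
      fun τ => Fr [pid, yy, Var.best, ll, xx, jj, xs] (Set.Ico (n * q) (n * q + Q.length)) σ τ ∧
        τ.reg xs = (n * (d + 2) + c : ℕ) ∧
        ∀ (j : ℕ) (hj : j < Q.length), τ.mem (n * q + j) = D Q[j] := by
  set I : ℕ → State → Prop := fun i τ =>
    Fr [pid, yy, Var.best, ll, xx, jj, xs] (Set.Ico (n * q) (n * q + Q.length)) σ τ ∧
    τ.reg xs = (n * (d + 2) + c : ℕ) ∧ τ.reg jj = i ∧
    (∀ (j : ℕ) (hj : j < Q.length), j < i → τ.mem (n * q + j) = D Q[j]) ∧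
    (∀ (j : ℕ) (hj : j < Q.length), i ≤ j → τ.mem (n * q + j) = (Q[j] : ℕ)) with hI
  refine (Runs.for_init (N := Q.length) I ?_ ?_ ?_).mono le_rfl ?_
  · rintro i τ ⟨h1, h2, h3, h4⟩
    exact ⟨h3, (h1.reg _ (by decide)).trans hm⟩
  · rintro i τ hi ⟨h1, h2, h3, h4, h5⟩
    have hDτ : Data p w τ := hD.of_fr h1 (by decide) (by decide) fun a ha => by
      have := ha.1
      rw [mul_add] at hq ⊢
      omega
    have hXτ : Holds (n * (d + 2) + c) X τ := hX.of_fr h1 fun a ha _ => by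
      have := ha.1
      omega
    refine Runs.seq (nearest_runs hDτ h2 hXτ ((h1.reg _ (by decide)).trans hs) hX0 h3
      (h5 i hi le_rfl) hDist) ?_
    rintro ρ ⟨g1, g2⟩
    refine Stmt.runs _ ?_
    have hf := h1.trans g1 (R'' := [pid, yy, Var.best, ll, xx, jj, xs])
      (M'' := Set.Ico (n * q) (n * q + Q.length)) (List.Subset.refl _)
      (by decide) subset_rfl (Set.empty_subset _)
    have a1 : ⌊(n : ℝ) * (q : ℝ) + (i : ℝ)⌋₊ = n * q + i := floor_of_eq (by push_cast; ring)
    have e1 := (g1.reg jj (by decide)).trans h3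
    have e2 := (hf.reg nn (by decide)).trans hD.nn
    have hden : (distNext q).den ρ = (ρ.put (n * q + i) (D Q[i])).set jj ((i + 1 : ℕ) : ℝ) := by
      simp [distNext, den, e1, e2, a1, g2]
    rw [hden]
    refine ⟨hf.trans (R' := [jj]) (M' := {n * q + i}) ⟨fun y hy => ?_, fun a ha => ?_⟩
      (List.Subset.refl _) (by decide) subset_rfl (by simpa using hi), ?_, by simp, ?_, ?_⟩
    · simp only [List.mem_singleton] at hy
      simp [hy]
    · simp only [Set.mem_singleton_iff] at ha
      simp [ha]
    · simpa using (g1.reg xs (by decide)).trans h2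
    · intro j hj hji
      simp only [State.set_mem, State.put_mem]
      by_cases hij : j = i
      · subst hij
        simp
      · rw [if_neg (by omega), g1.mem _ (by simp)]
        exact h4 j hj (by omega)
    · intro j hj hji
      simp only [State.set_mem, State.put_mem]
      rw [if_neg (by omega), g1.mem _ (by simp)]
      exact h5 j hj (by omega)
  · refine ⟨⟨fun y hy => ?_, fun _ _ => rfl⟩, ?_, by simp [distInit, den], by simp, ?_⟩
    · simp only [List.mem_cons, List.not_mem_nil, or_false, not_or] at hy
      simp [distInit, den, hy]
    · simp [distInit, den, hD.nn, hcnt]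
    · intro j hj _
      exact hQ j hj
  · rintro τ ⟨h1, h2, h3, h4, -⟩
    exact ⟨h1, h2, fun j hj => h4 j hj hj⟩

/-! ## The median distance -/

def countBody (q : ℕ) : Stmt :=
  Stmt.ite (ld (nn * nat q + ll)) yy (assign len (len + nat 1)) skip ;; assign ll (ll + nat 1)

def countInit (q : ℕ) : Stmt :=
  assign len (nat 0) ;; assign yy (ld (nn * nat q + jj)) ;; assign ll (nat 0)

/-- Counts the values that are smaller than the `jj`-th value. -/
def countSmaller (q : ℕ) : Prog :=
  .seq (countInit q).code (.loop ll.idx mm.idx (countBody q).code)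

open Classical in
theorem countSmaller_runs {n m q j : ℕ} {σ : State} {v : ℕ → ℝ} (hn : σ.reg nn = n)
    (hm : σ.reg mm = m) (hv : ∀ i < m, σ.mem (n * q + i) = v i) (hj : j < m) (hjj : σ.reg jj = j) :
    Runs (countSmaller q) σ (((countBody q).time + (countInit q).time + 2) * (m + 1))
      fun τ => Fr [len, yy, ll] ∅ σ τ ∧ τ.reg yy = v j ∧
        τ.reg len = (((Finset.range m).filter fun l => v l < v j).card : ℕ) := by
  refine (Runs.for_init (N := m) (fun i τ => Fr [len, yy, ll] ∅ σ τ ∧ τ.reg yy = v j ∧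
    τ.reg ll = i ∧ τ.reg len = (((Finset.range i).filter fun l => v l < v j).card : ℕ))
    ?_ ?_ ?_).mono le_rfl ?_
  · rintro i τ ⟨h1, h2, h3, h4⟩
    exact ⟨h3, (h1.reg _ (by decide)).trans hm⟩
  · rintro i τ hi ⟨h1, h2, h3, h4⟩
    refine Stmt.runs _ ?_
    have a1 : ⌊(n : ℝ) * (q : ℝ) + (i : ℝ)⌋₊ = n * q + i := floor_of_eq (by push_cast; ring)
    have e1 : τ.mem (n * q + i) = v i := by rw [h1.mem _ (by simp)]; exact hv i hi
    have e2 := (h1.reg nn (by decide)).trans hn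
    have hcard : (((Finset.range (i + 1)).filter fun l => v l < v j).card) =
        ((Finset.range i).filter fun l => v l < v j).card + if v i < v j then 1 else 0 := by
      rw [Finset.range_add_one, Finset.filter_insert]
      split_ifs
      · rw [Finset.card_insert_of_notMem (by simp)]
      · rfl
    have hden : (countBody q).den τ = (τ.set len (((Finset.range (i + 1)).filter
        fun l => v l < v j).card : ℕ)).set ll ((i + 1 : ℕ) : ℝ) := by
      simp only [countBody, den, eval_ld, eval_add, eval_mul, eval_nat, eval_var, e2, h3, a1, e1, h2,
        hcard]
      split_ifs
      · simp [h3, h4]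
      · simp only [h3, add_zero, ← h4]
        rw [State.mk.injEq]
        refine ⟨funext fun y => ?_, rfl⟩
        by_cases hy : y = ll
        · simp [hy]
        · by_cases hy' : y = len <;> simp [hy, hy']
    rw [hden]
    refine ⟨h1.trans (R' := [len, ll]) (M' := ∅) ⟨fun y hy => ?_, fun _ _ => rfl⟩
      (List.Subset.refl _) (by decide) subset_rfl subset_rfl, by simpa using h2, by simp, by simp⟩
    simp only [List.mem_cons, List.not_mem_nil, or_false, not_or] at hy
    simp [hy]
  · have a1 : ⌊(n : ℝ) * (q : ℝ) + (j : ℝ)⌋₊ = n * q + j := floor_of_eq (by push_cast; ring)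
    refine ⟨⟨fun y hy => ?_, fun _ _ => rfl⟩, ?_, by simp [countInit, den], by simp [countInit, den]⟩
    · simp only [List.mem_cons, List.not_mem_nil, or_false, not_or] at hy
      simp [countInit, den, hy]
    · simp [countInit, den, hn, hjj, a1, hv j hj]
  · rintro τ ⟨h1, h2, h3, h4⟩
    exact ⟨h1, h2, h4⟩

def medianNext : Stmt :=
  Stmt.ite (len + len) mm (Stmt.ite rad yy (assign rad yy) skip) skip ;; assign jj (jj + nat 1)

def medianInit : Stmt := assign rad (nat 0) ;; assign jj (nat 0)

/-- Computes a median of the values. -/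
def median (q : ℕ) : Prog :=
  .seq medianInit.code (.loop jj.idx mm.idx (.seq (countSmaller q) medianNext.code))

open Classical in
-- The result is the largest value with fewer than half of the values strictly below it, so at least
-- half are at or above it. The smallest value exceeding the result would have at least half
-- strictly below it, and all of these are at most the result. The start value `0` is harmless since
-- the values are nonnegative. Quadratic time is affordable because the test sample is no larger
-- than the sample.
theorem median_runs {n m q : ℕ} {σ : State} {v : ℕ → ℝ} (hn : σ.reg nn = n)
    (hm : σ.reg mm = m) (hv : ∀ i < m, σ.mem (n * q + i) = v i) (hv0 : ∀ i < m, 0 ≤ v i) :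
    Runs (median q) σ (((1 + ((countBody q).time + (countInit q).time + 2) * (m + 1) +
        medianNext.time) + medianInit.time + 2) * (m + 1))
      fun τ => Fr [rad, jj, len, yy, ll] ∅ σ τ ∧ 0 ≤ τ.reg rad ∧
        m ≤ 2 * ((Finset.range m).filter fun j => v j ≤ τ.reg rad).card ∧
        m ≤ 2 * ((Finset.range m).filter fun j => τ.reg rad ≤ v j).card := by
  set cn : ℕ → ℕ := fun j => ((Finset.range m).filter fun l => v l < v j).card with hcn
  refine (Runs.for_init (N := m) (fun i τ => Fr [rad, jj, len, yy, ll] ∅ σ τ ∧ τ.reg jj = i ∧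
    0 ≤ τ.reg rad ∧ (∀ j < i, 2 * cn j < m → v j ≤ τ.reg rad) ∧
    (τ.reg rad = 0 ∨ ∃ j < m, 2 * cn j < m ∧ τ.reg rad = v j)) ?_ ?_ ?_).mono le_rfl ?_
  · rintro i τ ⟨h1, h2, h3, h4⟩
    exact ⟨h2, (h1.reg _ (by decide)).trans hm⟩
  · rintro i τ hi ⟨h1, h2, h3, h4, h5⟩
    refine Runs.seq (countSmaller_runs ((h1.reg _ (by decide)).trans hn)
      ((h1.reg _ (by decide)).trans hm) (fun l hl => (h1.mem _ (by simp)).trans (hv l hl)) hi h2) ?_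
    rintro ρ ⟨g1, g2, g3⟩
    refine Stmt.runs _ ?_
    have hf := h1.trans g1 (R'' := [rad, jj, len, yy, ll]) (M'' := ∅) (List.Subset.refl _)
      (by decide) subset_rfl subset_rfl
    have e1 := (g1.reg jj (by decide)).trans h2
    have e2 := (hf.reg mm (by decide)).trans hm
    have e3 := g1.reg rad (by decide)
    have hden : medianNext.den ρ = (if 2 * cn i < m ∧ ρ.reg rad < v i then ρ.set rad (v i)
        else ρ).set jj ((i + 1 : ℕ) : ℝ) := by
      have h6 : (((cn i : ℕ) : ℝ) + ((cn i : ℕ) : ℝ) < m) ↔ 2 * cn i < m := by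
        rw [← Nat.cast_add, Nat.cast_lt]
        omega
      have g3' : ρ.reg len = (cn i : ℕ) := g3
      simp only [medianNext, den, eval_add, eval_var, g3', e2, g2, eval_nat]
      rw [ite_and]
      simp only [h6]
      split_ifs <;> simp [e1]
    rw [hden]
    split_ifs with hc
    · refine ⟨hf.trans (R' := [rad, jj]) (M' := ∅) ⟨fun y hy => ?_, fun _ _ => rfl⟩
        (List.Subset.refl _) (by decide) subset_rfl subset_rfl, by simp, by simpa using hv0 i hi,
        ?_, ?_⟩
      · simp only [List.mem_cons, List.not_mem_nil, or_false, not_or] at hy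
        simp [hy]
      · intro j hj hj'
        simp only [State.set_reg, reduceCtorEq, if_false, if_true]
        by_cases hij : j = i
        · rw [hij]
        · exact (h4 j (by omega) hj').trans (e3 ▸ hc.2.le)
      · exact Or.inr ⟨i, hi, hc.1, by simp⟩
    · refine ⟨hf.trans (R' := [jj]) (M' := ∅) ⟨fun y hy => ?_, fun _ _ => rfl⟩
        (List.Subset.refl _) (by decide) subset_rfl subset_rfl, by simp, by simpa [e3] using h3,
        ?_, by simpa [e3] using h5⟩
      · simp only [List.mem_singleton] at hy
        simp [hy]
      · intro j hj hj'
        simp only [State.set_reg, reduceCtorEq, if_false]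
        by_cases hij : j = i
        · subst hij
          by_contra hlt
          exact hc ⟨hj', not_le.1 hlt⟩
        · rw [e3]
          exact h4 j (by omega) hj'
  · refine ⟨⟨fun y hy => ?_, fun _ _ => rfl⟩, by simp [medianInit, den], by simp [medianInit, den],
      by simp, Or.inl (by simp [medianInit, den])⟩
    simp only [List.mem_cons, List.not_mem_nil, or_false, not_or] at hy
    simp [medianInit, den, hy]
  · rintro τ ⟨h1, h2, h3, h4, h5⟩
    refine ⟨h1, h3, ?_, ?_⟩
    · by_contra hlt
      set J := (Finset.range m).filter fun j => ¬ v j ≤ τ.reg rad with hJ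
      have hcard := Finset.card_filter_add_card_filter_not (s := Finset.range m)
        (fun j => v j ≤ τ.reg rad)
      rw [Finset.card_range] at hcard
      have hne : J.Nonempty := by
        refine Finset.card_pos.1 ?_
        rw [hJ]
        omega
      obtain ⟨j, hj, hmin⟩ := Finset.exists_min_image J v hne
      obtain ⟨hjm, hjr⟩ := Finset.mem_filter.1 hj
      refine hjr (h4 j (Finset.mem_range.1 hjm) ?_)
      have : cn j ≤ ((Finset.range m).filter fun j => v j ≤ τ.reg rad).card := by
        refine Finset.card_le_card fun l hl => ?_
        obtain ⟨hl1, hl2⟩ := Finset.mem_filter.1 hl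
        refine Finset.mem_filter.2 ⟨hl1, ?_⟩
        by_contra hc
        exact absurd (hmin l (Finset.mem_filter.2 ⟨hl1, hc⟩)) (not_le.2 hl2)
      omega
    · rcases h5 with h5 | ⟨j, hj, hj', h5⟩
      · rw [h5, Finset.filter_true_of_mem fun j hj => hv0 j (Finset.mem_range.1 hj),
          Finset.card_range]
        omega
      · rw [h5]
        have hcard := Finset.card_filter_add_card_filter_not (s := Finset.range m)
          (fun l => v l < v j)
        rw [Finset.card_range] at hcard
        simp only [not_lt] at hcard
        simp only [hcn] at hj'
        omega

/-! ## Grid cells -/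

/-- An injective code of a number and finitely many integers. -/
def cellCode (s : ℕ) (z : ℕ → ℤ) : ℕ → ℕ
  | 0 => s
  | j + 1 => (cellCode s z j + (4 * z j + 1).natAbs ^ 2) ^ 2 + cellCode s z j

theorem le_cellCode (s : ℕ) (z : ℕ → ℤ) (j : ℕ) : s ≤ cellCode s z j := by
  induction j with
  | zero => exact le_rfl
  | succ j ih => exact ih.trans (Nat.le_add_left _ _)

/-- The value lies in the interval from `(a + b) ^ 2` up to, but excluding, `(a + b + 1) ^ 2`; thus
it determines `a + b`, and then `a`. -/
theorem sq_add_injective {a b a' b' : ℕ} (h : (a + b) ^ 2 + a = (a' + b') ^ 2 + a') :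
    a = a' ∧ b = b' := by
  have key : ∀ {a b a' b' : ℕ}, (a + b) ^ 2 + a = (a' + b') ^ 2 + a' → ¬ a + b < a' + b' := by
    intro a b a' b' h hlt
    have := Nat.pow_le_pow_left (Nat.succ_le_of_lt hlt) 2
    rw [Nat.succ_eq_add_one] at this
    nlinarith
  have h1 := key h
  have h2 := key h.symm
  have h3 : a + b = a' + b' := by omega
  rw [h3] at h
  omega

/-- An integer `4 * z + 1` is determined by its absolute value, as its negative is not of this form.
Squaring does the job of the absolute value, which the machine does not offer as an operation. -/
theorem cellCode_injective {s s' : ℕ} {z z' : ℕ → ℤ} {j : ℕ}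
    (h : cellCode s z j = cellCode s' z' j) : s = s' ∧ ∀ i < j, z i = z' i := by
  induction j with
  | zero => exact ⟨h, by simp⟩
  | succ j ih =>
    obtain ⟨h1, h2⟩ := sq_add_injective h
    obtain ⟨h3, h4⟩ := ih h1
    refine ⟨h3, fun i hi => ?_⟩
    rcases Nat.lt_succ_iff_lt_or_eq.1 hi with hi | rfl
    · exact h4 i hi
    · have := Nat.pow_left_injective two_ne_zero h2
      rw [Int.natAbs_eq_natAbs_iff] at this
      omega

/-- The coordinates of the grid cell of a point. -/
def gridCell {d n : ℕ} (p : Fin n → Pt d) (r : ℝ) (a : Fin n) (j : ℕ) : ℤ :=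
  if h : j < d then ⌊p a ⟨j, h⟩ / r⌋ else 0

/-- The address of the cell of a point, moved by `o`. -/
def cellAddr {d n : ℕ} (p : Fin n → Pt d) (r : ℝ) (f q : ℕ) (a : Fin n) (o : ℕ → ℤ) : ℕ :=
  cellCode (n * q + f * a) (fun j => gridCell p r a j + o j) d

/-- The code of the lower coordinates occurs three times at each level, so the size is exponential
in `d`, which is constant for the program. -/
def cellE (d q : ℕ) (o : ℕ → ℤ) : ℕ → Expr
  | 0 => nn * nat q + flag * pid
  | j + 1 =>
    (cellE d q o j + (nat 4 * (un .floor (ld (pid * nat d + nat j) / rad) + int (o j)) + nat 1) *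
        (nat 4 * (un .floor (ld (pid * nat d + nat j) / rad) + int (o j)) + nat 1)) *
      (cellE d q o j + (nat 4 * (un .floor (ld (pid * nat d + nat j) / rad) + int (o j)) + nat 1) *
        (nat 4 * (un .floor (ld (pid * nat d + nat j) / rad) + int (o j)) + nat 1)) +
      cellE d q o j

theorem eval_cellE {d n : ℕ} {p : Fin n → Pt d} {w : Fin n → ℕ} {σ : State} (hD : Data p w σ)
    {a : Fin n} {f : ℕ} (ha : σ.reg pid = (a : ℕ)) (hf : σ.reg flag = f) (q : ℕ) (o : ℕ → ℤ) :
    (cellE d q o d).eval σ = cellAddr p (σ.reg rad) f q a o := by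
  have key : ∀ j ≤ d, (cellE d q o j).eval σ =
      cellCode (n * q + f * a) (fun j => gridCell p (σ.reg rad) a j + o j) j := by
    intro j
    induction j with
    | zero => simp [cellE, cellCode, hD.nn, ha, hf]
    | succ j ih =>
      intro hj
      have a1 : ⌊((a : ℕ) : ℝ) * (d : ℝ) + (j : ℝ)⌋₊ = a * d + j := floor_of_eq (by push_cast; ring)
      have a2 : σ.mem (a * d + j) = p a ⟨j, hj⟩ := hD.pt a ⟨j, hj⟩
      have a3 : gridCell p (σ.reg rad) a j = ⌊p a ⟨j, hj⟩ / σ.reg rad⌋ := dif_pos hj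
      have a4 : ∀ z : ℤ, (((z.natAbs : ℕ) : ℝ)) ^ 2 = (z : ℝ) ^ 2 := fun z => by
        rw [Nat.cast_natAbs, Int.cast_abs, sq_abs]
      simp only [cellE, eval_add, eval_mul, ih (by omega), eval_floor, eval_div, eval_ld, eval_var,
        eval_nat, eval_int, ha, a1, a2, cellCode, a3]
      push_cast
      rw [← Int.cast_natCast (R := ℝ), a4]
      push_cast
      ring
  exact key d le_rfl

/-- The moves to the neighbouring cells. -/
def offsets (d : ℕ) : List (ℕ → ℤ) :=
  (Fintype.piFinset fun _ : Fin d => ({-1, 0, 1} : Finset ℤ)).toList.map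
    fun o j => if h : j < d then o ⟨j, h⟩ else 0

/-- The cells of `a` and `b` are neighbours. -/
def Neighbours {d n : ℕ} (p : Fin n → Pt d) (r : ℝ) (f : ℕ) (a b : Fin n) : Prop :=
  f * (a : ℕ) = f * b ∧ ∀ j < d, |gridCell p r a j - gridCell p r b j| ≤ 1

/-- Injectivity of the code makes a coincidence of addresses a coincidence of cells. Marking `3 ^ d`
cells around every sample point therefore decides with one memory access per point whether it has a
sample point in a neighbouring cell. -/
theorem exists_offset_iff {d n : ℕ} (p : Fin n → Pt d) (r : ℝ) (f q : ℕ) (a b : Fin n) :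
    (∃ o ∈ offsets d, cellAddr p r f q a 0 = cellAddr p r f q b o) ↔ Neighbours p r f a b := by
  constructor
  · rintro ⟨o, ho, h⟩
    obtain ⟨h1, h2⟩ := cellCode_injective h
    refine ⟨by omega, fun j hj => ?_⟩
    have h3 := h2 j hj
    simp only [offsets, List.mem_map, Finset.mem_toList, Fintype.mem_piFinset] at ho
    obtain ⟨o', ho', rfl⟩ := ho
    have h4 := ho' ⟨j, hj⟩
    simp only [hj, dif_pos, Pi.zero_apply, add_zero, Finset.mem_insert, Finset.mem_singleton]
      at h3 h4
    rw [h3, add_sub_cancel_left]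
    rcases h4 with h4 | h4 | h4 <;> simp [h4]
  · rintro ⟨h1, h2⟩
    refine ⟨fun j => if h : j < d then gridCell p r a j - gridCell p r b j else 0, ?_, ?_⟩
    · refine List.mem_map.2 ⟨fun j => gridCell p r a j - gridCell p r b j, ?_, by simp⟩
      rw [Finset.mem_toList, Fintype.mem_piFinset]
      intro j
      have := abs_le.1 (h2 j j.2)
      simp only [Finset.mem_insert, Finset.mem_singleton]
      omega
    · have key : ∀ j ≤ d, cellCode (n * q + f * a) (fun j => gridCell p r a j + (0 : ℕ → ℤ) j) j =
          cellCode (n * q + f * b) (fun j => gridCell p r b j +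
            if h : j < d then gridCell p r a j - gridCell p r b j else 0) j := by
        intro j
        induction j with
        | zero => intro; simp only [cellCode]; omega
        | succ j ih =>
          intro hj
          have hj' : j < d := hj
          have e : gridCell p r a j + (0 : ℕ → ℤ) j = gridCell p r b j +
              if h : j < d then gridCell p r a j - gridCell p r b j else 0 := by simp [hj']
          rw [cellCode, cellCode, ih (by omega), e]
      exact key d le_rfl

/-! ## Marking cells -/

def markAll (d q : ℕ) : List (ℕ → ℤ) → Stmt
  | [] => skip
  | o :: os => put (cellE d q o d) rho ;; markAll d q os

theorem markAll_den {d n : ℕ} {p : Fin n → Pt d} {w : Fin n → ℕ} {q : ℕ} (hq : d + 1 ≤ q)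
    {a : Fin n} {f : ℕ} (os : List (ℕ → ℤ)) {σ : State} (hD : Data p w σ)
    (ha : σ.reg pid = (a : ℕ)) (hf : σ.reg flag = f) :
    Fr [] (Set.Ici (n * q)) σ ((markAll d q os).den σ) ∧
    (∀ o ∈ os, ((markAll d q os).den σ).mem (cellAddr p (σ.reg rad) f q a o) = σ.reg rho) ∧
    ∀ b, (∀ o ∈ os, b ≠ cellAddr p (σ.reg rad) f q a o) →
      ((markAll d q os).den σ).mem b = σ.mem b := by
  induction os generalizing σ with
  | nil => exact ⟨Fr.refl _ _ _, by simp, fun _ _ => rfl⟩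
  | cons o os ih =>
    set τ := σ.put (cellAddr p (σ.reg rad) f q a o) (σ.reg rho) with hτ
    have hden : (markAll d q (o :: os)).den σ = (markAll d q os).den τ := by
      simp only [markAll, den, eval_cellE hD ha hf, Nat.floor_natCast, eval_var, hτ]
    have hge : n * q ≤ cellAddr p (σ.reg rad) f q a o :=
      (Nat.le_add_right _ _).trans (le_cellCode _ _ _)
    have hfr : Fr [] (Set.Ici (n * q)) σ τ := by
      refine ⟨fun y _ => rfl, fun b hb => ?_⟩
      rw [hτ, State.put_mem, if_neg]
      rintro rfl
      exact hb hge
    obtain ⟨h1, h2, h3⟩ := ih (σ := τ) (hD.of_fr hfr (by simp) (by simp) fun b hb =>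
      (Nat.mul_le_mul_left n hq).trans hb) ha hf
    rw [hden]
    refine ⟨hfr.trans h1 (List.Subset.refl _) (List.Subset.refl _) subset_rfl subset_rfl, ?_, ?_⟩
    · intro o' ho'
      by_cases hmem : o' ∈ os
      · exact h2 o' hmem
      · obtain rfl : o' = o := by simpa [hmem] using ho'
        -- A later write to the same address stores the same stamp.
        by_cases hex : ∃ o'' ∈ os, cellAddr p (σ.reg rad) f q a o' = cellAddr p (σ.reg rad) f q a o''
        · obtain ⟨o'', ho'', heq⟩ := hex
          rw [heq]
          exact h2 o'' ho''
        · push Not at hex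
          rw [h3 _ hex]
          simp [hτ]
    · intro b hb
      rw [h3 b fun o' ho' => hb o' (List.mem_cons_of_mem _ ho'), hτ, State.put_mem, if_neg]
      exact hb o List.mem_cons_self

def markBody (d q : ℕ) : Stmt :=
  assign pid (ld (xs + ll)) ;; markAll d q (offsets d) ;; assign ll (ll + nat 1)

/-- Marks the cells around the sample. -/
def mark (d q : ℕ) : Prog :=
  .seq (assign ll (nat 0)).code (.loop ll.idx ss.idx (markBody d q).code)

theorem mark_runs {d n : ℕ} {p : Fin n → Pt d} {w : Fin n → ℕ} {σ : State} {X : List (Fin n)}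
    {α q f : ℕ} (hD : Data p w σ) (hxs : σ.reg xs = α) (hX : Holds α X σ)
    (hs : σ.reg ss = X.length) (hf : σ.reg flag = f) (hq : d + 1 ≤ q) (hα : α + X.length ≤ n * q) :
    Runs (mark d q) σ (((markBody d q).time + (assign ll (nat 0)).time + 2) * (X.length + 1))
      fun τ => Fr [ll, pid] (Set.Ici (n * q)) σ τ ∧
        (∀ x ∈ X, ∀ o ∈ offsets d, τ.mem (cellAddr p (σ.reg rad) f q x o) = σ.reg rho) ∧
        ∀ b, (∀ x ∈ X, ∀ o ∈ offsets d, b ≠ cellAddr p (σ.reg rad) f q x o) →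
          τ.mem b = σ.mem b := by
  set I : ℕ → State → Prop := fun i τ => Fr [ll, pid] (Set.Ici (n * q)) σ τ ∧ τ.reg ll = i ∧
    (∀ (l : ℕ) (hl : l < X.length), l < i → ∀ o ∈ offsets d,
      τ.mem (cellAddr p (σ.reg rad) f q X[l] o) = σ.reg rho) ∧
    ∀ b, (∀ (l : ℕ) (hl : l < X.length), l < i → ∀ o ∈ offsets d,
      b ≠ cellAddr p (σ.reg rad) f q X[l] o) → τ.mem b = σ.mem b with hI
  refine (Runs.for_init (N := X.length) I ?_ ?_ ?_).mono le_rfl ?_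
  · rintro i τ ⟨h1, h2, h3⟩
    exact ⟨h2, (h1.reg _ (by decide)).trans hs⟩
  · rintro i τ hi ⟨h1, h2, h3, h4⟩
    refine Stmt.runs _ ?_
    have a1 : ⌊(α : ℝ) + (i : ℝ)⌋₊ = α + i := floor_of_eq (by push_cast; ring)
    have hxτ := (h1.reg xs (by decide)).trans hxs
    have e1 : τ.mem (α + i) = (X[i] : ℕ) := by
      rw [h1.mem _ (by simp; omega)]
      exact hX i hi
    set τ₁ := τ.set pid ((X[i] : ℕ) : ℝ) with hτ₁
    have hfr : Fr [ll, pid] (Set.Ici (n * q)) σ τ₁ := by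
      refine h1.trans (R' := [pid]) (M' := ∅) ⟨fun y hy => ?_, fun _ _ => rfl⟩
        (List.Subset.refl _) (by decide) subset_rfl (Set.empty_subset _)
      simp only [List.mem_singleton] at hy
      simp [hτ₁, hy]
    have hD₁ : Data p w τ₁ := hD.of_fr hfr (by decide) (by decide) fun b hb =>
      (Nat.mul_le_mul_left n hq).trans hb
    obtain ⟨g1, g2, g3⟩ := markAll_den (a := X[i]) hq (offsets d) hD₁ (by simp [hτ₁])
      ((hfr.reg flag (by decide)).trans hf)
    rw [hfr.reg rad (by decide), hfr.reg rho (by decide)] at g2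
    rw [hfr.reg rad (by decide)] at g3
    have hden : (markBody d q).den τ = ((markAll d q (offsets d)).den τ₁).set ll ((i + 1 : ℕ) : ℝ) := by
      have : ((markAll d q (offsets d)).den τ₁).reg ll = i := by
        rw [g1.reg _ (by simp)]
        simpa [hτ₁] using h2
      simp only [markBody, den, eval_ld, eval_add, eval_var, eval_nat, hxτ, h2, a1, e1, ← hτ₁, this]
      push_cast
      rfl
    rw [hden]
    have hfr2 := hfr.trans g1 (R'' := [ll, pid]) (M'' := Set.Ici (n * q)) (List.Subset.refl _)
      (by simp) subset_rfl subset_rfl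
    refine ⟨hfr2.trans (R' := [ll]) (M' := ∅) ⟨fun y hy => ?_, fun _ _ => rfl⟩
        (List.Subset.refl _) (by decide) subset_rfl (Set.empty_subset _), by simp, ?_, ?_⟩
    · simp only [List.mem_singleton] at hy
      simp [hy]
    · intro l hl hli o ho
      rw [State.set_mem]
      by_cases hex : ∃ o' ∈ offsets d, cellAddr p (σ.reg rad) f q X[l] o =
          cellAddr p (σ.reg rad) f q X[i] o'
      · obtain ⟨o', ho', heq⟩ := hex
        rw [heq]
        exact g2 o' ho'
      · push Not at hex
        rw [g3 _ hex]
        by_cases hl' : l = i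
        · subst hl'
          exact absurd rfl (hex o ho)
        · exact h3 l hl (by omega) o ho
    · intro b hb
      rw [State.set_mem, g3 b fun o ho => hb i hi (Nat.lt_succ_self i) o ho]
      exact h4 b fun l hl hli => hb l hl (by omega)
  · refine ⟨⟨fun y hy => ?_, fun _ _ => rfl⟩, by simp [den], by simp, fun _ _ => rfl⟩
    simp only [List.mem_cons, List.not_mem_nil, or_false, not_or] at hy
    simp [den, hy]
  · rintro τ ⟨h1, h2, h3, h4⟩
    refine ⟨h1, fun x hx o ho => ?_, fun b hb => h4 b fun l hl _ => hb _ (List.getElem_mem hl)⟩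
    obtain ⟨l, hl, rfl⟩ := List.getElem_of_mem hx
    exact h3 l hl hl o ho

/-! ## Keeping the points in unmarked cells -/

def keepBody (d q : ℕ) : Stmt :=
  assign pid (ld (nn * nat (d + 1) + tt)) ;;
  Stmt.ite (ld (cellE d q 0 d)) rho
    (put (nn * nat (d + 1) + new) pid ;; assign new (new + nat 1) ;;
      assign newtot (newtot + ld (nn * nat d + pid))) skip ;;
  assign tt (tt + nat 1)

def keepInit : Stmt := assign tt (nat 0) ;; assign new (nat 0) ;; assign newtot (nat 0)

def keep (d q : ℕ) : Prog := .seq keepInit.code (.loop tt.idx na.idx (keepBody d q).code)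

open Classical in
theorem keep_runs {d n : ℕ} {p : Fin n → Pt d} {w : Fin n → ℕ} {σ : State} {l : List (Fin n)}
    {q f : ℕ} (hD : Data p w σ) (hl : Holds (n * (d + 1)) l σ) (hln : l.length ≤ n)
    (hna : σ.reg na = l.length) (hf : σ.reg flag = f) (hq : d + 2 ≤ q) :
    Runs (keep d q) σ (((keepBody d q).time + keepInit.time + 2) * (l.length + 1))
      fun τ => Fr [tt, new, newtot, pid] (Set.Ico (n * (d + 1)) (n * (d + 2))) σ τ ∧
        ∃ l' : List (Fin n),
          l' = l.filter (fun a => σ.mem (cellAddr p (σ.reg rad) f q a 0) < σ.reg rho) ∧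
          Holds (n * (d + 1)) l' τ ∧ τ.reg new = l'.length ∧
          τ.reg newtot = ((l'.map w).sum : ℕ) := by
  set P : Fin n → Bool := fun a => σ.mem (cellAddr p (σ.reg rad) f q a 0) < σ.reg rho with hP
  have hnd : n * (d + 2) = n * (d + 1) + n := by ring
  set I : ℕ → State → Prop := fun i τ =>
    Fr [tt, new, newtot, pid] (Set.Ico (n * (d + 1)) (n * (d + 2))) σ τ ∧ τ.reg tt = i ∧
    Holds (n * (d + 1)) ((l.take i).filter P) τ ∧ τ.reg new = ((l.take i).filter P).length ∧
    τ.reg newtot = ((((l.take i).filter P).map w).sum : ℕ) ∧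
    ∀ (t : ℕ) (ht : t < l.length), i ≤ t → τ.mem (n * (d + 1) + t) = (l[t] : ℕ) with hI
  refine (Runs.for_init (N := l.length) I ?_ ?_ ?_).mono le_rfl ?_
  · rintro i τ ⟨h1, h2, h3⟩
    exact ⟨h2, (h1.reg _ (by decide)).trans hna⟩
  · rintro i τ hi ⟨h1, h2, h3, h4, h5, h6⟩
    refine Stmt.runs _ ?_
    set m := ((l.take i).filter P).length with hm
    -- The list is compacted in place: the write position never passes the read position, so no
    -- unread entry is lost.
    have hmi : m ≤ i := (List.length_filter_le _ _).trans (List.length_take_le _ _)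
    have a1 : ⌊(n : ℝ) * ((d + 1 : ℕ) : ℝ) + (i : ℝ)⌋₊ = n * (d + 1) + i :=
      floor_of_eq (by push_cast; ring)
    have a2 : ⌊(n : ℝ) * ((d + 1 : ℕ) : ℝ) + (m : ℝ)⌋₊ = n * (d + 1) + m :=
      floor_of_eq (by push_cast; ring)
    have a3 : ⌊(n : ℝ) * (d : ℝ) + ((l[i] : ℕ) : ℝ)⌋₊ = n * d + l[i] :=
      floor_of_eq (by push_cast; ring)
    have e1 : τ.mem (n * (d + 1) + i) = (l[i] : ℕ) := h6 i hi le_rfl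
    have hDτ : Data p w τ := hD.of_fr h1 (by decide) (by decide) fun b hb => hb.1
    set τ₁ := τ.set pid ((l[i] : ℕ) : ℝ) with hτ₁
    have hfr : Fr [tt, new, newtot, pid] (Set.Ico (n * (d + 1)) (n * (d + 2))) σ τ₁ := by
      refine h1.trans (R' := [pid]) (M' := ∅) ⟨fun y hy => ?_, fun _ _ => rfl⟩
        (List.Subset.refl _) (by decide) subset_rfl (Set.empty_subset _)
      simp only [List.mem_singleton] at hy
      simp [hτ₁, hy]
    have hD₁ : Data p w τ₁ := hD.of_fr hfr (by decide) (by decide) fun b hb => hb.1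
    have hcell : (cellE d q 0 d).eval τ₁ = cellAddr p (σ.reg rad) f q l[i] 0 := by
      rw [eval_cellE (a := l[i]) hD₁ (by simp [hτ₁]) ((hfr.reg flag (by decide)).trans hf),
        hfr.reg rad (by decide)]
    have hge : n * (d + 2) ≤ cellAddr p (σ.reg rad) f q l[i] 0 :=
      ((Nat.mul_le_mul_left n hq).trans (Nat.le_add_right _ _)).trans (le_cellCode _ _ _)
    have hmem : τ₁.mem (cellAddr p (σ.reg rad) f q l[i] 0) =
        σ.mem (cellAddr p (σ.reg rad) f q l[i] 0) := hfr.mem _ (by simp; omega)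
    have hrho : τ₁.reg rho = σ.reg rho := hfr.reg rho (by decide)
    have r1 : τ₁.reg nn = n := hD₁.nn
    have r2 : τ₁.reg new = m := by simpa [hτ₁] using h4
    have r3 : τ₁.reg pid = (l[i] : ℕ) := by simp [hτ₁]
    have r4 : τ₁.reg newtot = ((((l.take i).filter P).map w).sum : ℕ) := by simpa [hτ₁] using h5
    have r5 : τ₁.reg tt = i := by simpa [hτ₁] using h2
    have r6 := hDτ.wt l[i]
    have hden : (keepBody d q).den τ = (if P l[i] then
        ((τ₁.put (n * (d + 1) + m) ((l[i] : ℕ) : ℝ)).set new ((m + 1 : ℕ) : ℝ)).set newtot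
          (((((l.take i).filter P).map w).sum + w l[i] : ℕ) : ℝ) else τ₁).set tt
            ((i + 1 : ℕ) : ℝ) := by
      have hne : n * d + (l[i] : ℕ) ≠ n * (d + 1) + m := by
        have := (l[i]).2
        rw [mul_add]
        omega
      have s1 : (keepBody d q).den τ = (Stmt.ite (ld (cellE d q 0 d)) rho
          (put (nn * nat (d + 1) + new) pid ;; assign new (new + nat 1) ;;
            assign newtot (newtot + ld (nn * nat d + pid))) skip ;;
          assign tt (tt + nat 1)).den τ₁ := by
        simp only [keepBody, den, eval_ld, eval_add, eval_mul, eval_nat, eval_var, hDτ.nn, h2, a1,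
          e1, ← hτ₁]
        rfl
      rw [s1]
      have s2 : (ld (cellE d q 0 d)).eval τ₁ < Expr.eval τ₁ rho ↔ P l[i] = true := by
        rw [eval_ld, hcell, Nat.floor_natCast, hmem, eval_var, hrho, hP]
        exact decide_eq_true_iff.symm
      simp only [den, s2]
      split_ifs with hc
      · simp only [eval_add, eval_mul, eval_nat, eval_var, r1, r2, a2, r3, State.set_reg,
          State.put_reg, reduceCtorEq, if_false, r4, r5, eval_ld, State.set_mem, a3,
          State.put_mem, if_neg hne]
        rw [show τ₁.mem (n * d + l[i]) = w l[i] from r6]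
        push_cast
        rfl
      · simp only [eval_add, eval_nat, eval_var, r5]
        push_cast
        rfl
    have htake : (l.take (i + 1)).filter P = (l.take i).filter P ++ if P l[i] then [l[i]] else [] := by
      rw [List.take_add_one, List.getElem?_eq_getElem hi, List.filter_append]
      simp [List.filter_cons]
    rw [hden, hI]
    simp only [htake]
    split_ifs with hc
    · refine ⟨hfr.trans (R' := [new, newtot, tt]) (M' := {n * (d + 1) + m})
        ⟨fun y hy => ?_, fun b hb => ?_⟩
        (List.Subset.refl _) (by decide) subset_rfl ?_, by simp, ?_, ?_, ?_, ?_⟩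
      · simp only [List.mem_cons, List.not_mem_nil, or_false, not_or] at hy
        simp [hy]
      · simp only [Set.mem_singleton_iff] at hb
        simp [hb]
      · simp only [Set.singleton_subset_iff, Set.mem_Ico]
        omega
      · intro t ht
        simp only [State.set_mem, State.put_mem]
        by_cases htm : t = m
        · subst htm
          rw [if_pos rfl, List.getElem_append_right (by omega)]
          simp
        · have ht' : t < ((l.take i).filter P).length := by simp at ht; omega
          rw [if_neg (by omega), List.getElem_append_left ht']
          exact h3 t ht'
      · simp [hm]
      · simp
      · intro t ht hit
        simp only [State.set_mem, State.put_mem]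
        rw [if_neg (by omega)]
        exact h6 t ht (by omega)
    · refine ⟨hfr.trans (R' := [tt]) (M' := ∅) ⟨fun y hy => ?_, fun b hb => rfl⟩
        (List.Subset.refl _) (by decide) subset_rfl (Set.empty_subset _), by simp, ?_, ?_, ?_, ?_⟩
      · simp only [List.mem_singleton] at hy
        simp [hy]
      · rw [List.append_nil]
        exact h3
      · rw [List.append_nil]
        simpa using r2
      · rw [List.append_nil]
        simpa using r4
      · intro t ht hit
        exact h6 t ht (by omega)
  · refine ⟨⟨fun y hy => ?_, fun _ _ => rfl⟩, by simp [keepInit, den], fun t ht => by simp at ht,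
      by simp [keepInit, den], by simp [keepInit, den], fun t ht _ => hl t ht⟩
    simp only [List.mem_cons, List.not_mem_nil, or_false, not_or] at hy
    simp [keepInit, den, hy]
  · rintro τ ⟨h1, h2, h3, h4, h5, h6⟩
    rw [List.take_length] at h3 h4 h5
    exact ⟨h1, _, rfl, h3, h4, h5⟩

/-! ## Neighbouring cells and distances -/

theorem neighbours_of_dist_le {d n : ℕ} {p : Fin n → Pt d} {r : ℝ} (hr : 0 < r) {a b : Fin n}
    (h : dist (p a) (p b) ≤ r) : Neighbours p r 0 a b := by
  refine ⟨by simp, fun j hj => ?_⟩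
  have h1 : |p a ⟨j, hj⟩ - p b ⟨j, hj⟩| ≤ r := by
    refine le_trans ?_ h
    rw [dist_eq_norm]
    exact PiLp.norm_apply_le (p a - p b) ⟨j, hj⟩
  simp only [gridCell, hj, dif_pos]
  obtain ⟨h2, h3⟩ := abs_le.1 h1
  have h4 : p a ⟨j, hj⟩ / r ≤ p b ⟨j, hj⟩ / r + 1 := by
    rw [div_add_one hr.ne']
    exact div_le_div_of_nonneg_right (by linarith) hr.le
  have h5 : p b ⟨j, hj⟩ / r ≤ p a ⟨j, hj⟩ / r + 1 := by
    rw [div_add_one hr.ne']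
    exact div_le_div_of_nonneg_right (by linarith) hr.le
  have h6 := Int.floor_le_floor h4
  have h7 := Int.floor_le_floor h5
  rw [Int.floor_add_one] at h6 h7
  exact abs_le.2 ⟨by linarith, by linarith⟩

/-- Points in cells whose indices differ by at most one differ by at most `2 * r` in each
coordinate, and the Euclidean distance is at most the sum of the coordinate differences. -/
theorem Neighbours.dist_le {d n : ℕ} {p : Fin n → Pt d} {r : ℝ} (hr : 0 < r) {f : ℕ} {a b : Fin n}
    (h : Neighbours p r f a b) : dist (p a) (p b) ≤ 2 * d * r := by
  have h1 : ∀ j : Fin d, |p a j - p b j| ≤ 2 * r := by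
    intro j
    have h2 := h.2 j j.2
    simp only [gridCell, j.2, dif_pos, Fin.eta] at h2
    obtain ⟨h3, h4⟩ := abs_le.1 h2
    have h3' : (-1 : ℝ) ≤ (⌊p a j / r⌋ : ℝ) - ⌊p b j / r⌋ := by exact_mod_cast h3
    have h4' : (⌊p a j / r⌋ : ℝ) - ⌊p b j / r⌋ ≤ 1 := by exact_mod_cast h4
    have h5 := Int.floor_le (p a j / r)
    have h6 := Int.lt_floor_add_one (p a j / r)
    have h7 := Int.floor_le (p b j / r)
    have h8 := Int.lt_floor_add_one (p b j / r)
    have h9 : |p a j / r - p b j / r| ≤ 2 := abs_le.2 ⟨by linarith, by linarith⟩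
    rwa [← sub_div, abs_div, abs_of_pos hr, div_le_iff₀ hr] at h9
  calc dist (p a) (p b) ≤ ∑ j, |p a j - p b j| := by
        rw [EuclideanSpace.dist_eq]
        refine Real.sqrt_le_iff.2 ⟨Finset.sum_nonneg fun _ _ => abs_nonneg _, ?_⟩
        simp only [Real.dist_eq]
        exact Finset.sum_sq_le_sq_sum_of_nonneg fun _ _ => abs_nonneg _
    _ ≤ ∑ _j : Fin d, 2 * r := Finset.sum_le_sum fun j _ => h1 j
    _ = 2 * d * r := by simp; ring

/-! ## The part of a round after the sampling -/

/-- A grid needs a positive side. For radius `0` the flag adds the number of the point to the start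
of the cell code, so that only a point itself is its neighbour; the side `1` is then a dummy. -/
def radiusStmt : Stmt :=
  assign rad (un .sqrt rad) ;; Stmt.ite zero rad (assign flag (nat 0))
    (assign flag (nat 1) ;; assign rad (nat 1))

/-- Increasing `rho` makes all marks obsolete without erasing them. Dropping everything when less
than an eighth of the weight was removed forces the weight to decay on every run, also on those
where the sample is bad; only correctness is lost there. -/
def finishStmt : Stmt :=
  assign cnt (cnt + ss) ;; assign na new ;; assign rho (rho + nat 1) ;;
  Stmt.ite (nat 7 * tot) (nat 8 * newtot) (assign tot (nat 0) ;; assign na (nat 0))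
    (assign tot newtot)

/-- Discards the points near the sample. -/
def prune (d q q' : ℕ) : Prog :=
  .seq (distances d q) (.seq (median q) (.seq radiusStmt.code
    (.seq (mark d q') (.seq (keep d q') finishStmt.code))))

def scratchVars : List Var :=
  [pid, yy, Var.best, ll, xx, jj, xs, rad, len, flag, tt, new, newtot]

def pruneVars : List Var := [tot, na, cnt, rho] ++ scratchVars

def pruneTime (d q q' : ℕ) : ℕ :=
  1 + (1 + ((nearestBody d).time + (nearestInit d q).time + 2) + (distNext q).time +
    (distInit d).time + 2) +
  (1 + (1 + ((countBody q).time + (countInit q).time + 2) + medianNext.time + medianInit.time + 2) +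
  (1 + radiusStmt.time + (1 + ((markBody d q').time + (assign ll (nat 0)).time + 2) +
  (1 + ((keepBody d q').time + keepInit.time + 2) + finishStmt.time))))

theorem Runs.seq_mul {P P' : Prog} {σ : State} {a b Y : ℕ} {Q Q' : State → Prop} (hY : 1 ≤ Y)
    (h1 : Runs P σ (a * Y) Q) (h2 : ∀ τ, Q τ → Runs P' τ (b * Y) Q') :
    Runs (.seq P P') σ ((1 + a + b) * Y) Q' :=
  (h1.seq h2).mono (by nlinarith) fun _ h => h

theorem nested_le {a b c x y Y : ℕ} (h : (x + 1) * (y + 1) ≤ Y) :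
    (1 + a * (x + 1) + b + c + 2) * (y + 1) ≤ (1 + a + b + c + 2) * Y := by
  refine le_trans ?_ (Nat.mul_le_mul_left _ h)
  rw [← mul_assoc]
  refine Nat.mul_le_mul_right _ ?_
  nlinarith [Nat.zero_le x, Nat.zero_le ((1 + b + c + 2) * x)]

/-- What the sample `X` and the discarded points have in common. -/
structure Pruned {d n : ℕ} (p : Fin n → Pt d) (l X l' : List (Fin n)) (r : ℝ) : Prop where
  sub : l'.Sublist l
  near : ∀ a ∈ l, a ∉ l' → ∃ x ∈ X, dist (p a) (p x) ≤ 2 * d * r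
  far : ∀ a ∈ l', ∀ x ∈ X, r < dist (p a) (p x)

open Classical in
-- A deterministic statement, valid for every pair of samples: both halves of the median property,
-- what was discarded, and the invariants of the next round. Randomness enters only in
-- `round_bound`.
theorem prune_runs {d n : ℕ} {p : Fin n → Pt d} (hp : Function.Injective p) {w : Fin n → ℕ}
    {σ : State} {l X Q : List (Fin n)} {c q q' W : ℕ} (hD : Data p w σ)
    (hl : Holds (n * (d + 1)) l σ) (hnd : l.Nodup) (hna : σ.reg na = l.length)
    (htot : σ.reg tot = W) (hcnt : σ.reg cnt = c)
    (hX : Holds (n * (d + 2) + c) X σ) (hs : σ.reg ss = X.length) (hX0 : X ≠ [])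
    (hQ : Holds (n * q) Q σ) (hm : σ.reg mm = Q.length) (hms : Q.length ≤ X.length)
    (hq : n * (d + 2) + c + X.length ≤ n * q) (hq' : n * q + Q.length ≤ n * q')
    (hqd : d + 2 ≤ q) (hqq : q ≤ q') (hmarks : ∀ a, n * q' ≤ a → σ.mem a < σ.reg rho)
    {D : Fin n → ℝ} (hDist : IsSqDist p X D) :
    Runs (prune d q q') σ (pruneTime d q q' * (l.length + (X.length + 1) * (Q.length + 1)))
      fun τ => Fr pruneVars (Set.Ico (n * (d + 1)) (n * (d + 2)) ∪ Set.Ici (n * q)) σ τ ∧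
        ∃ (r : ℝ) (l₁ l' : List (Fin n)), 0 ≤ r ∧
          Q.length ≤ 2 * ((Finset.range Q.length).filter fun j =>
            ∃ hj : j < Q.length, D Q[j] ≤ r ^ 2).card ∧
          Q.length ≤ 2 * ((Finset.range Q.length).filter fun j =>
            ∃ hj : j < Q.length, r ^ 2 ≤ D Q[j]).card ∧
          Pruned p l X l₁ r ∧ l' = (if 7 * W < 8 * (l₁.map w).sum then [] else l₁) ∧
          Holds (n * (d + 1)) l' τ ∧ τ.reg na = l'.length ∧ τ.reg tot = ((l'.map w).sum : ℕ) ∧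
          τ.reg cnt = (c + X.length : ℕ) ∧ ∀ a, n * q' ≤ a → τ.mem a < τ.reg rho := by
  have hD0 : ∀ i, 0 ≤ D i := fun i => by
    obtain ⟨x, -, h⟩ := (hDist i).2
    rw [h]
    positivity
  have hln : l.length ≤ n := by simpa using hnd.length_le_card
  set v : ℕ → ℝ := fun j => if h : j < Q.length then D Q[j] else 0 with hv
  set Y := l.length + (X.length + 1) * (Q.length + 1) with hY
  have hYX : X.length + 1 ≤ Y :=
    (Nat.le_mul_of_pos_right _ (Nat.succ_pos _)).trans (Nat.le_add_left _ _)
  have hYl : l.length + 1 ≤ Y := Nat.add_le_add_left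
    (Nat.one_le_iff_ne_zero.2 (Nat.mul_pos (Nat.succ_pos _) (Nat.succ_pos _)).ne') _
  have hY1 : 1 ≤ Y := (Nat.succ_pos _).trans_le hYX
  set M : Set ℕ := Set.Ico (n * (d + 1)) (n * (d + 2)) ∪ Set.Ici (n * q) with hM
  set M₀ : Set ℕ := Set.Ico (n * q) (n * q + Q.length) with hM₀
  have hnd2 : n * (d + 2) = n * (d + 1) + n := by ring
  have hnqd : n * (d + 2) ≤ n * q := Nat.mul_le_mul_left n hqd
  have hnq : n * q ≤ n * q' := Nat.mul_le_mul_left n hqq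
  have hMq : Set.Ici (n * q) ⊆ M := Set.subset_union_right
  have hM₀q : M₀ ⊆ Set.Ici (n * q) := fun a ha => ha.1
  have hMd : ∀ a ∈ Set.Ici (n * q), n * (d + 1) ≤ a := fun a ha => by
    have : n * q ≤ a := ha
    omega
  refine Runs.seq_mul hY1 ((distances_runs hD hcnt hX hs hX0 hQ hm hq hDist).mono ?_ fun _ h => h) ?_
  · exact nested_le (Nat.le_add_left _ _)
  rintro σ₁ ⟨f1, hxs1, hv1⟩
  have F1 : Fr scratchVars M₀ σ σ₁ :=
    (Fr.refl [] ∅ σ).trans f1 (by decide) (by decide) (Set.empty_subset _) subset_rfl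
  have hD1 := hD.of_fr F1 (by decide) (by decide) fun a ha => hMd a (hM₀q ha)
  refine Runs.seq_mul hY1 ((median_runs (m := Q.length) (v := v) hD1.nn
    ((F1.reg _ (by decide)).trans hm)
    (fun i hi => by simpa [hv, hi] using hv1 i hi)
    (fun i hi => by simpa [hv, hi] using hD0 _)).mono ?_ fun _ h => h) ?_
  · exact nested_le ((Nat.mul_le_mul_right _ (Nat.succ_le_succ hms)).trans (Nat.le_add_left _ _))
  rintro σ₂ ⟨f2, hrad0, hlow, hhigh⟩
  have F2 : Fr scratchVars M₀ σ σ₂ :=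
    F1.trans f2 (List.Subset.refl _) (by decide) subset_rfl (Set.empty_subset _)
  set r := Real.sqrt (σ₂.reg rad) with hr
  have hr2 : r ^ 2 = σ₂.reg rad := Real.sq_sqrt hrad0
  set f : ℕ := if 0 < r then 0 else 1 with hf
  set r' : ℝ := if 0 < r then r else 1 with hr'
  have hzero : σ₂.reg zero = 0 := (F2.reg _ (by decide)).trans hD.zero
  have hnb1 : ∀ a b, Neighbours p r' f a b → dist (p a) (p b) ≤ 2 * d * r := by
    intro a b h
    by_cases h0 : 0 < r
    · rw [hr', if_pos h0] at h
      exact h.dist_le h0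
    · have : a = b := by
        have := h.1
        rw [hf, if_neg h0, one_mul, one_mul] at this
        exact Fin.ext this
      rw [this, dist_self]
      positivity
  have hnb2 : ∀ a b, dist (p a) (p b) ≤ r → Neighbours p r' f a b := by
    intro a b h
    by_cases h0 : 0 < r
    · rw [hr', if_pos h0, hf, if_pos h0]
      exact neighbours_of_dist_le h0 h
    -- At radius `0` a point within the radius coincides with the sample point, and injectivity of
    -- `p` identifies their numbers.
    · have : a = b := hp (dist_le_zero.1 (h.trans (not_lt.1 h0)))
      rw [this]
      exact ⟨rfl, by simp⟩
  refine Runs.seq_mul hY1 ((Stmt.runs (Q := fun σ₃ => Fr scratchVars M₀ σ σ₃ ∧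
    σ₃.reg rad = r' ∧ σ₃.reg flag = f ∧ σ₃.reg xs = (n * (d + 2) + c : ℕ)) _ ?_).mono
      (Nat.le_mul_of_pos_right _ hY1) fun _ h => h) ?_
  · have hden : radiusStmt.den σ₂ = (σ₂.set rad r').set flag f ∨
        radiusStmt.den σ₂ = ((σ₂.set rad r).set flag f).set rad r' := by
      simp only [radiusStmt, den, eval_sqrt, eval_var, State.set_reg, reduceCtorEq, if_false,
        if_true, hzero, ← hr]
      by_cases h0 : 0 < r
      · left; simp [h0, hr', hf]
      · right; simp [h0, hr', hf]
    have hx2 : σ₂.reg xs = (n * (d + 2) + c : ℕ) := (f2.reg xs (by decide)).trans hxs1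
    rcases hden with hden | hden <;> rw [hden] <;>
    · refine ⟨F2.trans (R' := scratchVars) (M' := ∅) ⟨fun y hy => ?_, fun _ _ => rfl⟩
        (List.Subset.refl _) (List.Subset.refl _) subset_rfl (Set.empty_subset _), by simp,
        by simp, by simpa using hx2⟩
      have h1 : y ≠ rad := by rintro rfl; exact hy (by decide)
      have h2 : y ≠ flag := by rintro rfl; exact hy (by decide)
      simp [h1, h2]
  rintro σ₃ ⟨F3, hrad3, hflag3, hxs3⟩
  have hD3 := hD.of_fr F3 (by decide) (by decide) fun a ha => hMd a (hM₀q ha)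
  have hX3 : Holds (n * (d + 2) + c) X σ₃ := hX.of_fr F3 fun b hb _ => hq.trans hb.1
  refine Runs.seq_mul hY1 ((mark_runs hD3 hxs3 hX3 ((F3.reg _ (by decide)).trans hs) hflag3
    (by omega : d + 1 ≤ q') (hq.trans hnq)).mono ?_ fun _ h => h) ?_
  · exact Nat.mul_le_mul_left _ hYX
  rintro σ₄ ⟨f4, hmark, hunmark⟩
  have F4 : Fr scratchVars (Set.Ici (n * q)) σ σ₄ :=
    F3.trans f4 (List.Subset.refl _) (by decide) hM₀q fun a ha => hnq.trans ha
  have hD4 := hD.of_fr F4 (by decide) (by decide) hMd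
  have hl4 : Holds (n * (d + 1)) l σ₄ := hl.of_fr F4 fun b hb _ => by
    have : n * q ≤ b := hb
    omega
  refine Runs.seq_mul hY1 ((keep_runs hD4 hl4 hln ((F4.reg _ (by decide)).trans hna)
    ((f4.reg flag (by decide)).trans hflag3) (hqd.trans hqq)).mono ?_ fun _ h => h) ?_
  · exact Nat.mul_le_mul_left _ hYl
  rintro σ₅ ⟨f5, l₁, hl₁, hl5, hnew, hnewtot⟩
  have F5 : Fr scratchVars M σ σ₅ :=
    F4.trans f5 (List.Subset.refl _) (by decide) hMq Set.subset_union_left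
  have hrho3 : σ₃.reg rho = σ.reg rho := F3.reg _ (by decide)
  have hrho4 : σ₄.reg rho = σ.reg rho := F4.reg _ (by decide)
  have hrad4 : σ₄.reg rad = r' := (f4.reg _ (by decide)).trans hrad3
  have hmem3 : ∀ a, n * q' ≤ a → σ₃.mem a < σ.reg rho := fun a ha => by
    rw [F3.mem a fun hc => absurd hc.2 (by omega)]
    exact hmarks a ha
  -- All stamps of earlier rounds are below the current `rho`, so a cell carries `rho` exactly if
  -- this round has marked it.
  have hkeep : ∀ a, σ₄.mem (cellAddr p r' f q' a 0) < σ.reg rho ↔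
      ∀ x ∈ X, ¬ Neighbours p r' f a x := by
    intro a
    rw [hrad3, hrho3] at hmark
    rw [hrad3] at hunmark
    constructor
    · intro h x hx hnb
      obtain ⟨o, ho, heq⟩ := (exists_offset_iff p r' f q' a x).2 hnb
      rw [heq, hmark x hx o ho] at h
      exact lt_irrefl _ h
    · intro h
      rw [hunmark _ fun x hx o ho heq =>
        h x hx ((exists_offset_iff p r' f q' a x).1 ⟨o, ho, heq⟩)]
      exact hmem3 _ ((Nat.le_add_right _ _).trans (le_cellCode _ _ _))
  have hmem1 : ∀ a, a ∈ l₁ ↔ a ∈ l ∧ ∀ x ∈ X, ¬ Neighbours p r' f a x := by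
    intro a
    rw [hl₁, List.mem_filter, decide_eq_true_iff, hrad4, hrho4, hkeep]
  have hpr : Pruned p l X l₁ r := by
    refine ⟨hl₁ ▸ List.filter_sublist, fun a ha ha' => ?_, fun a ha x hx => ?_⟩
    · rw [hmem1] at ha'
      push Not at ha'
      obtain ⟨x, hx, hnb⟩ := ha' ha
      exact ⟨x, hx, hnb1 a x hnb⟩
    · by_contra hle
      exact ((hmem1 a).1 ha).2 x hx (hnb2 a x (not_lt.1 hle))
  refine (Stmt.runs _ ?_).mono (Nat.le_mul_of_pos_right _ hY1) fun _ h => h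
  set l' := if 7 * W < 8 * (l₁.map w).sum then [] else l₁ with hl'
  have e1 : σ₅.reg cnt = c := (F5.reg _ (by decide)).trans hcnt
  have e2 : σ₅.reg ss = X.length := (F5.reg _ (by decide)).trans hs
  have e3 : σ₅.reg rho = σ.reg rho := F5.reg _ (by decide)
  have e4 : σ₅.reg tot = W := (F5.reg _ (by decide)).trans htot
  have hmarks5 : ∀ a, n * q' ≤ a → σ₅.mem a ≤ σ.reg rho := by
    intro a ha
    rw [f5.mem a (fun hc => absurd hc.2 (by omega))]
    by_cases hex : ∃ x ∈ X, ∃ o ∈ offsets d, a = cellAddr p (σ₃.reg rad) f q' x o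
    · obtain ⟨x, hx, o, ho, rfl⟩ := hex
      rw [hmark x hx o ho, hrho3]
    · push Not at hex
      rw [hunmark a hex]
      exact (hmem3 a ha).le
  have hden : finishStmt.den σ₅ = ((((σ₅.set cnt (c + X.length : ℕ)).set na l₁.length).set rho
      (σ.reg rho + 1)).set tot ((l'.map w).sum : ℕ)).set na l'.length := by
    have hcond : ((7 : ℕ) : ℝ) * W < ((8 : ℕ) : ℝ) * ((l₁.map w).sum : ℕ) ↔
        7 * W < 8 * (l₁.map w).sum := by norm_cast
    have hself : ∀ (τ : State) (x : Var) (v : ℝ), τ.reg x = v → τ.set x v = τ := by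
      rintro ⟨g, _⟩ x v rfl
      simp only [State.set, State.mk.injEq, and_true]
      ext y
      split_ifs with h <;> simp [h]
    simp only [finishStmt, den, eval_add, eval_mul, eval_nat, eval_var, State.set_reg, reduceCtorEq,
      if_false, e1, e2, e3, e4, hnew, hnewtot, hcond, Nat.cast_one, ← Nat.cast_add]
    by_cases h : 7 * W < 8 * (l₁.map w).sum
    · simp [hl', h]
    · rw [if_neg h, hl', if_neg h]
      exact (hself _ na _ (by simp)).symm
  rw [hden]
  refine ⟨F5.trans (R' := pruneVars) (M' := ∅) ⟨fun y hy => ?_, fun _ _ => rfl⟩ (by decide)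
    (List.Subset.refl _) subset_rfl (Set.empty_subset _), r, l₁, l', Real.sqrt_nonneg _,
    ?_, ?_, hpr, rfl, ?_, by simp, by simp, by simp, fun a ha => ?_⟩
  · have h1 : y ≠ cnt := by rintro rfl; exact hy (by decide)
    have h2 : y ≠ na := by rintro rfl; exact hy (by decide)
    have h3 : y ≠ rho := by rintro rfl; exact hy (by decide)
    have h4 : y ≠ tot := by rintro rfl; exact hy (by decide)
    simp [h1, h2, h3, h4]
  · refine hlow.trans_eq ?_
    congr 2
    ext j
    simp only [Finset.mem_filter, Finset.mem_range, hv, hr2]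
    refine and_congr_right fun hj => ?_
    simp [hj]
  · refine hhigh.trans_eq ?_
    congr 2
    ext j
    simp only [Finset.mem_filter, Finset.mem_range, hv, hr2]
    refine and_congr_right fun hj => ?_
    simp [hj]
  · rw [hl']
    split_ifs
    · exact fun t ht => absurd ht (by simp)
    · exact hl5
  · simpa using (hmarks5 a ha).trans_lt (lt_add_one _)

/-! ## Sampling -/

/-- Draws a stratified sample. -/
def sample (d : ℕ) : Prog := .seq fill (merge d)

def sampleTime (d : ℕ) : ℕ :=
  1 + (10 + fillBody.time + fillInit.time) + (3 + mergeInit.time + (mergeBody d).time)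

theorem seq_time_le {a b x y : ℕ} (h : x ≤ y) (hy : 1 ≤ y) :
    1 + a * x + b * y ≤ (1 + a + b) * y := by
  nlinarith [Nat.mul_le_mul_left a h]

theorem sample_bound {d n : ℕ} {p : Fin n → Pt d} {w : Fin n → ℕ} {σ : State} {l : List (Fin n)}
    {β c W : ℕ} (hD : Data p w σ) (hl : Holds (n * (d + 1)) l σ) (hln : l.length ≤ n)
    (hna : σ.reg na = l.length) (hW : (l.map w).sum = W) (hW0 : 0 < W) (htot : σ.reg tot = W)
    (hb : σ.reg base = β) (hc : σ.reg len = c) (hβ : n * (d + 2) ≤ β)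
    {g : State → ℝ≥0∞} {v : (ℕ → ℕ) → ℝ≥0∞}
    (hg : ∀ u τ (X : List (Fin n)), Fr [val, jj, tt, cum, pid, xx] (Set.Icc β (β + c)) σ τ →
      X.length = c → Holds β X τ →
      (∀ (j : ℕ) (hj : j < X.length), locate w c l (j * W + u j) = some X[j]) → g τ ≤ v u)
    (u : ℕ → ℕ) :
    Bound (sample d) σ (sampleTime d * (l.length + c + 1)) g (tape W c 0 u v) := by
  set T := (3 + mergeInit.time + (mergeBody d).time) * (l.length + c + 1)
  refine Bound.mono (Bound.seq_best (T' := T)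
    (fill_bound hW0 hb hc htot (fun u τ hu hf h1 h2 => ?_) u)) ?_ (fun _ => le_rfl) le_rfl
  · have hd2 : n * (d + 2) = n * (d + 1) + n := by ring
    have hDτ := hD.of_fr hf (by decide) (by decide) fun a ha => by
      have := ha.1
      omega
    set pos : ℕ → ℕ := fun j => if j < c then j * W + u j else c * W with hpos
    refine Bound.best_le (Runs.bound (merge_runs (pos := pos) hDτ (hl.of_fr hf fun b hb' _ => ?_) hln
      ((hf.reg _ (by decide)).trans hna) hW ((hf.reg _ (by decide)).trans hb)
      ((hf.reg _ (by decide)).trans hc) hβ ?_ ?_ ?_ ?_) fun ρ hρ => ?_)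
    · have := hb'.1
      omega
    · intro j hj
      simp only [hpos, hj, if_true]
      have := hu j hj
      split_ifs with h
      · nlinarith
      · obtain rfl : c = j + 1 := by omega
        nlinarith
    · simp [hpos]
    · intro j hj
      simp only [hpos, hj, if_true]
      have := hu j hj
      have : (j + 1) * W ≤ c * W := Nat.mul_le_mul_right _ hj
      nlinarith
    · intro j hj
      rcases hj.lt_or_eq with hj | rfl
      · simp only [hpos, hj, if_true]
        exact h1 j hj
      · simp only [hpos, lt_irrefl, if_false]
        exact h2
    · obtain ⟨f2, X, hX1, hX2, hX3⟩ := hρ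
      refine hg u ρ X (hf.trans f2 (by decide) (by decide) subset_rfl Set.Ico_subset_Icc_self)
        hX1 hX2 fun j hj => ?_
      have := hX3 j hj
      simp only [hpos] at this
      rwa [if_pos (hX1 ▸ hj)] at this
  · exact seq_time_le (by omega) (by omega)

/-! ## A round -/

/-- The sample is written directly behind the centers chosen so far, so increasing `cnt` later is
all it takes to adopt it. -/
def prepSample (d : ℕ) : Stmt := assign base (nn * nat (d + 2) + cnt) ;; assign len ss

def prepTest (q : ℕ) : Stmt := assign base (nn * nat q) ;; assign len mm

def round (d q q' : ℕ) : Prog :=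
  .seq (prepSample d).code (.seq (sample d) (.seq (prepTest q).code
    (.seq (sample d) (prune d q q'))))

def roundTime (d q q' : ℕ) : ℕ :=
  4 + (prepSample d).time + sampleTime d + (prepTest q).time + sampleTime d + pruneTime d q q'

/-- The points in `l` remain to be clustered, and the centers in `X` have been chosen. -/
structure Live {d n : ℕ} (p : Fin n → Pt d) (w : Fin n → ℕ) (s m q' : ℕ) (l X : List (Fin n))
    (σ : State) : Prop where
  data : Data p w σ
  tot : σ.reg tot = ((l.map w).sum : ℕ)
  na : σ.reg na = l.length
  alive : Holds (n * (d + 1)) l σ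
  nodup : l.Nodup
  ss : σ.reg ss = s
  mm : σ.reg mm = m
  cnt : σ.reg cnt = X.length
  cent : Holds (n * (d + 2)) X σ
  marks : ∀ a, n * q' ≤ a → σ.mem a < σ.reg rho

/-- The centers `X` pay for the points that are in `l` but not in `l'`. -/
def Pays {d n : ℕ} (p : Fin n → Pt d) (w : Fin n → ℕ) (φ : ℕ → Fin n → Fin n)
    (l l' X : List (Fin n)) : Prop :=
  ∀ c : Fin n → ℝ, (∀ i, 0 ≤ c i) → (∀ i, ∀ x ∈ X, c i ≤ dist (p i) (p x)) →
    ∀ e, 1 ≤ e → e ≤ 2 → Charged w (fun i => dist (p i) (p (φ e i))) e l'.toFinset c →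
      Charged w (fun i => dist (p i) (p (φ e i))) e l.toFinset c

/-- The fraction of a cluster that the sample has to hit. -/
def hitRate (d : ℕ) : ℝ := 1 / (1024 * d ^ 2)

theorem Holds.append {n a : ℕ} {l l' : List (Fin n)} {σ : State} (h : Holds a l σ)
    (h' : Holds (a + l.length) l' σ) : Holds a (l ++ l') σ := by
  intro t ht
  by_cases hlt : t < l.length
  · rw [List.getElem_append_left hlt]
    exact h t hlt
  · rw [List.getElem_append_right (by omega), ← h' (t - l.length) (by simp at ht; omega)]
    congr 1
    omega

open Classical in
-- Outside the bad events all hypotheses of `Charged.step` hold: the test sample puts at least an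
-- eighth of the weight at squared distance at most `r ^ 2` and at least `r ^ 2`, respectively, and
-- `bad_weight_le` with rate `1 / (1024 * d ^ 2)` gives the bound `W / (512 * d ^ 2)` on the bad
-- weight.
theorem pays_of_pruned {d n : ℕ} (hd : 1 ≤ d) {p : Fin n → Pt d} {w : Fin n → ℕ}
    {φ : ℕ → Fin n → Fin n} {k s m W : ℕ} (hk : 1 ≤ k)
    (hφ : ∀ e, (Finset.univ.image (φ e)).card ≤ k) {l X Q l₁ l' : List (Fin n)} (hl : l.Nodup)
    (hW : (l.map w).sum = W) {u u' : ℕ → ℕ} {D : Fin n → ℝ} (hX : X.length = s) (hQ : Q.length = m)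
    (hX0 : X ≠ []) (hDist : IsSqDist p X D)
    (hu : ∀ (j : ℕ) (hj : j < X.length), locate w s l (j * W + u j) = some X[j])
    (hu' : ∀ (j : ℕ) (hj : j < Q.length), locate w m l (j * W + u' j) = some Q[j])
    (hmiss : ∀ e, 1 ≤ e → e ≤ 2 →
      ¬ Misses w (φ e) (fun i => dist (p i) (p (φ e i))) (hitRate d) k l W s u)
    (hlow : ¬ Skewed w D l W m u') (hhigh : ¬ Skewed w (fun i => - D i) l W m u')
    {r : ℝ} (hr : 0 ≤ r)
    (hr1 : Q.length ≤ 2 * ((Finset.range Q.length).filter fun j =>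
      ∃ hj : j < Q.length, D Q[j] ≤ r ^ 2).card)
    (hr2 : Q.length ≤ 2 * ((Finset.range Q.length).filter fun j =>
      ∃ hj : j < Q.length, r ^ 2 ≤ D Q[j]).card)
    (hpr : Pruned p l X l₁ r) (hl' : l' = (if 7 * W < 8 * (l₁.map w).sum then [] else l₁)) :
    Pays p w φ l l' X := by
  obtain ⟨x₀, hx₀⟩ := List.exists_mem_of_ne_nil X hX0
  set Z : ℕ → Fin n := fun j => if h : j < Q.length then Q[j] else x₀ with hZ
  have hZ1 : ∀ j < m, locate w m l (j * W + u' j) = some (Z j) := by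
    intro j hj
    have hj' : j < Q.length := hQ ▸ hj
    rw [hu' j hj', hZ]
    simp [hj']
  have hWr : (W : ℝ) = ∑ i ∈ l.toFinset, (w i : ℝ) := by
    rw [← hW]
    exact list_sum_cast_eq hl w
  have hl₁nd : l₁.Nodup := hpr.sub.nodup hl
  have h1 := low_weight_ge hlow hZ1 (r := r ^ 2) (by
    rw [← hQ]
    refine hr1.trans_eq ?_
    congr 2
    ext j
    simp only [Finset.mem_filter, Finset.mem_range, hZ]
    exact and_congr_right fun hj => by simp [hj])
  have h2 := low_weight_ge hhigh hZ1 (r := - r ^ 2) (by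
    rw [← hQ]
    refine hr2.trans_eq ?_
    congr 2
    ext j
    simp only [Finset.mem_filter, Finset.mem_range, hZ]
    exact and_congr_right fun hj => by simp [hj])
  have hsub : l₁.toFinset ⊆ l.toFinset := fun a ha => by
    rw [List.mem_toFinset] at ha ⊢
    exact hpr.sub.subset ha
  have h7 : 8 * ∑ i ∈ l₁.toFinset, (w i : ℝ) ≤ 7 * ∑ i ∈ l.toFinset, (w i : ℝ) := by
    have hdisj : Disjoint l₁.toFinset (l.toFinset.filter fun i => D i ≤ r ^ 2) := by
      rw [Finset.disjoint_left]
      intro a ha ha'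
      obtain ⟨x, hx, hxD⟩ := (hDist a).2
      have := hpr.far a (List.mem_toFinset.1 ha) x hx
      have h3 := (Finset.mem_filter.1 ha').2
      rw [hxD] at h3
      have := pow_lt_pow_left₀ this hr two_ne_zero
      linarith
    have := Finset.sum_le_sum_of_subset_of_nonneg (f := fun i => (w i : ℝ))
      (Finset.union_subset hsub (Finset.filter_subset (fun i => D i ≤ r ^ 2) l.toFinset))
      fun _ _ _ => Nat.cast_nonneg _
    rw [Finset.sum_union hdisj] at this
    linarith
  -- Enough weight was discarded, so the remaining points are not dropped.
  have hl₁' : l' = l₁ := by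
    rw [hl', if_neg]
    rw [not_lt, ← Nat.cast_le (α := ℝ), Nat.cast_mul, Nat.cast_mul, hWr, list_sum_cast_eq hl₁nd w]
    exact_mod_cast h7
  subst hl₁'
  intro c hc0 hc e he1 he2 hch
  obtain ⟨S, hS⟩ : ∃ S : Set (Fin n), ∀ x, x ∈ S ↔ x ∈ X := ⟨{x | x ∈ X}, fun _ => Iff.rfl⟩
  refine Charged.step hd he2 (S := S) (fun i => dist_nonneg) hr hsub h7 hc0
    (fun i x hx => hc i x ((hS x).1 hx)) (fun i hi hi' => ?_) ?_ ?_ hch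
  · obtain ⟨x, hx, hx'⟩ := hpr.near i (List.mem_toFinset.1 hi)
      fun h => hi' (List.mem_toFinset.2 h)
    exact ⟨x, (hS x).2 hx, hx'⟩
  · have hd0 : (0 : ℝ) < d := by exact_mod_cast hd
    refine (bad_weight_le (by rw [hitRate]; positivity) hk (hφ e) hWr (hmiss e he1 he2)
      fun j hj a ha => ?_).trans_eq ?_
    · have hj' : j < X.length := hX ▸ hj
      rw [hu j hj', Option.some_inj] at ha
      exact (hS a).2 (ha ▸ List.getElem_mem hj')
    · rw [← hWr, hitRate]
      field_simp
      ring
  · refine h2.trans (Finset.sum_le_sum_of_subset_of_nonneg (fun a ha => ?_)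
      fun _ _ _ => Nat.cast_nonneg _)
    obtain ⟨ha1, ha2⟩ := Finset.mem_filter.1 ha
    refine Finset.mem_filter.2 ⟨ha1, fun x hx => ?_⟩
    have := (hDist a).1 x ((hS x).1 hx)
    exact (sq_le_sq₀ hr dist_nonneg).1 (by linarith)

/-- The probability that a round fails. -/
def roundError (d k s m : ℕ) : ℝ≥0∞ :=
  (k * ENNReal.ofReal (Real.exp (-(s * hitRate d ^ 2 / k))) +
    k * ENNReal.ofReal (Real.exp (-(s * hitRate d ^ 2 / k)))) +
  (ENNReal.ofReal (Real.exp (-(m / 4))) + ENNReal.ofReal (Real.exp (-(m / 4))))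

theorem round_time_le {a b c e x x' Y : ℕ} (h : x ≤ Y) (h' : x' ≤ Y) (h1 : 1 ≤ Y) :
    1 + a + (1 + b * x + (1 + c + (1 + b * x' + e * Y))) ≤ (4 + a + b + c + b + e) * Y := by
  nlinarith [Nat.mul_le_mul_left b h, Nat.mul_le_mul_left b h', Nat.mul_le_mul_left (4 + a + c) h1]

def sampleVars : List Var := [base, len, val, jj, tt, cum, pid, xx]

theorem hitRate_nonneg (d : ℕ) : 0 ≤ hitRate d := by rw [hitRate]; positivity

theorem hitRate_le_one (d : ℕ) : hitRate d ≤ 1 := by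
  rw [hitRate]
  rcases Nat.eq_zero_or_pos d with rfl | hd
  · simp
  · have : (1 : ℝ) ≤ d := by exact_mod_cast hd
    rw [div_le_one (by positivity)]
    nlinarith

theorem tape_add_add_le {W c j : ℕ} {u : ℕ → ℕ} (x : ℝ≥0∞) {v v' : (ℕ → ℕ) → ℝ≥0∞} {a b : ℝ≥0∞}
    (h : tape W c j u v ≤ a) (h' : tape W c j u v' ≤ b) :
    tape W c j u (fun u => x + (v u + v' u)) ≤ x + (a + b) :=
  (tape_add W c j u (fun _ => x) _).trans_le (add_le_add (tape_const_le _ _ _ _ _)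
    ((tape_add W c j u v v').trans_le (add_le_add h h')))

/-- The hypothesis on `g` has two tiers: always at most `1`, and at most `v` if the sample pays. So
`g` is at most `v` plus the indicators of four bad events, namely a missed near part for either
exponent and a test sample skewed to either side. When the test sample is drawn, the distances to
`X` are already fixed, so the tail bound applies to them for every outcome of the first sample. -/
theorem round_bound {d n : ℕ} (hd : 1 ≤ d) {p : Fin n → Pt d} (hp : Function.Injective p)
    {w : Fin n → ℕ} {φ : ℕ → Fin n → Fin n} {k s m q q' : ℕ} (hk : 1 ≤ k)
    (hφ : ∀ e, (Finset.univ.image (φ e)).card ≤ k) (hs : 1 ≤ s) (hms : m ≤ s) (hqd : d + 2 ≤ q)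
    (hqq : q ≤ q') (hq' : n * q + m + 1 ≤ n * q') {l X : List (Fin n)} {σ : State}
    (hL : Live p w s m q' l X σ) (hq : n * (d + 2) + X.length + s + 1 ≤ n * q)
    (hW0 : 0 < (l.map w).sum) {g : State → ℝ≥0∞} {v : ℝ≥0∞}
    (hg : ∀ τ l' X', Live p w s m q' l' (X ++ X') τ → X'.length = s → l'.Sublist l →
      8 * (l'.map w).sum ≤ 7 * (l.map w).sum → g τ ≤ 1 ∧ (Pays p w φ l l' X' → g τ ≤ v)) :
    Bound (round d q q') σ (roundTime d q q' * (l.length + (s + 1) * (m + 1))) g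
      (v + roundError d k s m) := by
  set Y := l.length + (s + 1) * (m + 1) with hY
  set W := (l.map w).sum with hW
  set β := n * (d + 2) + X.length with hβ
  have hln : l.length ≤ n := by simpa using hL.nodup.length_le_card
  have hnd2 : n * (d + 2) = n * (d + 1) + n := by ring
  have hnq : n * q ≤ n * q' := Nat.mul_le_mul_left n hqq
  have hnqd : n * (d + 2) ≤ n * q := Nat.mul_le_mul_left n hqd
  set E₁ := (k : ℝ≥0∞) * ENNReal.ofReal (Real.exp (-(s * hitRate d ^ 2 / k))) with hE₁
  set E₂ := ENNReal.ofReal (Real.exp (-((m : ℝ) / 4))) with hE₂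
  set Miss : ℕ → (ℕ → ℕ) → Prop := fun e u =>
    Misses w (φ e) (fun i => dist (p i) (p (φ e i))) (hitRate d) k l W s u with hMiss
  refine Bound.mono (Runs.seq_bound (T' := 1 + sampleTime d * (l.length + s + 1) +
    (1 + (prepTest q).time + (1 + sampleTime d * (l.length + m + 1) + pruneTime d q q' * Y)))
    (Stmt.runs (Q := fun τ => Fr sampleVars ∅ σ τ ∧ τ.reg base = β ∧ τ.reg len = s) _ ?_)
    fun σ₁ hσ₁ => Bound.seq_best (v := v + (E₂ + E₂) + (E₁ + E₁)) ?_) ?_ (fun _ => le_rfl) ?_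
  · have hden : (prepSample d).den σ = (σ.set base β).set len s := by
      simp only [prepSample, den, eval_add, eval_mul, eval_var, eval_nat, hL.data.nn, hL.cnt,
        State.set_reg, reduceCtorEq, if_false, hL.ss, hβ]
      push_cast
      rfl
    rw [hden]
    refine ⟨⟨fun y hy => ?_, fun _ _ => rfl⟩, by simp, by simp⟩
    have h1 : y ≠ base := by rintro rfl; exact hy (by decide)
    have h2 : y ≠ len := by rintro rfl; exact hy (by decide)
    simp [h1, h2]
  · obtain ⟨f1, hb1, hl1⟩ := hσ₁
    have hD1 := hL.data.of_fr f1 (by decide) (by decide) (by simp)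
    refine Bound.mono (sample_bound hD1 (hL.alive.of_fr f1 (by simp)) hln
      ((f1.reg _ (by decide)).trans hL.na) hW.symm hW0 ((f1.reg _ (by decide)).trans hL.tot) hb1 hl1
      (Nat.le_add_right _ _) (v := fun u => (v + (E₂ + E₂)) + (ind (Miss 1 u) + ind (Miss 2 u)))
      (fun u σ₂ X' f2 hX'1 hX'2 hX'3 => Bound.best_le ?_) 0) le_rfl (fun _ => le_rfl) ?_
    · have F2 : Fr sampleVars (Set.Icc β (β + s)) σ σ₂ :=
        f1.trans f2 (List.Subset.refl _) (by decide) (Set.empty_subset _) subset_rfl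
      have hX'0 : X' ≠ [] := by
        rintro rfl
        simp only [List.length_nil] at hX'1
        omega
      obtain ⟨D, hDist⟩ := exists_isSqDist p hX'0
      have hD2 := hL.data.of_fr F2 (by decide) (by decide) fun a ha => by
        have := ha.1
        omega
      refine Runs.seq_bound
        (Stmt.runs (Q := fun τ => Fr sampleVars ∅ σ₂ τ ∧ τ.reg base = (n * q : ℕ) ∧ τ.reg len = m)
          _ ?_) fun σ₃ hσ₃ => Bound.seq_best ?_
      · have hden : (prepTest q).den σ₂ = (σ₂.set base (n * q : ℕ)).set len m := by
          simp only [prepTest, den, eval_mul, eval_var, eval_nat, hD2.nn, State.set_reg,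
            reduceCtorEq, if_false, F2.reg Var.mm (by decide), hL.mm]
          push_cast
          rfl
        rw [hden]
        refine ⟨⟨fun y hy => ?_, fun _ _ => rfl⟩, by simp, by simp⟩
        have h1 : y ≠ base := by rintro rfl; exact hy (by decide)
        have h2 : y ≠ len := by rintro rfl; exact hy (by decide)
        simp [h1, h2]
      · obtain ⟨f3, hb3, hl3⟩ := hσ₃
        have F3 : Fr sampleVars (Set.Icc β (β + s)) σ σ₃ :=
          F2.trans f3 (List.Subset.refl _) (List.Subset.refl _) subset_rfl (Set.empty_subset _)
        have hD3 := hD2.of_fr f3 (by decide) (by decide) (by simp)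
        have hl3' : Holds (n * (d + 1)) l σ₃ := hL.alive.of_fr F3 fun b hb _ => by
          have := hb.1
          omega
        have hX'3' : Holds β X' σ₃ := hX'2.of_fr f3 (by simp)
        refine Bound.mono (sample_bound hD3 hl3' hln
          ((F3.reg _ (by decide)).trans hL.na) hW.symm hW0 ((F3.reg _ (by decide)).trans hL.tot)
          hb3 hl3 hnqd (v := fun u' => (v + (ind (Miss 1 u) + ind (Miss 2 u))) +
            (ind (Skewed w D l W m u') + ind (Skewed w (fun i => - D i) l W m u')))
          (fun u' σ₄ Q f4 hQ1 hQ2 hQ3 => Bound.best_le ?_) 0) le_rfl (fun _ => le_rfl) ?_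
        · set M : Set ℕ := Set.Icc β (β + s) ∪ Set.Icc (n * q) (n * q + m) with hM
          have F4 : Fr sampleVars M σ σ₄ :=
            F3.trans f4 (List.Subset.refl _) (by decide) Set.subset_union_left
              Set.subset_union_right
          have hMn : ∀ a ∈ M, n * (d + 2) + X.length ≤ a ∧ a < n * q' := by
            rintro a (ha | ha) <;> obtain ⟨h1, h2⟩ := ha <;> constructor <;> omega
          have hD4 := hL.data.of_fr F4 (by decide) (by decide) fun a ha => by
            have := hMn a ha
            omega
          have hX4 : Holds β X' σ₄ := hX'3'.of_fr f4 fun b hb _ => by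
            have := hb.1
            omega
          have hl4 : Holds (n * (d + 1)) l σ₄ := hL.alive.of_fr F4 fun b hb _ => by
            have := hMn b hb
            omega
          refine Runs.bound (Runs.mono (prune_runs hp hD4 hl4 hL.nodup
            ((F4.reg _ (by decide)).trans hL.na)
            ((F4.reg _ (by decide)).trans hL.tot) ((F4.reg _ (by decide)).trans hL.cnt) hX4
            (((F4.reg _ (by decide)).trans hL.ss).trans (by rw [hX'1])) hX'0 hQ2
            (((F4.reg _ (by decide)).trans hL.mm).trans (by rw [hQ1])) (by omega)
            (by omega) (by omega) hqd hqq (fun a ha => ?_) hDist) ?_ fun _ h => h) ?_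
          · rw [F4.mem a fun hc => by have := hMn a hc; omega, F4.reg rho (by decide)]
            exact hL.marks a ha
          · rw [hX'1, hQ1]
          · rintro τ ⟨f5, r, l₁, l', hr, hr1, hr2, hpr, hl', t1, t2, t3, t4, t5⟩
            have hsub : l'.Sublist l := by
              rw [hl']
              split_ifs
              · exact List.nil_sublist _
              · exact hpr.sub
            have h7 : 8 * (l'.map w).sum ≤ 7 * W := by
              rw [hl']
              split_ifs with h
              · simp
              · omega
            have hlive : Live p w s m q' l' (X ++ X') τ := by
              refine ⟨hD4.of_fr f5 (by decide) (by decide) ?_, t3, t2, t1, hsub.nodup hL.nodup,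
                (f5.reg _ (by decide)).trans ((F4.reg _ (by decide)).trans hL.ss),
                (f5.reg _ (by decide)).trans ((F4.reg _ (by decide)).trans hL.mm),
                by rw [t4, List.length_append], ?_, t5⟩
              · rintro a (ha | ha)
                · exact ha.1
                · have : n * q ≤ a := ha
                  omega
              · have hout : ∀ b ∈ Set.Ico (n * (d + 1)) (n * (d + 2)) ∪ Set.Ici (n * q),
                    b < n * (d + 2) ∨ n * q ≤ b := by
                  rintro b (hb | hb)
                  · exact Or.inl hb.2
                  · exact Or.inr hb
                refine Holds.append ?_ (hX4.of_fr f5 fun b hb _ => ?_)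
                · refine (hL.cent.of_fr F4 fun b hb _ => (hMn b hb).1).of_fr f5 fun b hb _ => ?_
                  have := hout b hb
                  omega
                · have := hout b hb
                  omega
            obtain ⟨hg1, hg2⟩ := hg τ l' X' hlive hX'1 hsub h7
            by_cases hm1 : Miss 1 u
            · rw [ind_pos hm1]
              refine hg1.trans (le_trans ?_ le_self_add)
              exact le_self_add.trans le_add_self
            by_cases hm2 : Miss 2 u
            · rw [ind_pos hm2]
              refine hg1.trans (le_trans ?_ le_self_add)
              exact le_add_self.trans le_add_self
            by_cases hs1 : Skewed w D l W m u'
            · rw [ind_pos hs1]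
              exact hg1.trans (le_self_add.trans le_add_self)
            by_cases hs2 : Skewed w (fun i => - D i) l W m u'
            · rw [ind_pos hs2]
              exact hg1.trans (le_add_self.trans le_add_self)
            refine (hg2 (pays_of_pruned hd hk hφ hL.nodup hW.symm hX'1 hQ1 hX'0 hDist hX'3 hQ3
              (fun e he1 he2 => ?_) hs1 hs2 hr hr1 hr2 hpr hl')).trans
              (le_self_add.trans le_self_add)
            obtain rfl | rfl : e = 1 ∨ e = 2 := by omega
            · exact hm1
            · exact hm2
        · refine (tape_add_add_le _ (tape_skewed_le w D hL.nodup hW.symm hW0 m 0)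
            (tape_skewed_le w (fun i => - D i) hL.nodup hW.symm hW0 m 0)).trans_eq ?_
          exact add_right_comm _ _ _
    · exact tape_add_add_le _
        (tape_misses_le w (φ 1) _ (hitRate_nonneg d) (hitRate_le_one d) (hφ 1) hL.nodup
          hW.symm hW0 s 0)
        (tape_misses_le w (φ 2) _ (hitRate_nonneg d) (hitRate_le_one d) (hφ 2) hL.nodup
          hW.symm hW0 s 0)
  · have h1 : l.length + s + 1 ≤ Y := by
      rw [hY, add_assoc]
      exact Nat.add_le_add_left (Nat.le_mul_of_pos_right _ (Nat.succ_pos _)) _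
    have h2 : l.length + m + 1 ≤ Y := by omega
    exact round_time_le h1 h2 (by omega)
  · rw [roundError, add_assoc, add_comm (E₂ + E₂)]

/-! ## Sums over a decreasing sequence of weights -/

/-- The sum of `f` over `N`, `⌊7N/8⌋`, … -/
def total (f : ℕ → ℕ) : ℕ → ℕ
  | 0 => 0
  | N + 1 => f (N + 1) + total f (7 * (N + 1) / 8)
decreasing_by omega

theorem total_of_pos (f : ℕ → ℕ) {N : ℕ} (hN : 0 < N) : total f N = f N + total f (7 * N / 8) := by
  obtain ⟨N, rfl⟩ : ∃ M, N = M + 1 := ⟨N - 1, by omega⟩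
  rw [total]

theorem total_zero (f : ℕ → ℕ) : total f 0 = 0 := by rw [total]

theorem total_linear (f : ℕ → ℕ) (a b N : ℕ) :
    total (fun M => a * f M + b) N = a * total f N + b * total (fun _ => 1) N := by
  induction N using Nat.strong_induction_on with
  | _ N ih =>
    rcases Nat.eq_zero_or_pos N with rfl | hN
    · simp [total_zero]
    · rw [total_of_pos _ hN, total_of_pos f hN, total_of_pos (fun _ => 1) hN, ih _ (by omega)]
      ring

theorem total_id_le (N : ℕ) : total id N ≤ 8 * N := by
  induction N using Nat.strong_induction_on with
  | _ N ih =>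
    rcases Nat.eq_zero_or_pos N with rfl | hN
    · simp [total_zero]
    · have := ih (7 * N / 8) (by omega)
      rw [total_of_pos _ hN, id]
      omega

/-- The number of rounds that suffice for a total weight `N`. -/
def rounds (N : ℕ) : ℕ := total (fun _ => 1) N

theorem rounds_of_pos {N : ℕ} (hN : 0 < N) : rounds N = 1 + rounds (7 * N / 8) :=
  total_of_pos _ hN

/-- Each round lowers `8 * log N` by at least one, since `log (7 / 8) ≤ -1 / 8`. -/
theorem rounds_le {N : ℕ} (hN : 1 ≤ N) : (rounds N : ℝ) ≤ 1 + 8 * Real.log N := by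
  induction N using Nat.strong_induction_on with
  | _ N ih =>
    rw [rounds_of_pos hN]
    rcases Nat.eq_zero_or_pos (7 * N / 8) with h0 | h0
    · rw [h0, rounds, total_zero]
      have := Real.log_natCast_nonneg N
      push_cast
      linarith
    · have h1 := ih _ (by omega) h0
      have hN0 : (0 : ℝ) < N := by exact_mod_cast hN
      have h2 : ((7 * N / 8 : ℕ) : ℝ) ≤ 7 / 8 * N := by
        refine Nat.cast_div_le.trans_eq ?_
        push_cast
        ring
      have h3 : Real.log ((7 * N / 8 : ℕ) : ℝ) ≤ Real.log (7 / 8) + Real.log N := by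
        rw [← Real.log_mul (by norm_num) hN0.ne']
        exact Real.log_le_log (by exact_mod_cast h0) h2
      have h4 := Real.log_le_sub_one_of_pos (show (0 : ℝ) < 7 / 8 by norm_num)
      push_cast
      linarith

/-! ## The loop -/

def roundLoop (d q q' : ℕ) : Prog := .loop zero.idx tot.idx (round d q q')

/-- All points in `l` have been removed, and the centers in `Y` have been chosen after `X`. -/
structure Final {d n : ℕ} (p : Fin n → Pt d) (w : Fin n → ℕ) (s m q' : ℕ)
    (l X : List (Fin n)) (N : ℕ) (σ : State) (Y : List (Fin n)) : Prop where
  live : Live p w s m q' [] (X ++ Y) σ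
  length_le : Y.length ≤ s * rounds N
  ne_nil : l ≠ [] → Y ≠ []

theorem Final.step {d n : ℕ} {p : Fin n → Pt d} {w : Fin n → ℕ} {s m q' N : ℕ}
    {l l' X X' Y : List (Fin n)} {σ : State} (hN : 0 < N) (hs : 1 ≤ s) (hX' : X'.length = s)
    (h : Final p w s m q' l' (X ++ X') (7 * N / 8) σ Y) :
    Final p w s m q' l X N σ (X' ++ Y) := by
  refine ⟨by rw [← List.append_assoc]; exact h.live, ?_, fun _ hc => ?_⟩
  · rw [List.length_append, hX', rounds_of_pos hN, mul_add, mul_one]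
    exact Nat.add_le_add_left h.length_le _
  · have := congrArg List.length hc
    simp only [List.length_append, List.length_nil] at this
    omega

theorem Pays.trans {d n : ℕ} {p : Fin n → Pt d} {w : Fin n → ℕ} {φ : ℕ → Fin n → Fin n}
    {l l' l'' X Y : List (Fin n)} (h : Pays p w φ l l' X) (h' : Pays p w φ l' l'' Y) :
    Pays p w φ l l'' (X ++ Y) := fun c hc0 hc e he1 he2 hch =>
  h c hc0 (fun i x hx => hc i x (List.mem_append_left _ hx)) e he1 he2
    (h' c hc0 (fun i x hx => hc i x (List.mem_append_right _ hx)) e he1 he2 hch)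

/-- The indicator of the final states in which the centers do not pay for all points. -/
def risk {d n : ℕ} (p : Fin n → Pt d) (w : Fin n → ℕ) (φ : ℕ → Fin n → Fin n) (s m q' : ℕ)
    (l X : List (Fin n)) (N : ℕ) (σ : State) : ℝ≥0∞ :=
  ⨅ (Y : List (Fin n)) (_ : Final p w s m q' l X N σ Y), ind (¬ Pays p w φ l [] Y)

theorem risk_le {d n : ℕ} {p : Fin n → Pt d} {w : Fin n → ℕ} {φ : ℕ → Fin n → Fin n}
    {s m q' N : ℕ} {l X Y : List (Fin n)} {σ : State} (h : Final p w s m q' l X N σ Y) :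
    risk p w φ s m q' l X N σ ≤ ind (¬ Pays p w φ l [] Y) := iInf₂_le Y h

theorem exists_final {d n : ℕ} {p : Fin n → Pt d} {w : Fin n → ℕ} {φ : ℕ → Fin n → Fin n}
    {s m q' N : ℕ} {l X : List (Fin n)} {σ : State} (h : risk p w φ s m q' l X N σ ≠ ⊤) :
    ∃ Y, Final p w s m q' l X N σ Y := by
  by_contra hc
  push Not at hc
  exact h (by simp [risk, hc])

theorem roundError_ne_top (d k s m : ℕ) : roundError d k s m ≠ ⊤ := by
  rw [roundError]
  finiteness

/-- Induction on an upper bound `N` for the alive weight rather than on the weight itself, so that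
time and error depend only on the deterministic sequence `N`, `7 * N / 8`, and so on. The function
`f` bounds the number of alive points by their weight: it is the identity for unit weights and
constant for general ones. -/
theorem roundLoop_bound {d n : ℕ} (hd : 1 ≤ d) {p : Fin n → Pt d} (hp : Function.Injective p)
    {w : Fin n → ℕ} (hw : ∀ i, 1 ≤ w i) {φ : ℕ → Fin n → Fin n} {k s m q q' : ℕ} (hk : 1 ≤ k)
    (hφ : ∀ e, (Finset.univ.image (φ e)).card ≤ k) (hs : 1 ≤ s) (hms : m ≤ s) (hqd : d + 2 ≤ q)
    (hqq : q ≤ q') (hq' : n * q + m + 1 ≤ n * q') {f : ℕ → ℕ} (hf : Monotone f)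
    (hlen : ∀ l : List (Fin n), l.Nodup → l.length ≤ f (l.map w).sum) (N : ℕ) :
    ∀ (l X : List (Fin n)) (σ : State), Live p w s m q' l X σ → (l.map w).sum ≤ N →
      n * (d + 2) + X.length + s * rounds N + 1 ≤ n * q →
      Bound (roundLoop d q q') σ
        (1 + total (fun M => roundTime d q q' * f M + (1 + roundTime d q q' * ((s + 1) * (m + 1)))) N)
        (risk p w φ s m q' l X N) (rounds N * roundError d k s m) := by
  induction N using Nat.strong_induction_on with
  | _ N ih =>
    intro l X σ hL hlN hq
    by_cases hlt : 0 < (l.map w).sum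
    · have hN : 0 < N := hlt.trans_le hlN
      rw [total_of_pos _ hN]
      set T' := 1 + total (fun M => roundTime d q q' * f M +
        (1 + roundTime d q q' * ((s + 1) * (m + 1)))) (7 * N / 8) with hT'
      have hreg : σ.reg zero < σ.reg tot := by
        rw [hL.data.zero, hL.tot]
        exact_mod_cast hlt
      rw [rounds_of_pos hN, mul_add s, mul_one] at hq
      have key := round_bound hd hp hk hφ hs hms hqd hqq hq' hL (by omega) hlt
        (g := best (roundLoop d q q') T' (risk p w φ s m q' l X N))
        (v := rounds (7 * N / 8) * roundError d k s m) ?_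
      · refine (Bound.loop_step hreg key).mono ?_ (fun _ => le_rfl) ?_
        · have h1 : l.length ≤ f N := (hlen l hL.nodup).trans (hf hlN)
          have := Nat.mul_le_mul_left (roundTime d q q') h1
          rw [mul_add (roundTime d q q')]
          omega
        · rw [rounds_of_pos hN]
          push_cast
          rw [add_mul, one_mul, add_comm]
      · intro τ l' X' hL' hX' hsub h7
        have hb := ih (7 * N / 8) (by omega) l' (X ++ X') τ hL' (by omega)
          (by rw [List.length_append, hX']; omega)
        -- If the round failed, its points may never be paid for, but the remaining loop still halts
        -- in a final state, and the risk there is at most one.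
        refine ⟨Bound.best_le (hb.le_one
          (ENNReal.mul_ne_top (ENNReal.natCast_ne_top _) (roundError_ne_top _ _ _ _))
          fun ρ hρ => ?_), fun hpay => Bound.best_le (hb.mono le_rfl (fun ρ => ?_) le_rfl)⟩
        · obtain ⟨Y, hY⟩ := exists_final hρ
          exact (risk_le (hY.step hN hs hX')).trans (ind_le_one _)
        · refine le_iInf₂ fun Y hY => (risk_le (hY.step hN hs hX')).trans ?_
          exact ind_le fun h => (ind_pos fun h' => h (hpay.trans h')).ge
    · have hl0 : l = [] := by
        cases l with
        | nil => rfl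
        | cons a l =>
          have := hw a
          simp only [List.map_cons, List.sum_cons] at hlt
          omega
      subst hl0
      have hreg : ¬ σ.reg zero < σ.reg tot := by
        rw [hL.data.zero, hL.tot]
        simp
      refine (Bound.loop_stop hreg _).mono (by omega) (fun _ => le_rfl) ?_
      refine (risk_le (Y := []) ⟨by rwa [List.append_nil], Nat.zero_le _,
        fun h => absurd rfl h⟩).trans ?_
      rw [ind_neg]
      · exact zero_le
      · exact not_not.2 fun c _ _ e _ _ h => h

/-! ## The price of the centers -/

/-- `Pays` is applied to the distances to the output itself, with nothing left to charge at the end.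
Multiplying `2 ^ e + 4` by the factor `2 ^ e` of the assignment gives `12` and `32`. -/
theorem isGoodCenters_of_pays {d n : ℕ} (hd : 1 ≤ d) {p : Fin n → Pt d} {w : Fin n → ℕ}
    {φ : ℕ → Fin n → Fin n} {k : ℕ}
    (hφ : ∀ e, ∀ C : Finset (Pt d), C.card = k →
      ∑ i, (w i : ℝ) * dist (p i) (p (φ e i)) ^ e ≤
        2 ^ e * ∑ i, (w i : ℝ) * Metric.infDist (p i) (C : Set (Pt d)) ^ e)
    {l Y : List (Fin n)} (hl : ∀ i, i ∈ l) (hY : Y ≠ []) (hpay : Pays p w φ l [] Y) {b : ℝ}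
    (hb : (Y.length : ℝ) ≤ b) {C : Finset (Pt d)} (hC : ∀ x, x ∈ C ↔ ∃ i ∈ Y, p i = x) :
    IsGoodCenters p w k b C := by
  classical
  have hCne : C.Nonempty := by
    obtain ⟨y, hy⟩ := List.exists_mem_of_ne_nil Y hY
    exact ⟨p y, (hC _).2 ⟨y, hy, rfl⟩⟩
  have hCcard : C.card ≤ Y.length := by
    have : C ⊆ Y.toFinset.image p := fun x hx => by
      obtain ⟨i, hi, rfl⟩ := (hC x).1 hx
      exact Finset.mem_image_of_mem _ (List.mem_toFinset.2 hi)
    exact (Finset.card_le_card this).trans (Finset.card_image_le.trans (List.toFinset_card_le _))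
  have hlu : l.toFinset = Finset.univ := by
    ext i
    simp [hl i]
  have key : ∀ e, 1 ≤ e → e ≤ 2 → ∀ C' : Finset (Pt d), C'.card = k →
      ∑ i, (w i : ℝ) * Metric.infDist (p i) (C : Set (Pt d)) ^ e ≤
        32 * ∑ i, (w i : ℝ) * Metric.infDist (p i) (C' : Set (Pt d)) ^ e := by
    intro e he1 he2 C' hC'
    have h1 := hpay (fun i => Metric.infDist (p i) (C : Set (Pt d)))
      (fun i => Metric.infDist_nonneg)
      (fun i x hx => Metric.infDist_le_dist_of_mem ((hC _).2 ⟨x, hx, rfl⟩)) e he1 he2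
      (Charged.empty w _ e _)
    rw [hlu] at h1
    have h2 := h1.cost_le fun i => dist_nonneg
    have h3 := hφ e C' hC'
    have h4 : 0 ≤ ∑ i, (w i : ℝ) * Metric.infDist (p i) (C' : Set (Pt d)) ^ e :=
      Finset.sum_nonneg fun i _ => mul_nonneg (Nat.cast_nonneg _)
        (pow_nonneg Metric.infDist_nonneg _)
    obtain rfl | rfl : e = 1 ∨ e = 2 := by omega
    · nlinarith
    · nlinarith
  -- As `d ≥ 1`, the space is infinite and sets of `k` centers exist; the lower bound for the
  -- infimum needs a nonempty family.
  have : Nonempty (Fin d) := ⟨⟨0, hd⟩⟩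
  have : Infinite (Pt d) := Module.Free.infinite ℝ (Pt d)
  obtain ⟨C₀, hC₀⟩ := Infinite.exists_subset_card_eq (Pt d) k
  have : Nonempty {C : Finset (Pt d) // C.card = k} := ⟨⟨C₀, hC₀⟩⟩
  have le32 : ∀ (x : ℝ) (F : {C : Finset (Pt d) // C.card = k} → ℝ), (∀ C, x ≤ 32 * F C) →
      x ≤ 32 * ⨅ C, F C := by
    intro x F h
    have : x / 32 ≤ ⨅ C, F C := le_ciInf fun C => by
      rw [div_le_iff₀ (by norm_num)]
      linarith [h C]
    linarith
  refine ⟨hCne, (Nat.cast_le.2 hCcard).trans hb, le32 _ _ fun C' => key 2 one_le_two le_rfl _ C'.2,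
    le32 _ _ fun C' => ?_⟩
  have := key 1 le_rfl one_le_two _ C'.2
  simp only [pow_one] at this
  exact this

/-! ## Preparation -/

/-- The points, their weights and the number of centers are in place. -/
structure Ready {d n : ℕ} (p : Fin n → Pt d) (w : Fin n → ℕ) (k : ℕ) (σ : State) : Prop where
  data : Data p w σ
  kk : σ.reg kk = k
  rest : ∀ a, n * (d + 1) ≤ a → σ.mem a = 0

def collectBody (d : ℕ) : Stmt :=
  put (nn * nat (d + 1) + ii) ii ;; assign tot (tot + ld (nn * nat d + ii)) ;;
  assign ii (ii + nat 1)

def collectInit : Stmt := assign tot (nat 0) ;; assign ii (nat 0)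

/-- Lists all points and computes their total weight. -/
def collect (d : ℕ) : Prog :=
  .seq collectInit.code (.loop ii.idx nn.idx (collectBody d).code)

theorem collect_runs {d n : ℕ} {p : Fin n → Pt d} {w : Fin n → ℕ} {σ : State} (hD : Data p w σ) :
    Runs (collect d) σ (((collectBody d).time + collectInit.time + 2) * (n + 1)) fun τ =>
      Fr [tot, ii] (Set.Ico (n * (d + 1)) (n * (d + 2))) σ τ ∧
        τ.reg tot = (((List.finRange n).map w).sum : ℕ) ∧
        Holds (n * (d + 1)) (List.finRange n) τ := by
  have hnd : n * (d + 2) = n * (d + 1) + n := by ring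
  have hnd1 : n * (d + 1) = n * d + n := by ring
  set I : ℕ → State → Prop := fun i τ =>
    Fr [tot, ii] (Set.Ico (n * (d + 1)) (n * (d + 2))) σ τ ∧ τ.reg ii = i ∧
      τ.reg tot = ((((List.finRange n).take i).map w).sum : ℕ) ∧
      ∀ t < i, t < n → τ.mem (n * (d + 1) + t) = (t : ℝ) with hI
  refine (Runs.for_init (N := n) I ?_ ?_ ?_).mono le_rfl ?_
  · rintro i τ ⟨h1, h2, h3⟩
    exact ⟨h2, (h1.reg _ (by decide)).trans hD.nn⟩
  · rintro i τ hi ⟨h1, h2, h3, h4⟩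
    refine Stmt.runs _ ?_
    have hDτ := hD.of_fr h1 (by decide) (by decide) fun a ha => ha.1
    have a1 : ⌊(n : ℝ) * ((d + 1 : ℕ) : ℝ) + (i : ℝ)⌋₊ = n * (d + 1) + i :=
      floor_of_eq (by push_cast; ring)
    have a2 : ⌊(n : ℝ) * (d : ℝ) + (i : ℝ)⌋₊ = n * d + i := floor_of_eq (by push_cast; ring)
    have a3 : τ.mem (n * d + i) = w ⟨i, hi⟩ := hDτ.wt ⟨i, hi⟩
    have hden : (collectBody d).den τ = ((τ.put (n * (d + 1) + i) i).set tot
        (((((List.finRange n).take (i + 1)).map w).sum : ℕ) : ℝ)).set ii ((i + 1 : ℕ) : ℝ) := by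
      have htake : (((List.finRange n).take (i + 1)).map w).sum =
          (((List.finRange n).take i).map w).sum + w ⟨i, hi⟩ := by
        rw [List.take_add_one, List.getElem?_eq_getElem (by simpa using hi), List.map_append,
          List.sum_append]
        simp
      simp only [collectBody, den, eval_add, eval_mul, eval_var, eval_nat, eval_ld, hDτ.nn, h2, a1,
        State.put_reg, State.put_mem, State.set_reg, reduceCtorEq, if_false, h3, a2, htake]
      rw [if_neg (by omega), a3]
      push_cast
      rfl
    rw [hden]
    refine ⟨h1.trans (R' := [tot, ii]) (M' := {n * (d + 1) + i}) ⟨fun y hy => ?_, fun b hb => ?_⟩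
      (List.Subset.refl _) (List.Subset.refl _) subset_rfl ?_, by simp, by simp, ?_⟩
    · simp only [List.mem_cons, List.not_mem_nil, or_false, not_or] at hy
      simp [hy]
    · simp only [Set.mem_singleton_iff] at hb
      simp [hb]
    · simp only [Set.singleton_subset_iff, Set.mem_Ico]
      omega
    · intro t ht htn
      simp only [State.set_mem, State.put_mem]
      by_cases hti : t = i
      · rw [hti, if_pos rfl]
      · rw [if_neg (by omega)]
        exact h4 t (by omega) htn
  · refine ⟨⟨fun y hy => ?_, fun _ _ => rfl⟩, by simp [collectInit, den], by simp [collectInit, den],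
      fun t ht => absurd ht (by omega)⟩
    simp only [List.mem_cons, List.not_mem_nil, or_false, not_or] at hy
    simp [collectInit, den, hy]
  · rintro τ ⟨h1, h2, h3, h4⟩
    refine ⟨h1, ?_, fun t ht => ?_⟩
    · rw [h3, List.take_of_length_le (by simp)]
    · have ht' : t < n := by simpa using ht
      rw [h4 t ht' ht']
      simp

def setupStmt (C₁ C₂ : ℕ) : Stmt :=
  assign lg (un .floor (un .log tot) + nat 1) ;; assign ss (nat C₁ * (kk * lg)) ;;
  assign mm (nat C₂ * lg) ;; assign cnt (nat 0) ;; assign na nn ;; assign rho (nat 1)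

/-- An integer slightly above the logarithm. -/
def logCeil (W : ℕ) : ℕ := ⌊Real.log W⌋₊ + 1

theorem setup_runs {d n : ℕ} {p : Fin n → Pt d} {w : Fin n → ℕ} {k : ℕ} {σ τ : State}
    (C₁ C₂ : ℕ) {q' W : ℕ} (hq' : d + 2 ≤ q') (hR : Ready p w k σ)
    (hτ : Fr [tot, ii] (Set.Ico (n * (d + 1)) (n * (d + 2))) σ τ ∧
        τ.reg tot = (((List.finRange n).map w).sum : ℕ) ∧
        Holds (n * (d + 1)) (List.finRange n) τ) (hW : ((List.finRange n).map w).sum = W) :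
    Runs (setupStmt C₁ C₂).code τ (setupStmt C₁ C₂).time fun ρ =>
      Live p w (C₁ * (k * logCeil W)) (C₂ * logCeil W) q' (List.finRange n) [] ρ ∧ ρ.reg kk = k ∧
        ρ.reg lg = logCeil W := by
  obtain ⟨h1, h2, h3⟩ := hτ
  refine Stmt.runs _ ?_
  have hDτ := hR.data.of_fr h1 (by decide) (by decide) fun a ha => ha.1
  have hk : τ.reg kk = k := (h1.reg _ (by decide)).trans hR.kk
  have hlog : ((⌊Real.log W⌋ : ℤ) : ℝ) + ((1 : ℕ) : ℝ) = (logCeil W : ℕ) := by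
    rw [logCeil, Nat.cast_add, natCast_floor_eq_intCast_floor (Real.log_natCast_nonneg W)]
  have hden : (setupStmt C₁ C₂).den τ = (((((τ.set lg (logCeil W)).set ss
      (C₁ * (k * logCeil W) : ℕ)).set mm (C₂ * logCeil W : ℕ)).set cnt (0 : ℕ)).set na n).set
        rho (1 : ℕ) := by
    simp only [setupStmt, den, eval_add, eval_mul, eval_var, eval_nat, eval_floor, eval_log, h2, hW,
      hlog, State.set_reg, reduceCtorEq, if_false, if_true, hk, hDτ.nn]
    push_cast
    rfl
  rw [hden]
  refine ⟨⟨⟨by simp [hDτ.nn], by simp [hDτ.zero], hDτ.pt, hDτ.wt⟩, by simp [h2], by simp, h3,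
    List.nodup_finRange n, by simp, by simp, by simp, fun t ht => absurd ht (by simp), ?_⟩,
    by simp [hk], by simp⟩
  intro a ha
  have h4 : n * (d + 2) ≤ a := (Nat.mul_le_mul_left n hq').trans ha
  have h5 : n * (d + 1) ≤ n * (d + 2) := Nat.mul_le_mul_left n (by omega)
  simp only [State.set_mem, State.set_reg, if_true]
  rw [h1.mem a fun hc => absurd hc.2 (by omega), hR.rest a (by omega)]
  norm_num

/-! ## The output -/

/-- The set of points in the output. -/
def result (d : ℕ) (τ : State) : Finset (Pt d) :=
  output d ⟨fun i => if i = 0 then τ.reg nn else τ.reg kk, τ.mem⟩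

theorem result_view (d : ℕ) (σ : Store) : result d σ.view = output d σ := rfl

theorem mem_result {d n : ℕ} {p : Fin n → Pt d} {τ : State} {Y : List (Fin n)} {a : ℕ}
    (h1 : τ.reg nn = Y.length) (h2 : τ.reg kk = a)
    (h3 : ∀ (i : ℕ) (hi : i < Y.length) (j : Fin d), τ.mem (a + (i * d + j)) = p Y[i] j)
    (x : Pt d) : x ∈ result d τ ↔ ∃ i ∈ Y, p i = x := by
  have h4 : ∀ (i : ℕ) (hi : i < Y.length),
      (WithLp.toLp 2 fun j : Fin d => τ.mem (a + (i * d + (j : ℕ)))) = p Y[i] := by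
    intro i hi
    ext j
    exact h3 i hi j
  simp only [result, output, if_true, if_neg one_ne_zero, h1, h2, Nat.floor_natCast,
    Finset.mem_image, Finset.mem_range]
  constructor
  · rintro ⟨i, hi, rfl⟩
    exact ⟨Y[i], List.getElem_mem hi, (h4 i hi).symm⟩
  · rintro ⟨y, hy, rfl⟩
    obtain ⟨i, hi, rfl⟩ := List.getElem_of_mem hy
    exact ⟨i, hi, h4 i hi⟩

def copyCoords (d q : ℕ) : ℕ → Stmt
  | 0 => skip
  | j + 1 => copyCoords d q j ;; put (nn * nat q + (ii * nat d + nat j)) (ld (pid * nat d + nat j))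

theorem copyCoords_den {d n : ℕ} {p : Fin n → Pt d} {w : Fin n → ℕ} {q i : ℕ} {a : Fin n}
    {σ : State} (hD : Data p w σ) (hq : d + 1 ≤ q) (ha : σ.reg pid = (a : ℕ)) (hi : σ.reg ii = i)
    (J : ℕ) (hJ : J ≤ d) :
    Fr [] (Set.Ico (n * q + i * d) (n * q + i * d + J)) σ ((copyCoords d q J).den σ) ∧
      ∀ (j : ℕ) (hj : j < J), ((copyCoords d q J).den σ).mem (n * q + (i * d + j)) =
        p a ⟨j, hj.trans_le hJ⟩ := by
  induction J with
  | zero => exact ⟨Fr.refl _ _ _, fun j hj => absurd hj (by omega)⟩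
  | succ J ih =>
    obtain ⟨h1, h2⟩ := ih (by omega)
    set τ := (copyCoords d q J).den σ with hτ
    have hDτ := hD.of_fr h1 (by simp) (by simp) fun b hb => by
      have := hb.1
      have := Nat.mul_le_mul_left n hq
      omega
    have a1 : ⌊(n : ℝ) * (q : ℝ) + ((i : ℝ) * (d : ℝ) + (J : ℝ))⌋₊ = n * q + (i * d + J) :=
      floor_of_eq (by push_cast; ring)
    have a2 : ⌊((a : ℕ) : ℝ) * (d : ℝ) + (J : ℝ)⌋₊ = a * d + J := floor_of_eq (by push_cast; ring)
    have a3 : τ.mem (a * d + J) = p a ⟨J, hJ⟩ := hDτ.pt a ⟨J, hJ⟩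
    have hden : (copyCoords d q (J + 1)).den σ = τ.put (n * q + (i * d + J)) (p a ⟨J, hJ⟩) := by
      simp only [copyCoords, den, ← hτ, eval_add, eval_mul, eval_var, eval_nat, eval_ld, hDτ.nn,
        h1.reg ii (by simp), hi, h1.reg pid (by simp), ha, a1, a2, a3]
    rw [hden]
    refine ⟨h1.trans (R' := []) (M' := {n * q + (i * d + J)}) ⟨fun y _ => rfl, fun b hb => ?_⟩
      (List.Subset.refl _) (List.Subset.refl _) (Set.Ico_subset_Ico_right (by omega)) ?_, ?_⟩
    · simp only [Set.mem_singleton_iff] at hb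
      simp [hb]
    · simp only [Set.singleton_subset_iff, Set.mem_Ico]
      omega
    · intro j hj
      rw [State.put_mem]
      by_cases hjJ : j = J
      · subst hjJ
        rw [if_pos rfl]
      · rw [if_neg (by omega)]
        exact h2 j (by omega)

def copyBody (d q : ℕ) : Stmt :=
  assign pid (ld (nn * nat (d + 2) + ii)) ;; copyCoords d q d ;; assign ii (ii + nat 1)

/-- Copies the centers to the output. -/
def copy (d q : ℕ) : Prog :=
  .seq (assign ii (nat 0)).code (.loop ii.idx cnt.idx (copyBody d q).code)

theorem copy_runs {d n : ℕ} {p : Fin n → Pt d} {w : Fin n → ℕ} {q : ℕ} {Y : List (Fin n)}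
    {σ : State} (hD : Data p w σ) (hq : d + 1 ≤ q) (hY : Holds (n * (d + 2)) Y σ)
    (hcnt : σ.reg cnt = Y.length) (hYq : n * (d + 2) + Y.length ≤ n * q) :
    Runs (copy d q) σ (((copyBody d q).time + (assign ii (nat 0)).time + 2) * (Y.length + 1))
      fun τ => Fr [pid, ii] (Set.Ici (n * q)) σ τ ∧
        ∀ (i : ℕ) (hi : i < Y.length) (j : Fin d), τ.mem (n * q + (i * d + j)) = p Y[i] j := by
  have hnq := Nat.mul_le_mul_left n hq
  set I : ℕ → State → Prop := fun i τ => Fr [pid, ii] (Set.Ici (n * q)) σ τ ∧ τ.reg ii = i ∧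
    ∀ (t : ℕ) (ht : t < Y.length), t < i → ∀ j : Fin d, τ.mem (n * q + (t * d + j)) = p Y[t] j
    with hI
  refine (Runs.for_init (N := Y.length) I ?_ ?_ ?_).mono le_rfl ?_
  · rintro i τ ⟨h1, h2, h3⟩
    exact ⟨h2, (h1.reg _ (by decide)).trans hcnt⟩
  · rintro i τ hi ⟨h1, h2, h3⟩
    refine Stmt.runs _ ?_
    have hDτ := hD.of_fr h1 (by decide) (by decide) fun a ha => hnq.trans ha
    have a1 : ⌊(n : ℝ) * ((d + 2 : ℕ) : ℝ) + (i : ℝ)⌋₊ = n * (d + 2) + i :=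
      floor_of_eq (by push_cast; ring)
    have a2 : τ.mem (n * (d + 2) + i) = (Y[i] : ℕ) := by
      rw [h1.mem _ (by simp; omega)]
      exact hY i hi
    set τ₁ := τ.set pid ((Y[i] : ℕ) : ℝ) with hτ₁
    have f1 : Fr [pid] ∅ τ τ₁ := ⟨fun y hy => by
      simp only [List.mem_singleton] at hy
      simp [hτ₁, hy], fun _ _ => rfl⟩
    have hD₁ := hDτ.of_fr f1 (by decide) (by decide) (by simp)
    obtain ⟨g1, g2⟩ := copyCoords_den (a := Y[i]) (i := i) hD₁ hq (by simp [hτ₁])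
      ((f1.reg ii (by decide)).trans h2) d le_rfl
    have hden : (copyBody d q).den τ = ((copyCoords d q d).den τ₁).set ii ((i + 1 : ℕ) : ℝ) := by
      have h5 : ((copyCoords d q d).den τ₁).reg ii = i := by
        rw [g1.reg _ (by simp), f1.reg _ (by decide), h2]
      simp only [copyBody, den, eval_ld, eval_add, eval_mul, eval_var, eval_nat, hDτ.nn, h2, a1, a2,
        ← hτ₁, h5]
      push_cast
      rfl
    rw [hden]
    have F : Fr [pid, ii] (Set.Ici (n * q)) σ ((copyCoords d q d).den τ₁) :=
      (h1.trans f1 (List.Subset.refl _) (by decide) subset_rfl (Set.empty_subset _)).trans g1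
        (List.Subset.refl _) (by simp) subset_rfl fun a ha => by
          have := ha.1
          rw [Set.mem_Ici]
          omega
    refine ⟨F.trans (R' := [ii]) (M' := ∅) ⟨fun y hy => ?_, fun _ _ => rfl⟩
      (List.Subset.refl _) (by decide) subset_rfl (Set.empty_subset _), by simp, ?_⟩
    · simp only [List.mem_singleton] at hy
      simp [hy]
    · intro t ht hti j
      rw [State.set_mem]
      by_cases h : t = i
      · subst h
        exact g2 j j.2
      · rw [g1.mem _ fun hc => ?_]
        · exact h3 t ht (by omega) j
        · have h6 := hc.1
          have h7 : (t + 1) * d ≤ i * d := Nat.mul_le_mul_right _ (by omega)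
          have h8 := j.2
          rw [add_mul] at h7
          omega
  · refine ⟨⟨fun y hy => ?_, fun _ _ => rfl⟩, by simp [den], fun t ht hti => absurd hti (by omega)⟩
    simp only [List.mem_cons, List.not_mem_nil, or_false, not_or] at hy
    simp [den, hy]
  · rintro τ ⟨h1, h2, h3⟩
    exact ⟨h1, fun i hi => h3 i hi hi⟩

def returnStmt (q : ℕ) : Stmt := assign kk (nn * nat q) ;; assign nn cnt

theorem return_runs {d n : ℕ} {p : Fin n → Pt d} {w : Fin n → ℕ} {q : ℕ} {Y : List (Fin n)}
    {σ : State} (hD : Data p w σ) (hq : d + 1 ≤ q) (hY : Holds (n * (d + 2)) Y σ)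
    (hcnt : σ.reg cnt = Y.length) (hYq : n * (d + 2) + Y.length ≤ n * q) :
    Runs (.seq (copy d q) (returnStmt q).code) σ
      (1 + ((copyBody d q).time + (assign ii (nat 0)).time + 2) * (Y.length + 1) +
        (returnStmt q).time)
      fun τ => ∀ x, x ∈ result d τ ↔ ∃ i ∈ Y, p i = x := by
  refine (copy_runs hD hq hY hcnt hYq).seq ?_
  rintro τ ⟨h1, h2⟩
  refine Stmt.runs _ ?_
  have hden : (returnStmt q).den τ = (τ.set kk (n * q : ℕ)).set nn Y.length := by
    simp only [returnStmt, den, eval_mul, eval_var, eval_nat, State.set_reg, reduceCtorEq, if_false,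
      h1.reg nn (by decide), hD.nn, h1.reg cnt (by decide), hcnt]
    push_cast
    rfl
  rw [hden]
  exact mem_result (a := n * q) (by simp) (by simp) fun i hi j => h2 i hi j

/-! ## The clustering algorithm -/

/-- The factor in the size of the samples. -/
def sampleRate (d N₀ : ℕ) : ℕ := N₀ * (1024 * d ^ 2) ^ 2

/-- The segment of the memory that holds the test sample. -/
def testSeg (d N₀ : ℕ) : ℕ := d + 2 + (9 * sampleRate d N₀ + 2)

/-- The segment of the memory from which on the cells of the grids are. -/
def markSeg (d N₀ : ℕ) : ℕ := testSeg d N₀ + (9 * sampleRate d N₀ + 2)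

def guardE : Expr := kk * (lg * (lg * lg))

def mainPart (d N₀ : ℕ) : Prog :=
  .seq (roundLoop d (testSeg d N₀) (markSeg d N₀))
    (.seq (copy d (testSeg d N₀)) (returnStmt (testSeg d N₀)).code)

/-- The algorithm for weighted points. -/
def cluster (d N₀ : ℕ) : Prog :=
  .seq (collect d) (.seq (setupStmt (sampleRate d N₀) (4 * N₀)).code
    (branch guardE nn (mainPart d N₀) (assign kk (nat 0)).code))

theorem log_lt_logCeil (W : ℕ) : Real.log W < logCeil W := by
  rw [logCeil, Nat.cast_add, Nat.cast_one]
  exact Nat.lt_floor_add_one _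

theorem one_le_logCeil (W : ℕ) : 1 ≤ logCeil W := Nat.le_add_left _ _

theorem rounds_le_logCeil {W : ℕ} (hW : 1 ≤ W) : rounds W ≤ 9 * logCeil W := by
  have h1 := rounds_le hW
  have h2 := log_lt_logCeil W
  have h3 : (1 : ℝ) ≤ logCeil W := by exact_mod_cast one_le_logCeil W
  have : (rounds W : ℝ) ≤ (9 * logCeil W : ℕ) := by
    push_cast
    linarith
  exact_mod_cast this

/-- The sample sizes are chosen to make all exponents equal to `N₀ * L`. -/
theorem roundError_eq {d : ℕ} (hd : 1 ≤ d) {k : ℕ} (hk : 1 ≤ k) (N₀ L : ℕ) :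
    roundError d k (sampleRate d N₀ * (k * L)) (4 * N₀ * L) =
      ENNReal.ofReal ((2 * k + 2) * Real.exp (-(N₀ * L))) := by
  have hd0 : (d : ℝ) ≠ 0 := by positivity
  have hk0 : (k : ℝ) ≠ 0 := by positivity
  have h1 : ((sampleRate d N₀ * (k * L) : ℕ) : ℝ) * hitRate d ^ 2 / k = N₀ * L := by
    rw [sampleRate, hitRate]
    push_cast
    field_simp
  have h2 : ((4 * N₀ * L : ℕ) : ℝ) / 4 = N₀ * L := by
    push_cast
    ring
  have h0 := (Real.exp_pos (-((N₀ : ℝ) * L))).le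
  rw [roundError, h1, h2, ← ENNReal.ofReal_natCast k, ← ENNReal.ofReal_mul (Nat.cast_nonneg _),
    ← ENNReal.ofReal_add (by positivity) (by positivity), ← ENNReal.ofReal_add h0 h0,
    ← ENNReal.ofReal_add (by positivity) (by positivity)]
  congr 1
  ring

/-- There are at most `8 * W` rounds, each failing with probability at most `2 * W * W ^ (-N₀)`. The
factor `16 * W ^ 2` is at most `W ^ 6` for `W ≥ 2`, which explains the margin `6` in the choice of
`N₀`. -/
theorem failure_le {d : ℕ} (hd : 1 ≤ d) {k N₀ W : ℕ} (hk : 1 ≤ k) (hW : 2 ≤ W) (hkW : k + 1 ≤ W)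
    {c : ℝ} (hc : c + 6 ≤ N₀) :
    rounds W * roundError d k (sampleRate d N₀ * (k * logCeil W)) (4 * N₀ * logCeil W) ≤
      ENNReal.ofReal ((W : ℝ) ^ (-c)) := by
  have hW0 : (0 : ℝ) < W := by positivity
  have hW2 : (2 : ℝ) ≤ W := by exact_mod_cast hW
  rw [roundError_eq hd hk, ← ENNReal.ofReal_natCast, ← ENNReal.ofReal_mul (Nat.cast_nonneg _)]
  refine ENNReal.ofReal_le_ofReal ?_
  have h1 : (rounds W : ℝ) ≤ 8 * W := by
    have := rounds_le (by omega : 1 ≤ W)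
    have := Real.log_le_sub_one_of_pos hW0
    linarith
  have h2 : (2 * k + 2 : ℝ) ≤ 2 * W := by exact_mod_cast (by omega : 2 * k + 2 ≤ 2 * W)
  have h3 : Real.exp (-((N₀ : ℝ) * logCeil W)) ≤ (W : ℝ) ^ (-(N₀ : ℝ)) := by
    rw [Real.rpow_def_of_pos hW0]
    refine Real.exp_le_exp.2 ?_
    have := mul_le_mul_of_nonneg_left (log_lt_logCeil W).le (Nat.cast_nonneg (α := ℝ) N₀)
    linarith
  have h4 : (8 * W * (2 * W) : ℝ) ≤ (W : ℝ) ^ (6 : ℝ) := by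
    have h5 : (2 : ℝ) ^ 4 ≤ (W : ℝ) ^ 4 := pow_le_pow_left₀ (by norm_num) hW2 4
    rw [show (6 : ℝ) = (6 : ℕ) by norm_num, Real.rpow_natCast]
    nlinarith [sq_nonneg (W : ℝ)]
  calc (rounds W : ℝ) * ((2 * k + 2) * Real.exp (-(N₀ * logCeil W)))
      ≤ 8 * W * (2 * W * (W : ℝ) ^ (-(N₀ : ℝ))) := by gcongr
    _ = 8 * W * (2 * W) * (W : ℝ) ^ (-(N₀ : ℝ)) := by ring
    _ ≤ (W : ℝ) ^ (6 : ℝ) * (W : ℝ) ^ (-(N₀ : ℝ)) := by gcongr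
    _ = (W : ℝ) ^ (6 + -(N₀ : ℝ)) := (Real.rpow_add hW0 _ _).symm
    _ ≤ (W : ℝ) ^ (-c) := Real.rpow_le_rpow_of_exponent_le (by linarith) (by linarith)

def loopTime (d N₀ : ℕ) : ℕ :=
  roundTime d (testSeg d N₀) (markSeg d N₀) +
    9 * (1 + roundTime d (testSeg d N₀) (markSeg d N₀) *
      ((sampleRate d N₀ + 1) * (4 * N₀ + 1)))

/-- Besides the work on alive points, a round costs order `k * L ^ 2`; over at most `9 * L` rounds
this is order `k * L ^ 3`, which is below a multiple of `n` by the guard. -/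
theorem loopTime_bound (d N₀ : ℕ) (f : ℕ → ℕ) {n k W : ℕ} (hW : 1 ≤ W) (hk : 1 ≤ k)
    (h : k * logCeil W ^ 3 < n) :
    total (fun M => roundTime d (testSeg d N₀) (markSeg d N₀) * f M +
      (1 + roundTime d (testSeg d N₀) (markSeg d N₀) *
        ((sampleRate d N₀ * (k * logCeil W) + 1) * (4 * N₀ * logCeil W + 1)))) W ≤
      loopTime d N₀ * (n + total f W) := by
  set L := logCeil W with hL
  set R := roundTime d (testSeg d N₀) (markSeg d N₀) with hR
  set S := sampleRate d N₀ with hS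
  have hL1 : 1 ≤ L := one_le_logCeil W
  have hr : rounds W ≤ 9 * L := rounds_le_logCeil hW
  rw [total_linear, ← rounds, loopTime]
  have hkL : 1 ≤ k * L := Nat.mul_pos hk hL1
  have h1 : (S * (k * L) + 1) * (4 * N₀ * L + 1) ≤ (S + 1) * (4 * N₀ + 1) * (k * L * L) := by
    calc (S * (k * L) + 1) * (4 * N₀ * L + 1) ≤ ((S + 1) * (k * L)) * ((4 * N₀ + 1) * L) :=
          Nat.mul_le_mul (by nlinarith) (by nlinarith)
      _ = _ := by ring
  have hkLL : 1 ≤ k * L * L := Nat.mul_pos hkL hL1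
  have h2 : (1 + R * ((S * (k * L) + 1) * (4 * N₀ * L + 1))) ≤
      (1 + R * ((S + 1) * (4 * N₀ + 1))) * (k * L * L) := by
    have := Nat.mul_le_mul_left R h1
    calc _ ≤ k * L * L + R * ((S + 1) * (4 * N₀ + 1) * (k * L * L)) := Nat.add_le_add hkLL this
      _ = _ := by ring
  have h3 : (1 + R * ((S * (k * L) + 1) * (4 * N₀ * L + 1))) * rounds W ≤
      9 * (1 + R * ((S + 1) * (4 * N₀ + 1))) * n := by
    calc _ ≤ (1 + R * ((S + 1) * (4 * N₀ + 1))) * (k * L * L) * (9 * L) := Nat.mul_le_mul h2 hr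
      _ = 9 * (1 + R * ((S + 1) * (4 * N₀ + 1))) * (k * L ^ 3) := by ring
      _ ≤ _ := Nat.mul_le_mul_left _ h.le
  calc R * total f W + (1 + R * ((S * (k * L) + 1) * (4 * N₀ * L + 1))) * rounds W
      ≤ R * total f W + 9 * (1 + R * ((S + 1) * (4 * N₀ + 1))) * n := Nat.add_le_add_left h3 _
    _ ≤ _ := by
      rw [add_mul, mul_add, mul_add]
      have h4 := Nat.zero_le (R * n)
      have h5 := Nat.zero_le (9 * (1 + R * ((S + 1) * (4 * N₀ + 1))) * total f W)
      linarith

def copyTime (d N₀ : ℕ) : ℕ :=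
  (copyBody d (testSeg d N₀)).time + (assign ii (nat 0)).time + 2

def clusterTime (d N₀ : ℕ) : ℕ :=
  9 + 2 * ((collectBody d).time + collectInit.time + 2) +
    (setupStmt (sampleRate d N₀) (4 * N₀)).time + guardE.time + loopTime d N₀ +
    copyTime d N₀ * (9 * sampleRate d N₀ + 1) + (returnStmt (testSeg d N₀)).time +
    (assign kk (nat 0)).time

/-- The guard `k * L ^ 3 < n` does three things: it makes the overhead of the rounds linear in `n`,
lets the centers fit into a memory segment of length proportional to `n`, and yields `k + 1 ≤ W` for
the failure bound. If it fails, the input itself is a small enough set of centers. -/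
theorem cluster_bound {d n : ℕ} (hd : 1 ≤ d) {p : Fin n → Pt d} (hp : Function.Injective p)
    {w : Fin n → ℕ} (hw : ∀ i, 1 ≤ w i) {k N₀ W : ℕ} (hk : 1 ≤ k) (hN₀ : 1 ≤ N₀)
    (hW : ∑ i, w i = W) (hW2 : 2 ≤ W) {c : ℝ} (hc : c + 6 ≤ N₀) {f : ℕ → ℕ} (hf : Monotone f)
    (hlen : ∀ l : List (Fin n), l.Nodup → l.length ≤ f (l.map w).sum) {b : ℝ}
    (hb : (9 * sampleRate d N₀ + 1 : ℝ) * (k * logCeil W ^ 3) ≤ b) {σ : State}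
    (hσ : Ready p w k σ) :
    Bound (cluster d N₀) σ (clusterTime d N₀ * (n + total f W))
      (fun τ => ind (¬ IsGoodCenters p w k b (result d τ))) (ENNReal.ofReal ((W : ℝ) ^ (-c))) := by
  set L := logCeil W with hL
  set S := sampleRate d N₀ with hS
  set q := testSeg d N₀ with hq
  set q' := markSeg d N₀ with hq'
  have hL1 : 1 ≤ L := one_le_logCeil W
  have hW' : ((List.finRange n).map w).sum = W := by
    rw [← hW, ← List.sum_ofFn, List.ofFn_eq_map]
  have hnW : n ≤ W := by
    rw [← hW]
    calc n = ∑ _i : Fin n, 1 := by simp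
      _ ≤ _ := Finset.sum_le_sum fun i _ => hw i
  have hn : 1 ≤ n := by
    rcases Nat.eq_zero_or_pos n with rfl | h
    · simp at hW
      omega
    · exact h
  have hS1 : 4 * N₀ ≤ S := by
    have h1 : 1024 ≤ 1024 * d ^ 2 := Nat.le_mul_of_pos_right _ (Nat.pow_pos hd)
    have h2 := Nat.pow_le_pow_left h1 2
    rw [hS, sampleRate, mul_comm]
    exact Nat.mul_le_mul_left _ (by omega)
  have hqd : d + 2 ≤ q := Nat.le_add_right _ _
  have hqq : q ≤ q' := Nat.le_add_right _ _
  have hnq : n * q = n * (d + 2) + (9 * (S * n) + 2 * n) := by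
    rw [hq, testSeg]
    ring
  have hnq' : n * q' = n * q + (9 * (S * n) + 2 * n) := by
    rw [hq', markSeg]
    ring
  choose φ hφ1 hφ2 using fun e => exists_assignment p w hk e
  set T₂ := if k * L ^ 3 < n then 1 + (1 + loopTime d N₀ * (n + total f W)) +
    (1 + copyTime d N₀ * (9 * S * n + 1) + (returnStmt q).time) else (assign kk (nat 0)).time
    with hT₂
  refine Bound.mono (Runs.seq_bound (collect_runs hσ.data) fun σ₁ hσ₁ =>
    Runs.seq_bound (setup_runs S (4 * N₀) (hqd.trans hqq) hσ hσ₁ hW') fun σ₂ hσ₂ =>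
    branch_bound (T := T₂) (fun hlt => ?_) fun hlt => ?_) ?_ (fun _ => le_rfl) le_rfl
  · obtain ⟨hlive, hk2, hlg⟩ := hσ₂
    have hlt' : k * L ^ 3 < n := by
      simp only [guardE, eval_mul, eval_var, hk2, hlg, hlive.data.nn] at hlt
      have : ((k * L ^ 3 : ℕ) : ℝ) < n := by
        push_cast
        rw [show (L : ℝ) ^ 3 = L * (L * L) by ring]
        exact hlt
      exact_mod_cast this
    have hLn : L ≤ k * L ^ 3 := by
      calc L = 1 * L ^ 1 := by ring
        _ ≤ _ := Nat.mul_le_mul hk (Nat.pow_le_pow_right hL1 (by norm_num))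
    have hr : rounds W ≤ 9 * L := rounds_le_logCeil (by omega)
    have hsr : S * (k * L) * rounds W ≤ 9 * S * (k * L ^ 3) := by
      calc S * (k * L) * rounds W ≤ S * (k * L) * (9 * L) := Nat.mul_le_mul_left _ hr
        _ = 9 * S * (k * L ^ 2) := by ring
        _ ≤ _ := Nat.mul_le_mul_left _
          (Nat.mul_le_mul_left _ (Nat.pow_le_pow_right hL1 (by norm_num)))
    have hsn : 9 * S * (k * L ^ 3) ≤ 9 * S * n := Nat.mul_le_mul_left _ hlt'.le
    have hkn : k ≤ k * L ^ 3 := Nat.le_mul_of_pos_right _ (by positivity)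
    have hm : 4 * N₀ * L ≤ S * n := Nat.mul_le_mul hS1 (hLn.trans hlt'.le)
    rw [hT₂, if_pos hlt']
    refine Bound.seq_best (Bound.mono (roundLoop_bound hd hp hw hk hφ1 (s := S * (k * L))
      (m := 4 * N₀ * L) ?_ ?_ hqd hqq ?_ hf hlen W _ [] σ₂ hlive hW'.le ?_)
      (Nat.add_le_add_left (loopTime_bound d N₀ f (by omega) hk hlt') _) (fun τ => ?_)
      (failure_le hd hk hW2 (by omega) hc))
    · exact Nat.mul_pos (by omega) (Nat.mul_pos hk hL1)
    · exact Nat.mul_le_mul hS1 (Nat.le_mul_of_pos_left _ hk)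
    · have : n * q + 4 * N₀ * L + 1 ≤ n * q + (9 * (S * n) + 2 * n) := by omega
      exact this.trans hnq'.ge
    · rw [hnq, List.length_nil]
      have : 9 * S * n = 9 * (S * n) := by ring
      omega
    · refine le_iInf₂ fun Y hY => Bound.best_le (Bound.mono (Runs.bound (return_runs (q := q)
        (Y := Y) hY.live.data (by omega) hY.live.cent hY.live.cnt ?_) fun ρ hρ => ?_) ?_
        (fun _ => le_rfl) le_rfl)
      · have := hY.length_le.trans (hsr.trans hsn)
        rw [hnq]
        have h9 : 9 * S * n = 9 * (S * n) := by ring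
        omega
      · refine ind_le fun h => (ind_pos fun hpay => h ?_).ge
        refine isGoodCenters_of_pays hd hφ2 (fun i => List.mem_finRange i) (hY.ne_nil fun h => ?_)
          hpay (le_trans ?_ hb) hρ
        · have := congrArg List.length h
          simp only [List.length_finRange, List.length_nil] at this
          omega
        · have h1 : Y.length ≤ (9 * S + 1) * (k * L ^ 3) :=
            (hY.length_le.trans hsr).trans (Nat.mul_le_mul_right _ (Nat.le_succ _))
          exact_mod_cast h1
      · have := Nat.mul_le_mul_left (copyTime d N₀)
          (Nat.succ_le_succ (hY.length_le.trans (hsr.trans hsn)))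
        exact Nat.add_le_add_right (Nat.add_le_add_left this 1) _
  · obtain ⟨hlive, hk2, hlg⟩ := hσ₂
    have hlt' : ¬ k * L ^ 3 < n := by
      intro h
      apply hlt
      simp only [guardE, eval_mul, eval_var, hk2, hlg, hlive.data.nn]
      rw [show (L : ℝ) * (L * L) = L ^ 3 by ring]
      exact_mod_cast h
    rw [hT₂, if_neg hlt']
    refine Runs.bound (Stmt.runs (Q := fun τ => IsGoodCenters p w k b (result d τ)) _ ?_)
      fun τ hτ => by rw [ind_neg (not_not.2 hτ)]; exact zero_le
    -- Every point is a center here, so all costs vanish and no charge is needed. The output address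
    -- is `0`, where the input coordinates are.
    refine isGoodCenters_of_pays (Y := List.finRange n) hd hφ2 (fun i => List.mem_finRange i)
      (fun h => ?_) ?_ (le_trans ?_ hb)
      (mem_result (a := 0) (by simp [den, hlive.data.nn]) (by simp [den]) fun i hi j => ?_)
    · have := congrArg List.length h
      simp only [List.length_finRange, List.length_nil] at this
      omega
    · intro c hc0 hc e he1 he2 _
      have hc' : ∀ i, c i = 0 := fun i =>
        le_antisymm ((hc i i (List.mem_finRange i)).trans_eq (dist_self _)) (hc0 i)
      refine ⟨0, fun i _ => ⟨le_rfl, Nat.cast_nonneg _⟩, ?_, ?_⟩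
      · simp only [Pi.zero_apply, Finset.sum_const_zero]
        positivity
      · simp only [hc', zero_pow (by omega : e ≠ 0), mul_zero, Finset.sum_const_zero, Pi.zero_apply,
          zero_mul, add_zero]
        positivity
    · have h1 : n ≤ (9 * S + 1) * (k * L ^ 3) :=
        (not_lt.1 hlt').trans (Nat.le_mul_of_pos_left _ (Nat.succ_pos _))
      rw [List.length_finRange]
      exact_mod_cast h1
    · have := hlive.data.pt ((List.finRange n)[i]) j
      simpa [den] using this
  · set Z := n + total f W with hZ
    have hnZ : n ≤ Z := Nat.le_add_right _ _
    have hconst : ∀ x : ℕ, x ≤ x * Z := fun x => Nat.le_mul_of_pos_right _ (hn.trans hnZ)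
    have h1 : ((collectBody d).time + collectInit.time + 2) * (n + 1) ≤
        2 * ((collectBody d).time + collectInit.time + 2) * Z := by
      rw [mul_comm 2, mul_assoc]
      exact Nat.mul_le_mul_left _ (by omega)
    have h2 : copyTime d N₀ * (9 * S * n + 1) ≤ copyTime d N₀ * (9 * S + 1) * Z := by
      have := Nat.mul_le_mul_left (9 * S) hnZ
      calc _ ≤ copyTime d N₀ * ((9 * S + 1) * Z) := Nat.mul_le_mul_left _ (by
            rw [add_mul (9 * S), one_mul]
            omega)
        _ = _ := (mul_assoc _ _ _).symm
    have h3 : T₂ ≤ 3 + loopTime d N₀ * Z + copyTime d N₀ * (9 * S + 1) * Z + (returnStmt q).time +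
        (assign kk (nat 0)).time := by
      rw [hT₂]
      split_ifs <;> omega
    have h4 := hconst ((setupStmt S (4 * N₀)).time + guardE.time + (returnStmt q).time +
      (assign kk (nat 0)).time + 9)
    have h5 : (Expr.var nn).time = 1 := rfl
    have h6 : clusterTime d N₀ * Z = 2 * ((collectBody d).time + collectInit.time + 2) * Z +
        loopTime d N₀ * Z + copyTime d N₀ * (9 * S + 1) * Z +
        ((setupStmt S (4 * N₀)).time + guardE.time + (returnStmt q).time +
          (assign kk (nat 0)).time + 9) * Z := by
      rw [clusterTime]
      ring
    rw [h6, h5]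
    linarith

/-! ## Input and running time -/

theorem inputMem_pt {d n : ℕ} (p : Fin n → Pt d) (v : Fin n → ℝ) (i : Fin n) (j : Fin d) :
    inputMem p v (i * d + j) = p i j := by
  have hd : 0 < d := j.pos
  have h : (i : ℕ) * d + j < n * d := by
    have h1 : ((i : ℕ) + 1) * d ≤ n * d := Nat.mul_le_mul_right _ i.2
    have h2 := j.2
    rw [add_mul] at h1
    omega
  have h1 : ((i : ℕ) * d + j) / d = i := by
    rw [mul_comm, Nat.mul_add_div hd, Nat.div_eq_of_lt j.2, add_zero]
  have h2 : ((i : ℕ) * d + j) % d = j := by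
    rw [mul_comm, Nat.mul_add_mod, Nat.mod_eq_of_lt j.2]
  rw [inputMem, dif_pos h]
  simp only [h1, h2]

theorem inputMem_wt {d n : ℕ} (p : Fin n → Pt d) (v : Fin n → ℝ) (i : Fin n) :
    inputMem p v (n * d + i) = v i := by
  have h : n * d + (i : ℕ) - n * d = i := by omega
  rw [inputMem, dif_neg (by omega), dif_pos (by rw [h]; exact i.2)]
  congr 1
  exact Fin.ext h

theorem inputMem_rest {d n : ℕ} (p : Fin n → Pt d) (v : Fin n → ℝ) {a : ℕ}
    (ha : n * (d + 1) ≤ a) : inputMem p v a = 0 := by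
  rw [mul_add, mul_one] at ha
  rw [inputMem, dif_neg (by omega), dif_neg (by omega)]

theorem ready_weightedInput {d n : ℕ} (p : Fin n → Pt d) (w : Fin n → ℕ) (k : ℕ) :
    Ready p w k (weightedInput k p w).view :=
  ⟨⟨rfl, rfl, inputMem_pt p fun i => (w i : ℝ), inputMem_wt p fun i => (w i : ℝ)⟩, rfl,
    fun _ => inputMem_rest p fun i => (w i : ℝ)⟩

def unitBody (d : ℕ) : Stmt := put (nn * nat d + ii) (nat 1) ;; assign ii (ii + nat 1)

/-- Gives all points the weight one. -/
def unitWeights (d : ℕ) : Prog :=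
  .seq (assign ii (nat 0)).code (.loop ii.idx nn.idx (unitBody d).code)

theorem unitWeights_runs {d n : ℕ} (p : Fin n → Pt d) (k : ℕ) :
    Runs (unitWeights d) (input k p).view
      (((unitBody d).time + (assign ii (nat 0)).time + 2) * (n + 1)) (Ready p (fun _ => 1) k) := by
  set σ := (input k p).view with hσ
  set I : ℕ → State → Prop := fun i τ => Fr [ii] (Set.Ico (n * d) (n * d + n)) σ τ ∧ τ.reg ii = i ∧
    ∀ t < i, τ.mem (n * d + t) = 1 with hI
  have hn : σ.reg nn = n := rfl
  refine (Runs.for_init (N := n) I ?_ ?_ ?_).mono le_rfl ?_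
  · rintro i τ ⟨h1, h2, h3⟩
    exact ⟨h2, (h1.reg _ (by decide)).trans hn⟩
  · rintro i τ hi ⟨h1, h2, h3⟩
    refine Stmt.runs _ ?_
    have a1 : ⌊(n : ℝ) * (d : ℝ) + (i : ℝ)⌋₊ = n * d + i := floor_of_eq (by push_cast; ring)
    have hden : (unitBody d).den τ = (τ.put (n * d + i) (1 : ℕ)).set ii ((i + 1 : ℕ) : ℝ) := by
      simp only [unitBody, den, eval_add, eval_mul, eval_var, eval_nat, h1.reg nn (by decide), hn,
        h2, a1, State.put_reg]
      push_cast
      rfl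
    rw [hden]
    refine ⟨h1.trans (R' := [ii]) (M' := {n * d + i}) ⟨fun y hy => ?_, fun b hb => ?_⟩
      (List.Subset.refl _) (List.Subset.refl _) subset_rfl ?_, by simp, fun t ht => ?_⟩
    · simp only [List.mem_singleton] at hy
      simp [hy]
    · simp only [Set.mem_singleton_iff] at hb
      simp [hb]
    · simp only [Set.singleton_subset_iff, Set.mem_Ico]
      omega
    · simp only [State.set_mem, State.put_mem]
      by_cases hti : t = i
      · simp [hti]
      · rw [if_neg (by omega)]
        exact h3 t (by omega)
  · refine ⟨⟨fun y hy => ?_, fun _ _ => rfl⟩, by simp [den], fun t ht => absurd ht (by omega)⟩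
    simp only [List.mem_singleton] at hy
    simp [den, hy]
  · rintro τ ⟨h1, h2, h3⟩
    refine ⟨⟨(h1.reg _ (by decide)).trans hn, (h1.reg _ (by decide)).trans rfl, fun i j => ?_,
      fun i => (h3 i i.2).trans Nat.cast_one.symm⟩, (h1.reg _ (by decide)).trans rfl, fun a ha => ?_⟩
    · have h : (i : ℕ) * d + j < n * d := by
        have h1 : ((i : ℕ) + 1) * d ≤ n * d := Nat.mul_le_mul_right _ i.2
        have h2 := j.2
        rw [add_mul] at h1
        omega
      rw [h1.mem _ fun hc => absurd hc.1 (by omega)]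
      exact inputMem_pt p (fun _ => 0) i j
    · have h : n * d + n ≤ a := by rwa [mul_add, mul_one] at ha
      rw [h1.mem _ fun hc => absurd hc.2 (by omega)]
      exact inputMem_rest p (fun _ => 0) ha

theorem Bound.haltProb_and_time {P : Prog} {d : ℕ} {σ : Store} {T : ℕ} {Q : Finset (Pt d) → Prop}
    {δ : ℝ} (h : Bound P σ.view T (fun τ => ind (¬ Q (result d τ))) (ENNReal.ofReal δ))
    (hδ : 0 ≤ δ) :
    ENNReal.ofReal (1 - δ) ≤ haltProb P σ (fun τ => Q (output d τ)) ∧ expectedTime P σ ≤ T := by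
  classical
  have h1 := h σ rfl
  refine ⟨?_, expectedTime_le (ne_top_of_le_ne_top ENNReal.ofReal_ne_top h1)⟩
  rw [ENNReal.ofReal_sub _ hδ, ENNReal.ofReal_one]
  refine le_haltProb (le_trans (wp_mono _ _ fun τ => ?_) h1)
  simp only [result_view]
  split_ifs with hq
  · exact zero_le
  · exact (ind_pos hq).ge

theorem logCeil_le {W : ℕ} (hW : 2 ≤ W) :
    (logCeil W : ℝ) ≤ (1 + 1 / Real.log 2) * Real.log W := by
  have h0 : 0 < Real.log 2 := Real.log_pos one_lt_two
  have h1 : Real.log 2 ≤ Real.log W := Real.log_le_log two_pos (by exact_mod_cast hW)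
  have h2 : (⌊Real.log W⌋₊ : ℝ) ≤ Real.log W := Nat.floor_le (Real.log_natCast_nonneg W)
  have h3 : 1 ≤ 1 / Real.log 2 * Real.log W := by
    rw [one_div_mul_eq_div, le_div_iff₀ h0]
    linarith
  rw [logCeil]
  push_cast
  linarith

/-- The constant in the number of centers. -/
def centersConst (d N₀ : ℕ) : ℝ := (9 * sampleRate d N₀ + 1) * (1 + 1 / Real.log 2) ^ 3

theorem centersConst_bound (d N₀ k : ℕ) {W : ℕ} (hW : 2 ≤ W) :
    (9 * sampleRate d N₀ + 1 : ℝ) * (k * logCeil W ^ 3) ≤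
      centersConst d N₀ * (k * Real.log W ^ 3) := by
  have h := pow_le_pow_left₀ (Nat.cast_nonneg _) (logCeil_le hW) 3
  calc (9 * sampleRate d N₀ + 1 : ℝ) * (k * logCeil W ^ 3)
      ≤ (9 * sampleRate d N₀ + 1 : ℝ) * (k * ((1 + 1 / Real.log 2) * Real.log W) ^ 3) := by gcongr
    _ = _ := by rw [centersConst]; ring

/-- Decay of the weight says little about the number of alive points, as a few heavy points may
carry it all; each of the `O(log W)` rounds is therefore charged for all `n` points. -/
theorem exists_weighted (d : ℕ) (hd : 1 ≤ d) (c : ℝ) :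
    ∃ (A : Prog) (S B : ℝ), ∀ (n k W : ℕ), 2 ≤ W → 1 ≤ k → ∀ (p : Fin n → Pt d) (w : Fin n → ℕ),
      Function.Injective p → (∀ i, 1 ≤ w i) → ∑ i, w i = W →
      ENNReal.ofReal (1 - (W : ℝ) ^ (-c)) ≤ haltProb A (weightedInput k p w)
        (fun σ => IsGoodCenters p w k (S * (k * Real.log W ^ 3)) (output d σ)) ∧
      expectedTime A (weightedInput k p w) ≤ ENNReal.ofReal (B * (n * Real.log W ^ 2)) := by
  obtain ⟨N₀, hN₀⟩ := exists_nat_ge (max (c + 6) 1)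
  have hc := (le_max_left _ _).trans hN₀
  have hN1 : 1 ≤ N₀ := by exact_mod_cast (le_max_right _ _).trans hN₀
  set h := Real.log 2 with hh
  have h0 : 0 < h := Real.log_pos one_lt_two
  refine ⟨cluster d N₀, centersConst d N₀, clusterTime d N₀ * 10 * ((1 + 1 / h) / h), ?_⟩
  intro n k W hW2 hk p w hp hw hW
  obtain ⟨h1, h2⟩ := (cluster_bound hd hp hw hk hN1 hW hW2 hc (f := fun _ => n) monotone_const
    (fun l hl => by simpa using hl.length_le_card) (centersConst_bound d N₀ k hW2)
    (ready_weightedInput p w k)).haltProb_and_time (by positivity)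
  refine ⟨h1, h2.trans ?_⟩
  rw [← ENNReal.ofReal_natCast]
  refine ENNReal.ofReal_le_ofReal ?_
  have h3 : total (fun _ => n) W = n * rounds W := by
    have := total_linear id 0 n W
    simpa [rounds] using this
  have h4 : ((n + total (fun _ => n) W : ℕ) : ℝ) ≤ 10 * (n * logCeil W) := by
    rw [h3]
    have h5 := Nat.mul_le_mul_left n (rounds_le_logCeil (by omega : 1 ≤ W))
    have h6 := Nat.mul_le_mul_left n (one_le_logCeil W)
    have h7 : n + n * rounds W ≤ 10 * (n * logCeil W) := by
      rw [mul_left_comm] at h5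
      omega
    exact_mod_cast h7
  have h5 : (logCeil W : ℝ) ≤ (1 + 1 / h) / h * Real.log W ^ 2 := by
    have h6 : h ≤ Real.log W := Real.log_le_log two_pos (by exact_mod_cast hW2)
    refine (logCeil_le hW2).trans ?_
    rw [div_mul_eq_mul_div, le_div_iff₀ h0, mul_assoc, sq]
    have : 0 ≤ Real.log W := h0.le.trans h6
    gcongr
  calc ((clusterTime d N₀ * (n + total (fun _ => n) W) : ℕ) : ℝ)
      = clusterTime d N₀ * ((n + total (fun _ => n) W : ℕ) : ℝ) := Nat.cast_mul _ _
    _ ≤ clusterTime d N₀ * (10 * (n * ((1 + 1 / h) / h * Real.log W ^ 2))) := by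
      gcongr
      exact h4.trans (by gcongr)
    _ = _ := by ring

/-- With unit weights the number of alive points is the weight, so it decays geometrically, and the
rounds cost `O(n)` together for every `k`. -/
theorem exists_unweighted (d : ℕ) (hd : 1 ≤ d) (c : ℝ) :
    ∃ (A : Prog) (S : ℝ) (B : ℕ), ∀ (n k : ℕ), 2 ≤ n → 1 ≤ k → ∀ p : Fin n → Pt d,
      Function.Injective p →
      ENNReal.ofReal (1 - (n : ℝ) ^ (-c)) ≤ haltProb A (input k p)
        (fun σ => IsGoodCenters p (fun _ => 1) k (S * (k * Real.log n ^ 3)) (output d σ)) ∧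
      expectedTime A (input k p) ≤ ENNReal.ofReal (B * n) := by
  obtain ⟨N₀, hN₀⟩ := exists_nat_ge (max (c + 6) 1)
  have hc := (le_max_left _ _).trans hN₀
  have hN1 : 1 ≤ N₀ := by exact_mod_cast (le_max_right _ _).trans hN₀
  set u := (unitBody d).time + (assign ii (nat 0)).time + 2 with hu
  refine ⟨.seq (unitWeights d) (cluster d N₀), centersConst d N₀,
    1 + 2 * u + 9 * clusterTime d N₀, ?_⟩
  intro n k hn hk p hp
  obtain ⟨h1, h2⟩ := (Runs.seq_bound (unitWeights_runs p k) fun τ hτ =>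
    cluster_bound hd hp (fun _ => le_rfl) hk hN1 (by simp) hn hc (f := id) monotone_id
      (fun l hl => by simp) (centersConst_bound d N₀ k hn) hτ).haltProb_and_time (by positivity)
  refine ⟨h1, h2.trans ?_⟩
  rw [← ENNReal.ofReal_natCast]
  refine ENNReal.ofReal_le_ofReal ?_
  have h3 := Nat.mul_le_mul_left (clusterTime d N₀) (Nat.add_le_add_left (total_id_le n) n)
  have h4 : 1 + u * (n + 1) + clusterTime d N₀ * (n + total id n) ≤
      (1 + 2 * u + 9 * clusterTime d N₀) * n := by
    nlinarith
  exact_mod_cast h4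

end KClustering

end

/-! ### The two unweighted time bounds from the linear one. -/

theorem mainTheorem6 (d : ℕ) (hd : 1 ≤ d) (c : ℝ) (hc : 0 < c) :
    -- unweighted point sets
    (∃ (A : KClustering.Prog) (S : ℝ),
      (∀ (n k : ℕ), 2 ≤ n → 1 ≤ k →
        ∀ p : Fin n → KClustering.Pt d, Function.Injective p →
          ENNReal.ofReal (1 - (n : ℝ) ^ (-c)) ≤
            KClustering.haltProb A (KClustering.input k p) (fun σ =>
              KClustering.IsGoodCenters p (fun _ => 1) k (S * (k * Real.log n ^ 3))
                (KClustering.output d σ))) ∧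
      (∀ a : ℝ, 1 ≤ a → ∃ B : ℝ, ∀ (n k : ℕ), 2 ≤ n → 1 ≤ k →
        ∀ p : Fin n → KClustering.Pt d, Function.Injective p →
          ((k : ℝ) ≤ a * (n : ℝ) ^ (1 / 4 : ℝ) →
            KClustering.expectedTime A (KClustering.input k p) ≤ ENNReal.ofReal (B * n)) ∧
          (a * (n : ℝ) ^ (1 / 4 : ℝ) < (k : ℝ) →
            KClustering.expectedTime A (KClustering.input k p) ≤
              ENNReal.ofReal (B * (n * Real.log (k * Real.log n)))))) ∧
    -- weighted point sets, of total weight W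
    (∃ (A : KClustering.Prog) (S B : ℝ),
      ∀ (n k W : ℕ), 2 ≤ W → 1 ≤ k →
        ∀ (p : Fin n → KClustering.Pt d) (w : Fin n → ℕ), Function.Injective p →
          (∀ i, 1 ≤ w i) → ∑ i, w i = W →
          ENNReal.ofReal (1 - (W : ℝ) ^ (-c)) ≤
            KClustering.haltProb A (KClustering.weightedInput k p w) (fun σ =>
              KClustering.IsGoodCenters p w k (S * (k * Real.log W ^ 3))
                (KClustering.output d σ)) ∧
          KClustering.expectedTime A (KClustering.weightedInput k p w) ≤
            ENNReal.ofReal (B * (n * Real.log W ^ 2))) := by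
  refine ⟨?_, KClustering.exists_weighted d hd c⟩
  obtain ⟨A, S, B, h⟩ := KClustering.exists_unweighted d hd c
  refine ⟨A, S, fun n k hn hk p hp => (h n k hn hk p hp).1, fun a ha => ?_⟩
  -- Beyond the threshold `k ≥ 2`, and `n ≥ 2`, so `log (k * log n)` is at least `log (2 * log 2)`.
  -- This is positive since `2 * log 2 > 1`, hence the linear bound implies the second one at the
  -- price of a factor `1 / γ`.
  set γ := Real.log (2 * Real.log 2) with hγ
  have hγ0 : 0 < γ := Real.log_pos (by linarith [Real.log_two_gt_d9])
  have hB : (0 : ℝ) ≤ B := Nat.cast_nonneg B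
  refine ⟨B * (1 + 1 / γ), fun n k hn hk p hp => ⟨fun _ => ?_, fun hlt => ?_⟩⟩
  · refine (h n k hn hk p hp).2.trans (ENNReal.ofReal_le_ofReal ?_)
    have h1 : 0 ≤ B * (1 / γ) * n := by positivity
    linarith
  · refine (h n k hn hk p hp).2.trans (ENNReal.ofReal_le_ofReal ?_)
    have hn2 : (2 : ℝ) ≤ n := by exact_mod_cast hn
    have hk2 : (2 : ℝ) ≤ k := by
      have h1 : (1 : ℝ) ≤ (n : ℝ) ^ (1 / 4 : ℝ) := Real.one_le_rpow (by linarith) (by norm_num)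
      have h2 : (1 : ℝ) < k := lt_of_le_of_lt (by nlinarith) hlt
      have h3 : 1 < k := by exact_mod_cast h2
      exact_mod_cast h3
    have hlog : γ ≤ Real.log (k * Real.log n) := by
      have h0 : 0 < Real.log 2 := Real.log_pos one_lt_two
      have h1 : Real.log 2 ≤ Real.log n := Real.log_le_log two_pos hn2
      refine Real.log_le_log (by positivity) ?_
      gcongr
    calc (B * n : ℝ) = B * (1 / γ) * (n * γ) := by field_simp
      _ ≤ B * (1 / γ) * (n * Real.log (k * Real.log n)) := by gcongr
      _ ≤ B * (1 + 1 / γ) * (n * Real.log (k * Real.log n)) := by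
        have h2 : 0 ≤ Real.log (k * Real.log n) := hγ0.le.trans hlog
        gcongr
        linarith
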